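/- Let $T^*\mathbb R^2$ have coordinates $(q,p)$, symplectic form $dq_1\wedge dp_1+dq_2\wedge dp_2$ and projection $\pi(q,p)=q$. Let $S(T^*\mathbb R^2,0)$ be the set of symplectic diffeomorphism germs on $(T^*\mathbb R^2,0)$, and let $S^l(2)$ be the smooth manifold of $l$-jets $j^lS(0)$ of its elements. For $\sigma\subset I=\{1,2\}$ let $$L_\sigma^0=\{(q,p)\in(T^*\mathbb R^2,0)\mid q_\sigma=0,\ p_{I-\sigma}=0,\ q_{I-\sigma}\ge 0\},$$ and let $\mathbb L$ be the union of the $L^0_\sigma$. Let $F(x,q)$ be a smooth function germ at $0\in\mathbb R^2\times\mathbb R^2$ with $F(0)=0$, $dF(0)=0$, for which $x_1,x_2,\partial F/\partial x_1,\partial F/\partial x_2$ are independent at $0$. It is a generating family of the reticular Lagrangian map $\pi\circ S|_{\mathbb L}$, $S\in S(T^*\mathbb R^2,0)$, if for every $\sigma\subset I$, as germs at $0$, $$S(L_\sigma^0)=\Big\{\Big(q,\frac{\partial F}{\partial q}(x,q)\Big)\ \Big|\ x_\sigma=0,\ x_{I-\sigma}\ge0,\ \frac{\partial F}{\partial x_{I-\sigma}}(x,q)=0\Big\};$$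 $S$ is then called an extension of the reticular Lagrangian embedding defined by $F$. The Lagrangian equivalence class $[S]_L$ of $S\in S(T^*\mathbb R^2,0)$ is the set of all $S'\in S(T^*\mathbb R^2,0)$ with $\Theta\circ S=S'\circ\varphi$ for some $\Theta,\varphi\in S(T^*\mathbb R^2,0)$ such that $\pi\circ\Theta=g\circ\pi$ for a diffeomorphism germ $g$ on $(\mathbb R^2,0)$, and $\varphi(L^0_\sigma)=L^0_\sigma$ for all $\sigma\subset I$. If $S$ is an extension of the reticular Lagrangian embedding defined by $F$, the caustic-equivalence class of $S$ is $[S]_c=[S]_L\cup[S^-]_L$, where $S^-$ is an extension of the reticular Lagrangian embedding defined by $-F$ (this does not depend on the choice of $F$ and $S^-$). Let $[j^lS(0)]_c$ be the set of $l$-jets at $0$ of the elements of $[S]_c$. **Proposition.** For each $a>\frac14$ let $\pi\circ i_a$ be the reticular Lagrangian map with generating family $x_1^2+x_1x_2+ax_2^2+q_1x_1+q_2x_2$, and let $S_a\in S(T^*\mathbb R^2,0)$ be any extension of $i_a$. Then for every $l\ge1$ the weak caustic-equivalence class $$[j^lS_1(0)]_w:=\bigcup_{a>\frac14}[j^lS_a(0)]_c$$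 is an immersed manifold in $S^l(2)$, that is, the image of an injective smooth immersion into $S^l(2)$ of a second countable Hausdorff smooth manifold of constant dimension. -/

import Mathlib

open Filter Topology
open scoped Manifold ContDiff

namespace RetLag

/-! Reticular Lagrangian maps over a `2`-dimensional base with an `r = 2` corner.
Germs at `0` are represented by globally defined functions; every condition below only involves
their values near `0`. -/

/-- The plane `ℝ²`. -/
abbrev Plane : Type := Fin 2 → ℝ

/-- The cotangent bundle `T*ℝ²` with canonical coordinates `(q, p)`. -/
abbrev Phase : Type := Plane × Plane

/-- The canonical symplectic form `dq₁ ∧ dp₁ + dq₂ ∧ dp₂`. -/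
def omega (u v : Phase) : ℝ := ∑ i, (u.1 i * v.2 i - u.2 i * v.1 i)

/-- `f` represents a smooth map germ `(E, 0) → (E', 0)`. -/
def IsSmoothGerm {E E' : Type*} [NormedAddCommGroup E] [NormedSpace ℝ E]
    [NormedAddCommGroup E'] [NormedSpace ℝ E'] (f : E → E') : Prop :=
  f 0 = 0 ∧ ∀ᶠ z in 𝓝 0, ContDiffAt ℝ ∞ f z

/-- `g` represents a diffeomorphism germ on `(ℝ², 0)`. -/
def IsDiffeoGerm (g : Plane → Plane) : Prop :=
  IsSmoothGerm g ∧ Function.Bijective (fderiv ℝ g 0)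

/-- `S` represents an element of `S(T*ℝ², 0)`, a symplectic diffeomorphism germ on `(T*ℝ², 0)`.
Its derivative at `0` preserves a nondegenerate form, hence is invertible, so that `S` is
a diffeomorphism germ. -/
def IsSympGerm (S : Phase → Phase) : Prop :=
  IsSmoothGerm S ∧
    ∀ᶠ z in 𝓝 0, ∀ u v : Phase, omega (fderiv ℝ S z u) (fderiv ℝ S z v) = omega u v

/-- `L_σ⁰ = {(q, p) | q_σ = 0, p_{I - σ} = 0, q_{I - σ} ≥ 0}` for `σ ⊂ I = {1, 2}`. -/
def cornerL (σ : Set (Fin 2)) : Set Phase :=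
  {z | (∀ i ∈ σ, z.1 i = 0) ∧ ∀ i ∉ σ, z.2 i = 0 ∧ 0 ≤ z.1 i}

/-- Reticular diffeomorphism germs: symplectic diffeomorphism germs `φ` with `φ(L_σ⁰) = L_σ⁰`
for all `σ`. The image under `φ` of the germ at `0` of a set `A` is the filter
`map φ (𝓝[A] 0)`, which is generated by the sets `φ(A ∩ U)`, `U` a neighbourhood of `0`. -/
def IsReticular (φ : Phase → Phase) : Prop :=
  IsSympGerm φ ∧ ∀ σ : Set (Fin 2), map φ (𝓝[cornerL σ] 0) = 𝓝[cornerL σ] 0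

/-- Lagrangian equivalences of `π : T*ℝ² → ℝ²`, `π(q, p) = q`: symplectic diffeomorphism germs `Θ`
on `(T*ℝ², 0)` which cover a diffeomorphism germ `g` of the base, `π ∘ Θ = g ∘ π`. -/
def IsLagrangianEquivalence (Θ : Phase → Phase) : Prop :=
  IsSympGerm Θ ∧ ∃ g : Plane → Plane, IsDiffeoGerm g ∧ ∀ᶠ z in 𝓝 0, (Θ z).1 = g z.1

/-- The Lagrangian equivalence class `[S]_L`: all `S'` in `S(T*ℝ², 0)` such that
`Θ ∘ S = S' ∘ φ` for a Lagrangian equivalence `Θ` and a reticular diffeomorphism germ `φ`. -/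
def lagrangianClass (S : Phase → Phase) : Set (Phase → Phase) :=
  {S' | IsSympGerm S' ∧ ∃ Θ φ : Phase → Phase, IsLagrangianEquivalence Θ ∧ IsReticular φ ∧
    Θ ∘ S =ᶠ[𝓝 0] S' ∘ φ}

/-! ### Generating families `F(x, q)`, written as functions of the pair `(x, q)` -/

/-- `∂F/∂xᵢ`. -/
noncomputable def dX (F : Plane × Plane → ℝ) (i : Fin 2) (z : Plane × Plane) : ℝ :=
  fderiv ℝ F z (Pi.single i 1, 0)

/-- `∂F/∂qᵢ`. -/
noncomputable def dQ (F : Plane × Plane → ℝ) (i : Fin 2) (z : Plane × Plane) : ℝ :=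
  fderiv ℝ F z (0, Pi.single i 1)

/-- `{(x, q) | x_σ = 0, x_{I - σ} ≥ 0, ∂F/∂x_{I - σ} = 0}`. -/
def critSet (F : Plane × Plane → ℝ) (σ : Set (Fin 2)) : Set (Plane × Plane) :=
  {z | (∀ i ∈ σ, z.1 i = 0) ∧ ∀ i ∉ σ, 0 ≤ z.1 i ∧ dX F i z = 0}

/-- `(x, q) ↦ (q, ∂F/∂q(x, q))`. -/
noncomputable def conormal (F : Plane × Plane → ℝ) (z : Plane × Plane) : Phase :=
  (z.2, fun i => dQ F i z)

/-- `F(x, q)` is a generating family of the reticular Lagrangian map `π ∘ S|_𝕃`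
(equivalently, `S` is an extension of the reticular Lagrangian embedding defined by `F`):
* `F` is smooth near `0`, with `F(0) = 0` and `dF(0) = 0`;
* `F` is nondegenerate: `x₁, x₂, ∂F/∂x₁, ∂F/∂x₂` are independent at `0`;
* for every `σ` the restriction of `F` to `x_σ = 0` generates the Lagrangian germ `S(L_σ⁰)`, i.e.
  `S(L_σ⁰) = {(q, ∂F/∂q) | x_σ = 0, x_{I - σ} ≥ 0, ∂F/∂x_{I - σ} = 0}` as germs at `0`. -/
structure IsGeneratingFamily (F : Plane × Plane → ℝ) (S : Phase → Phase) : Prop where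
  smooth : IsSmoothGerm F
  critical : fderiv ℝ F 0 = 0
  nondegenerate : LinearIndependent ℝ
    (Sum.elim (fun i : Fin 2 => fderiv ℝ (fun z : Plane × Plane => z.1 i) 0)
      (fun i : Fin 2 => fderiv ℝ (dX F i) 0))
  generates : ∀ σ : Set (Fin 2),
    map S (𝓝[cornerL σ] 0) = map (conormal F) (𝓝[critSet F σ] 0)

/-- The family `F_a(x, q) = x₁² + x₁x₂ + a x₂² + q₁x₁ + q₂x₂`. -/
def familyB (a : ℝ) (z : Plane × Plane) : ℝ :=
  z.1 0 ^ 2 + z.1 0 * z.1 1 + a * z.1 1 ^ 2 + z.2 0 * z.1 0 + z.2 1 * z.1 1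

/-- The caustic-equivalence class `[S]_c = [S⁺]_L ∪ [S⁻]_L`, where `S⁺ = S` is an extension of the
reticular Lagrangian embedding defined by a generating family `F`, and `S⁻` is an extension
of the one defined by `-F`. -/
def causticClass (S : Phase → Phase) : Set (Phase → Phase) :=
  {S' | S' ∈ lagrangianClass S ∨
    ∃ (F : Plane × Plane → ℝ) (T : Phase → Phase), IsGeneratingFamily F S ∧
      IsSympGerm T ∧ IsGeneratingFamily (-F) T ∧ S' ∈ lagrangianClass T}

/-! ### Jets -/

/-- The finite-dimensional vector space in which `l`-jets at `0` of maps `T*ℝ² → T*ℝ²` live: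
a jet is the tuple of its derivatives of orders `0, …, l` at `0`. -/
abbrev JetSpace (l : ℕ) : Type :=
  (k : Fin (l + 1)) → ContinuousMultilinearMap ℝ (fun _ : Fin (k : ℕ) => Phase) Phase

/-- The `l`-jet `j^l S(0)`. -/
noncomputable def jet (l : ℕ) (S : Phase → Phase) : JetSpace l :=
  fun k => iteratedFDeriv ℝ (k : ℕ) S 0

/-- `S^l(2)`, the `l`-jets at `0` of symplectic diffeomorphism germs on `(T*ℝ², 0)`. -/
def sympJets (l : ℕ) : Set (JetSpace l) := jet l '' {S | IsSympGerm S}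

/-- `[j^l S(0)]_c`, the `l`-jets of the elements of `[S]_c`. -/
def causticJets (l : ℕ) (S : Phase → Phase) : Set (JetSpace l) := jet l '' causticClass S

/-- `[j^l S₁(0)]_w = ⋃_{a > 1/4} [j^l S_a(0)]_c`. -/
def weakCausticJets (l : ℕ) (S : ℝ → Phase → Phase) : Set (JetSpace l) :=
  ⋃ a ∈ Set.Ioi (1 / 4 : ℝ), causticJets l (S a)

/-- `W` is an immersed manifold in `N`, where `N` is a submanifold of the vector space `V`:
`W ⊆ N` is the image of an injective smooth immersion of a second countable Hausdorff smooth
manifold `M` without boundary, of some constant dimension `d`. Since `N` carries the smooth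
structure of a submanifold of `V`, a map with values in `N` is a smooth immersion into `N`
if and only if it is one into `V`. -/
def IsImmersedManifoldIn {V : Type*} [NormedAddCommGroup V] [NormedSpace ℝ V]
    (N W : Set V) : Prop :=
  W ⊆ N ∧ ∃ (d : ℕ) (M : Type) (_ : TopologicalSpace M)
    (_ : ChartedSpace (EuclideanSpace ℝ (Fin d)) M) (_ : IsManifold (𝓡 d) ∞ M)
    (_ : T2Space M) (_ : SecondCountableTopology M) (ι : M → V),
    ContMDiff (𝓡 d) 𝓘(ℝ, V) ∞ ι ∧ Function.Injective ι ∧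
    (∀ x : M, Function.Injective (mfderiv (𝓡 d) 𝓘(ℝ, V) ι x)) ∧
    Set.range ι = W

end RetLag

namespace RetLag

open Asymptotics

section Taylor

variable {E F : Type*} [NormedAddCommGroup E] [NormedSpace ℝ E]
  [NormedAddCommGroup F] [NormedSpace ℝ F]

/-- The leading term of the Taylor expansion. -/
theorem taylor_leading [CompleteSpace F] {f : E → F} (hf : ContDiffAt ℝ ∞ f 0) (k : ℕ)
    (h : ∀ j < k, iteratedFDeriv ℝ j f 0 = 0) :
    (fun z => f z - (k.factorial : ℝ)⁻¹ • iteratedFDeriv ℝ k f 0 fun _ => z)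
      =o[𝓝 0] fun z : E => ‖z‖ ^ k := by
  rcases k with _ | k
  · have hc : Tendsto f (𝓝 0) (𝓝 (f 0)) := hf.continuousAt
    simpa [sub_eq_add_neg] using (isLittleO_one_iff ℝ).2 (hc.sub_const (f 0) |>.trans (by simp))
  have hn : ContDiffAt ℝ (k + 1 : ℕ) f 0 := hf.of_le (by exact_mod_cast le_top)
  have hev : ∀ᶠ z in 𝓝 (0 : E), ContDiffAt ℝ (k + 1 : ℕ) f z := hn.eventually (by simp)
  have hcont : ContinuousAt (iteratedFDeriv ℝ (k + 1) f) 0 :=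
    hn.continuousAt_iteratedFDeriv (by simp)
  obtain ⟨r, hr, hball⟩ := Metric.eventually_nhds_iff_ball.1 hev
  refine isLittleO_iff.2 fun c hc => ?_
  obtain ⟨r', hr', hball'⟩ := Metric.eventually_nhds_iff_ball.1
    (hcont.eventually (Metric.ball_mem_nhds _ hc))
  filter_upwards [Metric.ball_mem_nhds (0 : E) (lt_min hr hr')] with y hy
  have hty : ∀ t ∈ Set.Icc (0 : ℝ) 1, t • y ∈ Metric.ball (0 : E) (min r r') := by
    intro t ht
    rw [mem_ball_zero_iff] at hy ⊢
    calc ‖t • y‖ = t * ‖y‖ := by rw [norm_smul, Real.norm_of_nonneg ht.1]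
      _ ≤ 1 * ‖y‖ := by gcongr; exact ht.2
      _ < _ := by simpa using hy
  have hT := map_add_eq_sum_add_integral_iteratedFDeriv (f := f) (x := 0) (y := y) (n := k)
    (fun t ht => by
      rw [zero_add]
      exact_mod_cast hball _ (Metric.ball_subset_ball (min_le_left _ _) (hty t ht)))
  rw [Finset.sum_eq_zero (fun j hj => by
    rw [h j (by simpa using hj)]; simp)] at hT
  simp only [zero_add] at hT
  set c₀ := iteratedFDeriv ℝ (k + 1) f 0 with hc₀
  have hI : ∫ t in (0 : ℝ)..1, (1 - t) ^ k = ((k : ℝ) + 1)⁻¹ := by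
    rw [intervalIntegral.integral_comp_sub_left (fun t : ℝ => t ^ k) 1]
    simp [integral_pow]
  have hcst : (((k + 1).factorial : ℕ) : ℝ)⁻¹ • (c₀ fun _ => y) =
      (k.factorial : ℝ)⁻¹ • ∫ t in (0 : ℝ)..1, (1 - t) ^ k • c₀ fun _ => y := by
    rw [intervalIntegral.integral_smul_const, hI, smul_smul, Nat.factorial_succ]
    push_cast
    rw [mul_inv, mul_comm]
  have hcontOn : ContinuousOn (fun t : ℝ => (1 - t) ^ k •
      (iteratedFDeriv ℝ (k + 1) f (t • y)) fun _ => y) (Set.uIcc 0 1) := by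
    intro t ht
    rw [Set.uIcc_of_le zero_le_one] at ht
    have h1 : ContinuousAt (iteratedFDeriv ℝ (k + 1) f) (t • y) :=
      (hball _ (Metric.ball_subset_ball (min_le_left _ _) (hty t ht))).continuousAt_iteratedFDeriv
        (by simp)
    have h2 : ContinuousAt (fun t : ℝ => iteratedFDeriv ℝ (k + 1) f (t • y)) t :=
      ContinuousAt.comp (f := fun t : ℝ => t • y) h1 (by fun_prop)
    have h3 : ContinuousAt (fun t : ℝ => iteratedFDeriv ℝ (k + 1) f (t • y) fun _ => y) t :=
      h2.eval_const _
    exact (ContinuousAt.smul (by fun_prop) h3).continuousWithinAt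
  rw [hT, hcst, ← smul_sub, ← intervalIntegral.integral_sub hcontOn.intervalIntegrable
    (by apply Continuous.intervalIntegrable; fun_prop), norm_smul]
  have hb : ‖∫ t in (0 : ℝ)..1, ((1 - t) ^ k • (iteratedFDeriv ℝ (k + 1) f (t • y)) (fun _ => y) -
      (1 - t) ^ k • c₀ fun _ => y)‖ ≤ (c * ‖y‖ ^ (k + 1)) * |(1 : ℝ) - 0| := by
    refine intervalIntegral.norm_integral_le_of_norm_le_const fun t ht => ?_
    rw [Set.uIoc_of_le zero_le_one] at ht
    have ht' : t ∈ Set.Icc (0 : ℝ) 1 := ⟨ht.1.le, ht.2⟩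
    rw [← smul_sub, norm_smul, ← sub_apply]
    have h1 : ‖(1 - t) ^ k‖ ≤ 1 := by
      rw [norm_pow, Real.norm_of_nonneg (by linarith [ht.2])]
      exact pow_le_one₀ (by linarith [ht.2]) (by linarith [ht.1])
    have h2 : ‖iteratedFDeriv ℝ (k + 1) f (t • y) - c₀‖ ≤ c := by
      have := hball' _ (Metric.ball_subset_ball (min_le_right _ _) (hty t ht'))
      rw [dist_eq_norm] at this
      exact this.le
    calc _ ≤ 1 * (‖iteratedFDeriv ℝ (k + 1) f (t • y) - c₀‖ * ∏ _i : Fin (k + 1), ‖y‖) := by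
          gcongr
          exact ContinuousMultilinearMap.le_opNorm _ _
      _ ≤ _ := by
          simp only [Finset.prod_const, Finset.card_univ, Fintype.card_fin, one_mul]
          gcongr
  have hk1 : ‖((k.factorial : ℕ) : ℝ)⁻¹‖ ≤ 1 := by
    rw [norm_inv, Real.norm_natCast]
    exact inv_le_one_of_one_le₀ (by exact_mod_cast k.factorial_pos)
  rw [norm_pow, norm_norm]
  refine (mul_le_mul hk1 hb (norm_nonneg _) zero_le_one).trans_eq ?_
  simp

theorem contDiffAt_multilinear_apply {G : Type*} [NormedAddCommGroup G] [NormedSpace ℝ G] {n : ℕ}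
    {N : WithTop ℕ∞} {f : G → E [×n]→L[ℝ] F} {x : G} (hf : ContDiffAt ℝ N f x) (v : Fin n → E) :
    ContDiffAt ℝ N (fun y => f y v) x :=
  (ContinuousMultilinearMap.apply ℝ (fun _ : Fin n => E) F v).contDiff.contDiffAt.comp x hf

/-- The iterated derivatives of a smooth function are symmetric. -/
theorem iteratedFDeriv_perm (n : ℕ) {f : E → F} {x : E} (hf : ContDiffAt ℝ n f x)
    (σ : Equiv.Perm (Fin n)) (v : Fin n → E) :
    iteratedFDeriv ℝ n f x (v ∘ σ) = iteratedFDeriv ℝ n f x v := by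
  induction n generalizing x with
  | zero => congr 1; ext i; exact i.elim0
  | succ n ih =>
  have hdiff : ∀ m : ℕ, m ≤ n → ∀ y, ContDiffAt ℝ (n + 1 : ℕ) f y →
      DifferentiableAt ℝ (iteratedFDeriv ℝ m f) y := fun m hm y hy =>
    hy.differentiableAt_iteratedFDeriv (by exact_mod_cast Nat.lt_succ_of_le hm)
  have hev : ∀ᶠ y in 𝓝 x, ContDiffAt ℝ (n + 1 : ℕ) f y := hf.eventually (by simp)
  have key : ∀ (i : Fin n) (v : Fin (n + 1) → E),
      iteratedFDeriv ℝ (n + 1) f x (v ∘ Equiv.swap i.castSucc i.succ) =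
        iteratedFDeriv ℝ (n + 1) f x v := by
    intro i v
    rcases n with _ | n
    · exact i.elim0
    refine Fin.cases ?_ (fun i => ?_) i
    · have h2 : ∀ w : Fin (n + 2) → E, iteratedFDeriv ℝ (n + 2) f x w =
          fderiv ℝ (fderiv ℝ fun y => iteratedFDeriv ℝ n f y (Fin.tail (Fin.tail w))) x
            (w 0) (w 1) := by
        intro w
        have hg : ContDiffAt ℝ 2 (fun y => iteratedFDeriv ℝ n f y (Fin.tail (Fin.tail w))) x :=
          contDiffAt_multilinear_apply
            (hf.iteratedFDeriv_right (by norm_cast; omega)) _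
        rw [(hdiff (n + 1) le_rfl x hf).iteratedFDeriv_succ_apply_left']
        have : (fun y => iteratedFDeriv ℝ (n + 1) f y (Fin.tail w)) =ᶠ[𝓝 x] fun y =>
            fderiv ℝ (fun y => iteratedFDeriv ℝ n f y (Fin.tail (Fin.tail w))) y (w 1) := by
          filter_upwards [hev] with y hy
          rw [(hdiff n (by omega) y hy).iteratedFDeriv_succ_apply_left']
          rfl
        rw [this.fderiv_eq, fderiv_clm_apply
          ((hg.fderiv_right (m := 1) (by norm_num)).differentiableAt (by simp)) (by fun_prop)]
        simp
      rw [h2, h2]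
      have ht : Fin.tail (Fin.tail (v ∘ Equiv.swap (Fin.castSucc (0 : Fin (n + 1)))
          (Fin.succ 0))) = Fin.tail (Fin.tail v) := by
        ext j
        simp only [Fin.tail, Function.comp]
        rw [Equiv.swap_apply_of_ne_of_ne]
        · simp [Fin.ext_iff]
        · simp [Fin.ext_iff]
      rw [ht]
      have hg : ContDiffAt ℝ 2 (fun y => iteratedFDeriv ℝ n f y (Fin.tail (Fin.tail v))) x :=
        contDiffAt_multilinear_apply
            (hf.iteratedFDeriv_right (by norm_cast; omega)) _
      have := (hg.isSymmSndFDerivAt (by simp)).eq (v 1) (v 0)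
      simpa using this
    · rw [(hdiff (n + 1) le_rfl x hf).iteratedFDeriv_succ_apply_left',
        (hdiff (n + 1) le_rfl x hf).iteratedFDeriv_succ_apply_left']
      have h0 : (v ∘ Equiv.swap (Fin.castSucc i.succ) (Fin.succ i.succ)) 0 = v 0 := by
        simp only [Function.comp]
        rw [Equiv.swap_apply_of_ne_of_ne]
        · simp [Fin.ext_iff]
        · simp [Fin.ext_iff]
      have ht : Fin.tail (v ∘ Equiv.swap (Fin.castSucc i.succ) (Fin.succ i.succ)) =
          Fin.tail v ∘ Equiv.swap i.castSucc i.succ := by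
        ext j
        simp only [Fin.tail, Function.comp, ← Fin.succ_castSucc]
        rw [(Fin.succ_injective _).map_swap]
      rw [h0, ht]
      congr 1
      refine Filter.EventuallyEq.fderiv_eq ?_
      filter_upwards [hev] with y hy using
        ih (hy.of_le (by exact_mod_cast Nat.le_succ _)) _ _
  have hσ : σ ∈ Submonoid.closure
      (Set.range fun i : Fin n => Equiv.swap i.castSucc i.succ) := by
    rw [Equiv.Perm.mclosure_swap_castSucc_succ]; trivial
  induction hσ using Submonoid.closure_induction generalizing v with
  | mem σ h => obtain ⟨i, rfl⟩ := h; exact key i v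
  | one => rfl
  | mul σ τ _ _ h1 h2 =>
    have : v ∘ ⇑(σ * τ) = (v ∘ σ) ∘ τ := rfl
    rw [this, h2, h1]

theorem diag_eq_zero_of_isLittleO {k : ℕ} (P : E → F)
    (hP : ∀ s : ℝ, 0 < s → ∀ z, P (s • z) = s ^ k • P z)
    (h : P =o[𝓝 0] fun z => ‖z‖ ^ k) (z : E) : P z = 0 := by
  have ht : Tendsto (fun s : ℝ => s • z) (𝓝[>] 0) (𝓝 0) := by
    have : Tendsto (fun s : ℝ => s • z) (𝓝 0) (𝓝 ((0 : ℝ) • z)) := by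
      exact Continuous.tendsto (by fun_prop) _
    rw [zero_smul] at this
    exact this.mono_left nhdsWithin_le_nhds
  have h1 := h.comp_tendsto ht
  have h2 : (fun s : ℝ => s ^ k • P z) =o[𝓝[>] 0] fun s : ℝ => s ^ k * ‖z‖ ^ k := by
    refine h1.congr' ?_ ?_
    · filter_upwards [self_mem_nhdsWithin] with s hs using hP s hs z
    · filter_upwards [self_mem_nhdsWithin] with s hs
      simp [norm_smul, mul_pow, abs_of_pos (Set.mem_Ioi.1 hs)]
  have h3 : (fun _ : ℝ => P z) =o[𝓝[>] 0] fun _ : ℝ => ‖z‖ ^ k := by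
    have := (isBigO_refl (fun s : ℝ => (s ^ k)⁻¹) (𝓝[>] 0)).smul_isLittleO h2
    refine this.congr' ?_ ?_ <;>
    · filter_upwards [self_mem_nhdsWithin] with s hs
      have : s ≠ 0 := (Set.mem_Ioi.1 hs).ne'
      simp [this]
  by_contra hz
  have h4 := h3.def (c := ‖P z‖ / (2 * (‖z‖ ^ k + 1))) (by positivity)
  obtain ⟨s, hs⟩ := h4.exists
  have h5 : 0 ≤ ‖z‖ ^ k := by positivity
  have h6 : 0 < ‖P z‖ := norm_pos_iff.2 hz
  rw [Real.norm_of_nonneg h5, div_mul_eq_mul_div, le_div_iff₀ (by positivity)] at hs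
  nlinarith

theorem isLittleO_norm_pow_mono {E F : Type*} [NormedAddCommGroup E] [NormedAddCommGroup F]
    {f : E → F} {j k : ℕ} (hjk : j ≤ k)
    (h : f =o[𝓝 0] fun z => ‖z‖ ^ k) : f =o[𝓝 0] fun z => ‖z‖ ^ j := by
  refine h.trans_isBigO (IsBigO.of_bound 1 ?_)
  filter_upwards [Metric.ball_mem_nhds (0 : E) one_pos] with z hz
  rw [mem_ball_zero_iff] at hz
  simpa using pow_le_pow_of_le_one (norm_nonneg z) hz.le hjk

/-- For smooth functions, flatness to order `k` is the vanishing of the `k`-jet. -/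
theorem isLittleO_iff_iteratedFDeriv [CompleteSpace F] {f : E → F} (hf : ContDiffAt ℝ ∞ f 0) (k : ℕ) :
    (f =o[𝓝 0] fun z => ‖z‖ ^ k) ↔ ∀ j ≤ k, iteratedFDeriv ℝ j f 0 = 0 := by
  refine ⟨fun h j => ?_, fun h => ?_⟩
  · induction j using Nat.strong_induction_on with
    | _ j ih =>
    intro hj
    have h1 := taylor_leading hf j (fun i hi => ih i hi (by omega))
    have h2 := (isLittleO_norm_pow_mono hj h).sub h1
    simp only [sub_sub_cancel] at h2
    have h3 : ∀ z, (iteratedFDeriv ℝ j f 0 fun _ => z) = 0 := by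
      intro z
      have := diag_eq_zero_of_isLittleO (k := j)
        (fun z => (j.factorial : ℝ)⁻¹ • iteratedFDeriv ℝ j f 0 fun _ => z) (fun s _ z => by
          rw [(iteratedFDeriv ℝ j f 0).map_smul_univ (fun _ => s) (fun _ => z)]
          simp only [Finset.prod_const, Finset.card_univ, Fintype.card_fin]
          rw [smul_comm]) h2 z
      simpa [Nat.factorial_ne_zero] using this
    ext v
    have h4 := (iteratedFDeriv ℝ j f 0).iteratedFDeriv_comp_diagonal 0 v
    simp only [h3] at h4
    have h5 : ∀ σ : Equiv.Perm (Fin j), iteratedFDeriv ℝ j f 0 (fun i => v (σ i)) =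
        iteratedFDeriv ℝ j f 0 v := fun σ =>
      iteratedFDeriv_perm j (hf.of_le (by exact_mod_cast le_top)) σ v
    simp only [h5, Finset.sum_const, Finset.card_univ, Fintype.card_perm, Fintype.card_fin,
      iteratedFDeriv_fun_zero] at h4
    have h6 := h4.symm
    rw [← Nat.cast_smul_eq_nsmul ℝ] at h6
    simpa [Nat.factorial_ne_zero] using h6
  · have := taylor_leading hf k (fun j hj => h j hj.le)
    simpa [h k le_rfl] using this

theorem isLittleO_fderiv [CompleteSpace F] {f : E → F} (hf : ContDiffAt ℝ ∞ f 0) {k : ℕ}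
    (h : f =o[𝓝 0] fun z => ‖z‖ ^ (k + 1)) :
    fderiv ℝ f =o[𝓝 0] fun z => ‖z‖ ^ k := by
  rw [isLittleO_iff_iteratedFDeriv hf] at h
  rw [isLittleO_iff_iteratedFDeriv (hf.fderiv_right (by simp))]
  intro j hj
  have h1 := h (j + 1) (by omega)
  rw [iteratedFDeriv_succ_eq_comp_right] at h1
  exact (LinearIsometryEquiv.map_eq_zero_iff _).1 h1

end Taylor

section PosHom

variable {E F : Type*} [NormedAddCommGroup E] [NormedSpace ℝ E]
  [NormedAddCommGroup F] [NormedSpace ℝ F]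

/-- Positive homogeneity of degree `k`. -/
def PosHom (k : ℕ) (P : E → F) : Prop := ∀ s : ℝ, 0 < s → ∀ z, P (s • z) = s ^ k • P z

theorem PosHom.eq_zero_of_isLittleO {k : ℕ} {P : E → F} (hP : PosHom k P)
    (h : P =o[𝓝 0] fun z => ‖z‖ ^ k) : P = 0 := by
  funext z
  exact diag_eq_zero_of_isLittleO P hP h z

theorem PosHom.isBigO {k : ℕ} {P : E → F} (hP : PosHom k P) (hc : ContinuousAt P 0) :
    P =O[𝓝 0] fun z => ‖z‖ ^ k := by
  obtain ⟨r, hr, hb⟩ := Metric.eventually_nhds_iff_ball.1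
    (hc.norm.eventually (gt_mem_nhds (lt_add_one ‖P 0‖)))
  refine IsBigO.of_bound ((‖P 0‖ + 1) * (r / 2)⁻¹ ^ k) (Eventually.of_forall fun z => ?_)
  rcases eq_or_ne z 0 with rfl | hz
  · rcases k with _ | k
    · simp
    · have h2 := hP 2 two_pos 0
      rw [smul_zero] at h2
      have h3 : ((2 : ℝ) ^ (k + 1) - 1) • P 0 = 0 := by rw [sub_smul, ← h2]; simp
      have h4 : (1 : ℝ) < 2 ^ (k + 1) := one_lt_pow₀ one_lt_two (by omega)
      have h5 : P 0 = 0 := (smul_eq_zero.1 h3).resolve_left (by linarith)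
      simp [h5]
  · have hz' : 0 < ‖z‖ := norm_pos_iff.2 hz
    have h1 : ‖(r / 2 * ‖z‖⁻¹) • z‖ < r := by
      rw [norm_smul, Real.norm_of_nonneg (by positivity), mul_assoc, inv_mul_cancel₀ hz'.ne']
      linarith
    have h2 := hb _ (mem_ball_zero_iff.2 h1)
    have h3 : z = ((r / 2)⁻¹ * ‖z‖) • ((r / 2 * ‖z‖⁻¹) • z) := by
      rw [smul_smul]
      have : (r / 2)⁻¹ * ‖z‖ * (r / 2 * ‖z‖⁻¹) = 1 := by field_simp
      rw [this, one_smul]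
    rw [h3, hP _ (by positivity), ← h3, norm_smul, norm_pow, norm_pow, norm_norm,
      Real.norm_of_nonneg (by positivity), mul_pow]
    calc (r / 2)⁻¹ ^ k * ‖z‖ ^ k * ‖P ((r / 2 * ‖z‖⁻¹) • z)‖
        ≤ (r / 2)⁻¹ ^ k * ‖z‖ ^ k * (‖P 0‖ + 1) := by gcongr
      _ = _ := by ring

/-- Smooth positively homogeneous maps are polynomial. -/
theorem PosHom.eq_diag [CompleteSpace F] {k : ℕ} {P : E → F} (hP : PosHom k P)
    (hs : ContDiffAt ℝ ∞ P 0) (z : E) :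
    P z = (k.factorial : ℝ)⁻¹ • iteratedFDeriv ℝ k P 0 fun _ => z := by
  have h0 : ∀ j < k, iteratedFDeriv ℝ j P 0 = 0 := by
    intro j hj
    refine (isLittleO_iff_iteratedFDeriv hs j).1 ?_ j le_rfl
    refine (hP.isBigO hs.continuousAt).trans_isLittleO ?_
    have := (isLittleO_pow_pow (𝕜 := ℝ) hj).comp_tendsto (tendsto_norm_zero (E := E))
    exact this
  have h1 := taylor_leading hs k h0
  have h2 : PosHom k fun z => P z - (k.factorial : ℝ)⁻¹ • iteratedFDeriv ℝ k P 0 fun _ => z := by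
    intro s hs z
    change P (s • z) - (k.factorial : ℝ)⁻¹ • iteratedFDeriv ℝ k P 0 (fun _ => s • z) = _
    rw [hP s hs, (iteratedFDeriv ℝ k P 0).map_smul_univ (fun _ => s) (fun _ => z)]
    simp only [Finset.prod_const, Finset.card_univ, Fintype.card_fin]
    rw [smul_comm, smul_sub]
  exact sub_eq_zero.1 (congrFun (h2.eq_zero_of_isLittleO h1) z)

theorem PosHom.comp_sub_isLittleO [CompleteSpace F] {k : ℕ} {P : E → F} (hP : PosHom k P)
    (hs : ContDiffAt ℝ ∞ P 0) {f : E → E} (hf : (fun z => f z - z) =o[𝓝 0] fun z => ‖z‖) :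
    (fun z => P (f z) - P z) =o[𝓝 0] fun z => ‖z‖ ^ k := by
  rcases k with _ | k
  · have : ∀ z w, P z = P w := by
      intro z w
      rw [hP.eq_diag hs, hP.eq_diag hs]
      congr 2
      ext i
      exact i.elim0
    refine (isLittleO_zero _ _).congr_left fun z => (sub_eq_zero.2 (this _ _)).symm
  set c := (((k + 1).factorial : ℕ) : ℝ)⁻¹ • iteratedFDeriv ℝ (k + 1) P 0 with hc
  have hPc : ∀ z, P z = c fun _ => z := fun z => by rw [hP.eq_diag hs, hc]; rfl
  have hb : ∀ᶠ z in 𝓝 (0 : E), ‖P (f z) - P z‖ ≤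
      (‖c‖ * (k + 1) * 2 ^ k) * ‖‖z‖ ^ k * ‖f z - z‖‖ := by
    filter_upwards [hf.def one_pos] with z hz
    rw [one_mul, norm_norm] at hz
    have h2 : ‖f z‖ ≤ 2 * ‖z‖ := by
      calc ‖f z‖ = ‖(f z - z) + z‖ := by simp
        _ ≤ _ := (norm_add_le _ _).trans (by linarith)
    have h3 := c.norm_image_sub_le (fun _ => f z) (fun _ => z)
    rw [← hPc, ← hPc] at h3
    refine h3.trans ?_
    have h4 : ‖(fun _ : Fin (k + 1) => f z)‖ ≤ 2 * ‖z‖ :=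
      (pi_norm_le_iff_of_nonneg (by positivity)).2 fun _ => h2
    have h5 : ‖(fun _ : Fin (k + 1) => z)‖ ≤ 2 * ‖z‖ :=
      (pi_norm_le_iff_of_nonneg (by positivity)).2 fun _ => by linarith [norm_nonneg z]
    have h6 : ‖(fun _ : Fin (k + 1) => f z) - (fun _ => z)‖ ≤ ‖f z - z‖ :=
      (pi_norm_le_iff_of_nonneg (by positivity)).2 fun _ => le_rfl
    simp only [Fintype.card_fin, Nat.add_sub_cancel, norm_mul, norm_pow, norm_norm]
    calc _ ≤ ‖c‖ * ((k + 1 : ℕ) : ℝ) * (2 * ‖z‖) ^ k * ‖f z - z‖ := by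
          gcongr
          exact max_le h4 h5
      _ = _ := by push_cast; ring
  refine (IsBigO.of_bound _ hb).trans_isLittleO ?_
  simp only [pow_succ]
  exact (isBigO_refl _ _).mul_isLittleO hf.norm_left

theorem PosHom.fderiv {k : ℕ} {P : E → F} (hP : PosHom (k + 1) P) (hd : Differentiable ℝ P) :
    PosHom k (fderiv ℝ P) := by
  intro s hs z
  have h1 : HasFDerivAt (fun z => P (s • z)) ((_root_.fderiv ℝ P (s • z)).comp
      (s • ContinuousLinearMap.id ℝ E)) z :=
    HasFDerivAt.comp z (g := P) (f := fun z => s • z) (hd (s • z)).hasFDerivAt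
      ((s • ContinuousLinearMap.id ℝ E).hasFDerivAt)
  have h2 : HasFDerivAt (fun z => P (s • z)) (s ^ (k + 1) • _root_.fderiv ℝ P z) z := by
    simp only [hP s hs]
    exact (hd z).hasFDerivAt.const_smul _
  have h3 := h1.unique h2
  ext v
  have h4 := DFunLike.congr_fun h3 v
  simp only [ContinuousLinearMap.comp_apply, smul_apply, ContinuousLinearMap.id_apply, map_smul,
    pow_succ', mul_smul] at h4
  simpa using smul_right_injective F hs.ne' h4

/-- Euler's identity. -/
theorem PosHom.euler {k : ℕ} {P : E → F} (hP : PosHom k P) {z : E}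
    (hd : DifferentiableAt ℝ P z) : _root_.fderiv ℝ P z z = (k : ℝ) • P z := by
  have h1 : HasDerivAt (fun s : ℝ => P (s • z)) (_root_.fderiv ℝ P z z) 1 := by
    have h0 : HasFDerivAt P (_root_.fderiv ℝ P z) ((1 : ℝ) • z) := by simpa using hd.hasFDerivAt
    have := h0.comp_hasDerivAt (1 : ℝ) ((hasDerivAt_id (1 : ℝ)).smul_const z)
    simpa [Function.comp_def] using this
  have h2 : HasDerivAt (fun s : ℝ => P (s • z)) ((k : ℝ) • P z) 1 := by
    have := ((hasDerivAt_pow k (1 : ℝ)).smul_const (P z))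
    simp only [one_pow, mul_one] at this
    refine this.congr_of_eventuallyEq ?_
    filter_upwards [lt_mem_nhds one_pos] with s hs using hP s hs z
  exact h1.unique h2

theorem PosHom.apply_zero {k : ℕ} {P : E → F} (hP : PosHom (k + 1) P) : P 0 = 0 := by
  have h2 := hP 2 two_pos 0
  rw [smul_zero] at h2
  have h3 : ((2 : ℝ) ^ (k + 1) - 1) • P 0 = 0 := by rw [sub_smul, ← h2]; simp
  have h4 : (1 : ℝ) < 2 ^ (k + 1) := one_lt_pow₀ one_lt_two (by omega)
  exact (smul_eq_zero.1 h3).resolve_left (by linarith)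

theorem PosHom.comp_linear {G : Type*} [NormedAddCommGroup G] [NormedSpace ℝ G] {k : ℕ}
    {P : E → F} (hP : PosHom k P) (A : G →L[ℝ] E) : PosHom k fun z => P (A z) := by
  intro s hs z
  simp [hP s hs]

theorem PosHom.linear_comp {G : Type*} [NormedAddCommGroup G] [NormedSpace ℝ G] {k : ℕ}
    {P : E → F} (hP : PosHom k P) (A : F →L[ℝ] G) : PosHom k fun z => A (P z) := by
  intro s hs z
  simp [hP s hs]

theorem tendsto_smul_pos (z : E) : Tendsto (fun s : ℝ => s • z) (𝓝[>] 0) (𝓝 0) := by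
  have : Tendsto (fun s : ℝ => s • z) (𝓝 0) (𝓝 ((0 : ℝ) • z)) :=
    Continuous.tendsto (by fun_prop) _
  rw [zero_smul] at this
  exact this.mono_left nhdsWithin_le_nhds

/-- If `f = P + o(|z|^k)` with `P` homogeneous of degree `k`, then `P` is the limit of `f` rescaled
along rays. -/
theorem PosHom.tendsto_ray {k : ℕ} {P f : E → F} (hP : PosHom k P)
    (hf : (fun z => f z - P z) =o[𝓝 0] fun z => ‖z‖ ^ k) (z : E) :
    Tendsto (fun s : ℝ => (s ^ k)⁻¹ • f (s • z)) (𝓝[>] 0) (𝓝 (P z)) := by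
  have h1 := (hf.comp_tendsto (tendsto_smul_pos z))
  have h2 := (isBigO_refl (fun s : ℝ => (s ^ k)⁻¹) (𝓝[>] 0)).smul_isLittleO h1
  have h3 : (fun s : ℝ => (s ^ k)⁻¹ • f (s • z) - P z) =o[𝓝[>] 0] fun _ : ℝ => (1 : ℝ) := by
    refine (h2.congr' (f₂ := fun s : ℝ => (s ^ k)⁻¹ • f (s • z) - P z)
      (g₂ := fun _ : ℝ => ‖z‖ ^ k) ?_ ?_).trans_isBigO (isBigO_const_const _ one_ne_zero _)
    · filter_upwards [self_mem_nhdsWithin] with s hs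
      have hs' : s ≠ 0 := (Set.mem_Ioi.1 hs).ne'
      simp [hP s hs, smul_sub, smul_smul, hs']
    · filter_upwards [self_mem_nhdsWithin] with s hs
      have hs' : 0 < s := Set.mem_Ioi.1 hs
      simp only [Function.comp, norm_smul, mul_pow, Real.norm_of_nonneg hs'.le, smul_eq_mul]
      field_simp
  simpa using ((isLittleO_one_iff ℝ).1 h3).add_const (P z)

end PosHom

/-! ### Hamiltonian vector fields -/

theorem omega_eq (u v : Phase) : omega u v =
    u.1 0 * v.2 0 - u.2 0 * v.1 0 + (u.1 1 * v.2 1 - u.2 1 * v.1 1) := by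
  simp only [omega, Fin.sum_univ_two]

/-- The bilinear form `omega` as a continuous bilinear map. -/
noncomputable def omegaL : Phase →L[ℝ] Phase →L[ℝ] ℝ :=
  LinearMap.toContinuousLinearMap
    ((LinearMap.toContinuousLinearMap (𝕜 := ℝ) (E := Phase) (F' := ℝ)).toLinearMap ∘ₗ
      LinearMap.mk₂ ℝ omega
        (fun u u' v => by simp [omega_eq]; ring) (fun c u v => by simp [omega_eq]; ring)
        (fun u v v' => by simp [omega_eq]; ring) (fun c u v => by simp [omega_eq]; ring))

theorem omegaL_apply (u v : Phase) : omegaL u v = omega u v := rfl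

theorem omega_antisymm (u v : Phase) : omega u v = -omega v u := by
  rw [omega_eq, omega_eq]; ring

theorem eq_zero_of_omega {u : Phase} (h : ∀ v, omega u v = 0) : u = 0 := by
  have h1 := h (0, Pi.single 0 1)
  have h2 := h (0, Pi.single 1 1)
  have h3 := h (Pi.single 0 1, 0)
  have h4 := h (Pi.single 1 1, 0)
  simp [omega_eq] at h1 h2 h3 h4
  ext i
  · fin_cases i <;> simp [h1, h2]
  · fin_cases i <;> simp [h3, h4]

/-- `∂K/∂x` for a function `K(x, P)`. -/
noncomputable def gradX (K : Phase → ℝ) (z : Phase) : Plane :=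
  fun i => fderiv ℝ K z (Pi.single i 1, 0)

/-- `∂K/∂P` for a function `K(x, P)`. -/
noncomputable def gradP (K : Phase → ℝ) (z : Phase) : Plane :=
  fun i => fderiv ℝ K z (0, Pi.single i 1)

/-- The Hamiltonian vector field of `K`. -/
noncomputable def hamVF (K : Phase → ℝ) (z : Phase) : Phase := (gradP K z, -gradX K z)

theorem phase_decomp (v : Phase) : v = v.1 0 • (Pi.single 0 1, 0) + v.1 1 • (Pi.single 1 1, 0) +
    (v.2 0 • (0, Pi.single 0 1) + v.2 1 • (0, Pi.single 1 1)) := by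
  ext i <;> fin_cases i <;> simp

theorem clm_phase_apply (L : Phase →L[ℝ] ℝ) (v : Phase) : L v =
    v.1 0 * L (Pi.single 0 1, 0) + v.1 1 * L (Pi.single 1 1, 0) +
    (v.2 0 * L (0, Pi.single 0 1) + v.2 1 * L (0, Pi.single 1 1)) := by
  conv_lhs => rw [phase_decomp v]
  simp only [map_add, map_smul, smul_eq_mul]

theorem omega_hamVF (K : Phase → ℝ) (z v : Phase) : omega (hamVF K z) v = fderiv ℝ K z v := by
  rw [clm_phase_apply, omega_eq]
  simp only [hamVF, gradP, gradX, Pi.neg_apply]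
  ring

/-- Reads off the gradients from a covector. -/
noncomputable def hamL : (Phase →L[ℝ] ℝ) →L[ℝ] Phase :=
  LinearMap.toContinuousLinearMap
    { toFun := fun L => (fun i => L (0, Pi.single i 1), -fun i => L (Pi.single i 1, 0))
      map_add' := fun L L' => by
        ext i <;> simp; ring
      map_smul' := fun c L => by ext i <;> simp }

theorem hamVF_eq (K : Phase → ℝ) (z : Phase) : hamVF K z = hamL (fderiv ℝ K z) := rfl

/-! ### Local inverses -/

theorem exists_smooth_local_inverse {E F : Type*} [NormedAddCommGroup E] [NormedSpace ℝ E]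
    [NormedAddCommGroup F] [NormedSpace ℝ F] [CompleteSpace E] {f : E → F} {a : E}
    (hf : ∀ᶠ z in 𝓝 a, ContDiffAt ℝ ∞ f z) (f' : E ≃L[ℝ] F)
    (h : HasFDerivAt f (f' : E →L[ℝ] F) a) :
    ∃ g : F → E, g (f a) = a ∧ (∀ᶠ y in 𝓝 (f a), ContDiffAt ℝ ∞ g y) ∧
      (∀ᶠ x in 𝓝 a, g (f x) = x) ∧ ∀ᶠ y in 𝓝 (f a), f (g y) = y := by
  have hs : HasStrictFDerivAt f (f' : E →L[ℝ] F) a :=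
    hf.self_of_nhds.hasStrictFDerivAt' h (by simp)
  refine ⟨hs.localInverse f f' a, hs.localInverse_apply_image, ?_, hs.eventually_left_inverse,
    hs.eventually_right_inverse⟩
  have h1 : ∀ᶠ x in 𝓝 a, ContDiffAt ℝ ∞ f x ∧ ∃ e : E ≃L[ℝ] F, HasFDerivAt f (e : E →L[ℝ] F) x := by
    have hc : ContinuousAt (fderiv ℝ f) a :=
      (hf.self_of_nhds.fderiv_right (m := 0) (by simp)).continuousAt
    have h2 : ∀ᶠ x in 𝓝 a, fderiv ℝ f x ∈ Set.range ((↑) : (E ≃L[ℝ] F) → E →L[ℝ] F) := by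
      refine hc.eventually ?_
      rw [h.fderiv]
      exact f'.nhds
    filter_upwards [hf, h2] with x hx hx2
    obtain ⟨e, he⟩ := hx2
    exact ⟨hx, e, by rw [he]; exact (hx.differentiableAt (by simp)).hasFDerivAt⟩
  have h3 := hs.localInverse_tendsto.eventually h1
  filter_upwards [h3, (hs.toOpenPartialHomeomorph f).open_target.mem_nhds
    hs.image_mem_toOpenPartialHomeomorph_target] with y hy hyt
  obtain ⟨hy1, e, he⟩ := hy
  exact (hs.toOpenPartialHomeomorph f).contDiffAt_symm hyt he hy1

/-! ### Symplectic germs from generating functions `x · P + K(x, P)` -/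

/-- `(x, P) ↦ (x, P + ∂K/∂x)`. -/
noncomputable def srcMap (K : Phase → ℝ) (z : Phase) : Phase := z - (0, (hamVF K z).2)

/-- `(x, P) ↦ (x + ∂K/∂P, P)`. -/
noncomputable def tgtMap (K : Phase → ℝ) (z : Phase) : Phase := z + ((hamVF K z).1, 0)

/-- Smooth functions without terms of degree at most two. -/
structure IsAdm (K : Phase → ℝ) : Prop where
  smooth : ContDiff ℝ ∞ K
  flat : K =o[𝓝 0] fun z => ‖z‖ ^ 2

theorem contDiff_hamVF {K : Phase → ℝ} (hK : ContDiff ℝ ∞ K) : ContDiff ℝ ∞ (hamVF K) :=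
  hamL.contDiff.comp (hK.fderiv_right (by simp))

theorem contDiff_srcMap {K : Phase → ℝ} (hK : ContDiff ℝ ∞ K) : ContDiff ℝ ∞ (srcMap K) :=
  contDiff_id.sub (contDiff_const.prodMk (contDiff_hamVF hK).snd)

theorem contDiff_tgtMap {K : Phase → ℝ} (hK : ContDiff ℝ ∞ K) : ContDiff ℝ ∞ (tgtMap K) :=
  contDiff_id.add ((contDiff_hamVF hK).fst.prodMk contDiff_const)

theorem hamVF_isLittleO {K : Phase → ℝ} (hK : ContDiffAt ℝ ∞ K 0) {k : ℕ}
    (h : K =o[𝓝 0] fun z => ‖z‖ ^ (k + 1)) : hamVF K =o[𝓝 0] fun z => ‖z‖ ^ k :=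
  (hamL.isBigO_comp (fderiv ℝ K) _).trans_isLittleO (isLittleO_fderiv hK h)

theorem apply_zero_of_isLittleO {E F : Type*} [NormedAddCommGroup E] [NormedAddCommGroup F]
    {f : E → F} {k : ℕ} (h : f =o[𝓝 0] fun z => ‖z‖ ^ (k + 1)) : f 0 = 0 := by
  have := (h.def one_pos).self_of_nhds
  simpa using this

theorem hasFDerivAt_zero_of_isLittleO {E F : Type*} [NormedAddCommGroup E] [NormedSpace ℝ E]
    [NormedAddCommGroup F] [NormedSpace ℝ F]
    {f : E → F} (h : f =o[𝓝 0] fun z => ‖z‖ ^ 1) : HasFDerivAt f (0 : E →L[ℝ] F) 0 := by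
  rw [hasFDerivAt_iff_isLittleO_nhds_zero]
  simpa [apply_zero_of_isLittleO (k := 0) h] using (isLittleO_norm_right (g' := fun z : E => z)).1
    (by simpa using h)

namespace IsAdm

variable {K : Phase → ℝ} (hK : IsAdm K)
include hK

theorem hamVF_zero : hamVF K 0 = 0 :=
  apply_zero_of_isLittleO (k := 0) (hamVF_isLittleO hK.smooth.contDiffAt hK.flat)

theorem srcMap_zero : srcMap K 0 = 0 := by simp [srcMap, hK.hamVF_zero]

theorem tgtMap_zero : tgtMap K 0 = 0 := by simp [tgtMap, hK.hamVF_zero]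

theorem hasStrictFDerivAt_hamVF : HasStrictFDerivAt (hamVF K) (0 : Phase →L[ℝ] Phase) 0 :=
  (contDiff_hamVF hK.smooth).contDiffAt.hasStrictFDerivAt'
    (hasFDerivAt_zero_of_isLittleO (hamVF_isLittleO hK.smooth.contDiffAt hK.flat)) (by simp)

theorem hasStrictFDerivAt_srcMap :
    HasStrictFDerivAt (srcMap K) (ContinuousLinearMap.id ℝ Phase) 0 := by
  have h := (hasStrictFDerivAt_id (𝕜 := ℝ) (0 : Phase)).sub
    ((ContinuousLinearMap.inr ℝ Plane Plane ∘L
      ContinuousLinearMap.snd ℝ Plane Plane).hasStrictFDerivAt.comp (0 : Phase)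
      hK.hasStrictFDerivAt_hamVF)
  rw [ContinuousLinearMap.comp_zero] at h
  exact h.congr_fderiv (by simp)

theorem hasStrictFDerivAt_tgtMap :
    HasStrictFDerivAt (tgtMap K) (ContinuousLinearMap.id ℝ Phase) 0 := by
  have h := (hasStrictFDerivAt_id (𝕜 := ℝ) (0 : Phase)).add
    ((ContinuousLinearMap.inl ℝ Plane Plane ∘L
      ContinuousLinearMap.fst ℝ Plane Plane).hasStrictFDerivAt.comp (0 : Phase)
      hK.hasStrictFDerivAt_hamVF)
  rw [ContinuousLinearMap.comp_zero] at h
  exact h.congr_fderiv (by simp)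

theorem map_srcMap : map (srcMap K) (𝓝 0) = 𝓝 0 := by
  have := HasStrictFDerivAt.map_nhds_eq_of_equiv (f' := ContinuousLinearEquiv.refl ℝ Phase)
    (f := srcMap K) (a := 0) hK.hasStrictFDerivAt_srcMap
  rwa [hK.srcMap_zero] at this

theorem map_tgtMap : map (tgtMap K) (𝓝 0) = 𝓝 0 := by
  have := HasStrictFDerivAt.map_nhds_eq_of_equiv (f' := ContinuousLinearEquiv.refl ℝ Phase)
    (f := tgtMap K) (a := 0) hK.hasStrictFDerivAt_tgtMap
  rwa [hK.tgtMap_zero] at this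

end IsAdm

/-- `G` is the symplectic germ with generating function `x · P + K(x, P)`. -/
structure IsGen (K : Phase → ℝ) (G : Phase → Phase) : Prop where
  smooth : ∀ᶠ z in 𝓝 0, ContDiffAt ℝ ∞ G z
  eq : ∀ᶠ z in 𝓝 0, G (srcMap K z) = tgtMap K z

theorem IsGen.unique {K : Phase → ℝ} (hK : IsAdm K) {G G' : Phase → Phase} (h : IsGen K G)
    (h' : IsGen K G') : G =ᶠ[𝓝 0] G' := by
  rw [EventuallyEq, ← hK.map_srcMap, eventually_map]
  filter_upwards [h.eq, h'.eq] with z hz hz'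
  rw [hz, hz']

theorem contDiff_uncurry_linear {V E F : Type*} [NormedAddCommGroup V] [NormedSpace ℝ V]
    [FiniteDimensional ℝ V] [NormedAddCommGroup E] [NormedSpace ℝ E]
    [NormedAddCommGroup F] [NormedSpace ℝ F] (L : V →ₗ[ℝ] E → F)
    (hL : ∀ s, ContDiff ℝ ∞ (L s)) : ContDiff ℝ ∞ fun p : E × V => L p.2 p.1 := by
  set b := Module.finBasis ℝ V
  have h : (fun p : E × V => L p.2 p.1) =
      fun p : E × V => ∑ i, b.coord i p.2 • L (b i) p.1 := by
    funext p
    conv_lhs => rw [← b.sum_repr p.2]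
    rw [map_sum, Finset.sum_apply]
    refine Finset.sum_congr rfl fun i _ => ?_
    rw [map_smul]; rfl
  rw [h]
  refine ContDiff.sum fun i _ => ContDiff.smul ?_ ((hL _).comp contDiff_fst)
  exact (LinearMap.toContinuousLinearMap (b.coord i)).contDiff.comp contDiff_snd

/-- The symplectic germs generated by a linear family of functions depend smoothly on
the parameter. -/
theorem exists_joint_gen {V : Type*} [NormedAddCommGroup V] [NormedSpace ℝ V]
    [FiniteDimensional ℝ V] (L : V →ₗ[ℝ] Phase → ℝ) (hL : ∀ s, IsAdm (L s)) (s₀ : V) :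
    ∃ G : Phase × V → Phase, (∀ᶠ p in 𝓝 ((0 : Phase), s₀), ContDiffAt ℝ ∞ G p) ∧
      ∀ᶠ s in 𝓝 s₀, IsGen (L s) fun z => G (z, s) := by
  have : CompleteSpace V := FiniteDimensional.complete ℝ V
  have hLs : ContDiff ℝ ∞ fun p : Phase × V => L p.2 p.1 :=
    contDiff_uncurry_linear L fun s => (hL s).smooth
  have hH : ContDiff ℝ ∞ fun p : Phase × V => hamVF (L p.2) p.1 := by
    refine hamL.contDiff.comp (ContDiff.fderiv (n := ∞) (m := ∞)
      (f := fun (p : Phase × V) z => L p.2 z) (g := Prod.fst) ?_ contDiff_fst (by simp))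
    exact hLs.comp (contDiff_snd.prodMk (contDiff_snd.comp contDiff_fst))
  have hH0 : HasFDerivAt (fun p : Phase × V => hamVF (L p.2) p.1)
      (0 : Phase × V →L[ℝ] Phase) (0, s₀) := by
    have h1 := (hH.differentiable (by simp) (0, s₀)).hasFDerivAt
    have h2 : HasFDerivAt (fun z : Phase => hamVF (L s₀) z)
        ((fderiv ℝ (fun p : Phase × V => hamVF (L p.2) p.1) (0, s₀)).comp
          (ContinuousLinearMap.inl ℝ Phase V)) 0 :=
      HasFDerivAt.comp (0 : Phase) (f := fun z : Phase => (z, s₀)) h1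
        (hasFDerivAt_prodMk_left (0 : Phase) s₀)
    have h3 : HasFDerivAt (fun s : V => hamVF (L s) 0)
        ((fderiv ℝ (fun p : Phase × V => hamVF (L p.2) p.1) (0, s₀)).comp
          (ContinuousLinearMap.inr ℝ Phase V)) s₀ :=
      HasFDerivAt.comp s₀ (f := fun s : V => ((0 : Phase), s)) h1
        (hasFDerivAt_prodMk_right (0 : Phase) s₀)
    have h4 := h2.unique (hL s₀).hasStrictFDerivAt_hamVF.hasFDerivAt
    have h5 := h3.unique (by
      simp only [fun s => (hL s).hamVF_zero]
      exact hasFDerivAt_const (0 : Phase) s₀)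
    have h6 : fderiv ℝ (fun p : Phase × V => hamVF (L p.2) p.1) (0, s₀) = 0 := by
      refine ContinuousLinearMap.prod_ext ?_ ?_
      · rw [h4]; rfl
      · rw [h5]; rfl
    rwa [h6] at h1
  set A : Phase × V → Phase × V := fun p => (srcMap (L p.2) p.1, p.2) with hA
  have hAs : ContDiff ℝ ∞ A :=
    (contDiff_fst.sub (contDiff_const.prodMk hH.snd)).prodMk contDiff_snd
  have hA0 : A (0, s₀) = (0, s₀) := by simp [hA, (hL s₀).srcMap_zero]
  have hAd : HasFDerivAt A
      ((ContinuousLinearEquiv.refl ℝ (Phase × V) : (Phase × V) ≃L[ℝ] (Phase × V)) :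
        Phase × V →L[ℝ] Phase × V) (0, s₀) := by
    have h7 := (hasFDerivAt_fst (𝕜 := ℝ) (E := Phase) (F := V) (p := (0, s₀))).sub
      ((ContinuousLinearMap.inr ℝ Plane Plane ∘L
        ContinuousLinearMap.snd ℝ Plane Plane).hasFDerivAt.comp (0, s₀) hH0)
    have h8 := h7.prodMk (hasFDerivAt_snd (𝕜 := ℝ) (E := Phase) (F := V) (p := (0, s₀)))
    refine h8.congr_fderiv ?_
    ext <;> simp
  obtain ⟨g, -, hgs, hgl, -⟩ := exists_smooth_local_inverse
    (Eventually.of_forall fun p => hAs.contDiffAt) _ hAd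
  rw [hA0] at hgs
  have hgc : Tendsto g (𝓝 (0, s₀)) (𝓝 (g (0, s₀))) := hgs.self_of_nhds.continuousAt
  have hT : ContDiff ℝ ∞ fun p : Phase × V => tgtMap (L p.2) p.1 :=
    contDiff_fst.add (hH.fst.prodMk contDiff_const)
  have hGs : ∀ᶠ p in 𝓝 ((0 : Phase), s₀),
      ContDiffAt ℝ ∞ (fun p => tgtMap (L (g p).2) (g p).1) p := by
    filter_upwards [hgs] with p hp
    exact hT.contDiffAt.comp p hp
  refine ⟨fun p => tgtMap (L (g p).2) (g p).1, hGs, ?_⟩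
  rw [nhds_prod_eq] at hGs hgl
  have h9 := (eventually_swap_iff.1 hGs).curry
  have h10 := (eventually_swap_iff.1 hgl).curry
  filter_upwards [h9, h10] with s hs hs'
  constructor
  · filter_upwards [hs] with z hz
    exact ContDiffAt.comp (g := fun p : Phase × V => tgtMap (L (g p).2) (g p).1) z hz
      (contDiffAt_id.prodMk contDiffAt_const)
  · filter_upwards [hs'] with z hz
    have hz' : g (srcMap (L s) z, s) = (z, s) := hz
    simp only [hz']

theorem exists_isGen {K : Phase → ℝ} (hK : IsAdm K) : ∃ G, IsGen K G := by
  let L : ℝ →ₗ[ℝ] Phase → ℝ := LinearMap.toSpanSingleton ℝ (Phase → ℝ) K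
  obtain ⟨G, -, hG⟩ := exists_joint_gen L (fun s => ⟨contDiff_const.smul hK.smooth,
    hK.flat.const_smul_left s⟩) 1
  have := hG.self_of_nhds
  simp only [L, LinearMap.toSpanSingleton_apply, one_smul] at this
  exact ⟨_, this⟩

open Classical in
/-- The symplectic germ with generating function `x · P + K(x, P)`. -/
noncomputable def gen (K : Phase → ℝ) : Phase → Phase :=
  if h : ∃ G, IsGen K G then Classical.choose h else id

theorem isGen_gen {K : Phase → ℝ} (hK : IsAdm K) : IsGen K (gen K) := by
  rw [gen, dif_pos (exists_isGen hK)]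
  exact Classical.choose_spec (exists_isGen hK)

namespace IsAdm

variable {K : Phase → ℝ} (hK : IsAdm K)
include hK

theorem gen_zero : gen K 0 = 0 := by
  have := (isGen_gen hK).eq.self_of_nhds
  rwa [hK.srcMap_zero, hK.tgtMap_zero] at this

theorem hasStrictFDerivAt_gen :
    HasStrictFDerivAt (gen K) (ContinuousLinearMap.id ℝ Phase) 0 := by
  have h1 := (isGen_gen hK).smooth.self_of_nhds
  refine h1.hasStrictFDerivAt' ?_ (by simp)
  have h2 := (h1.differentiableAt (by simp)).hasFDerivAt
  have h3 : HasFDerivAt (tgtMap K) ((fderiv ℝ (gen K) 0).comp (ContinuousLinearMap.id ℝ Phase))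
      0 := by
    have h4 : HasFDerivAt (gen K) (fderiv ℝ (gen K) 0) (srcMap K 0) := by
      rwa [hK.srcMap_zero]
    exact (h4.comp 0 hK.hasStrictFDerivAt_srcMap.hasFDerivAt).congr_of_eventuallyEq
      ((isGen_gen hK).eq.mono fun z hz => hz.symm)
  have h5 := h3.unique hK.hasStrictFDerivAt_tgtMap.hasFDerivAt
  rw [ContinuousLinearMap.comp_id] at h5
  rwa [h5] at h2

theorem isSmoothGerm_gen : IsSmoothGerm (gen K) := ⟨hK.gen_zero, (isGen_gen hK).smooth⟩

theorem isSympGerm_gen : IsSympGerm (gen K) := by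
  refine ⟨hK.isSmoothGerm_gen, ?_⟩
  have hsrc := contDiff_srcMap hK.smooth
  have htgt := contDiff_tgtMap hK.smooth
  have hham := contDiff_hamVF hK.smooth
  have hdf : ContDiff ℝ ∞ (fderiv ℝ K) := hK.smooth.fderiv_right (by simp)
  have hsurj : ∀ᶠ z in 𝓝 (0 : Phase), Function.Surjective (fderiv ℝ (srcMap K) z) := by
    have hc : ContinuousAt (fderiv ℝ (srcMap K)) 0 :=
      (hsrc.fderiv_right (m := 0) (by simp)).continuous.continuousAt
    have h2 : ∀ᶠ x in 𝓝 (0 : Phase), fderiv ℝ (srcMap K) x ∈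
        Set.range ((↑) : (Phase ≃L[ℝ] Phase) → Phase →L[ℝ] Phase) := by
      refine hc.eventually ?_
      rw [hK.hasStrictFDerivAt_srcMap.hasFDerivAt.fderiv]
      exact (ContinuousLinearEquiv.refl ℝ Phase).nhds
    filter_upwards [h2] with z hz
    obtain ⟨e, he⟩ := hz
    rw [← he]
    exact e.surjective
  have hsm : ∀ᶠ z in 𝓝 (0 : Phase), ContDiffAt ℝ ∞ (gen K) (srcMap K z) := by
    have := (isGen_gen hK).smooth
    rwa [← hK.map_srcMap, eventually_map] at this
  rw [← hK.map_srcMap, eventually_map]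
  filter_upwards [hsurj, hsm, (isGen_gen hK).eq.eventually_nhds] with z hz hsz hez u v
  obtain ⟨u, rfl⟩ := hz u
  obtain ⟨v, rfl⟩ := hz v
  have hchain : (fderiv ℝ (gen K) (srcMap K z)).comp (fderiv ℝ (srcMap K) z) =
      fderiv ℝ (tgtMap K) z := by
    rw [← fderiv_comp z (hsz.differentiableAt (by simp)) (hsrc.differentiable (by simp) z)]
    exact Filter.EventuallyEq.fderiv_eq hez
  have hc : ∀ w, fderiv ℝ (gen K) (srcMap K z) (fderiv ℝ (srcMap K) z w) =
      fderiv ℝ (tgtMap K) z w := fun w => by rw [← hchain]; rfl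
  rw [hc, hc]
  have hd2 : HasFDerivAt (hamVF K) (hamL.comp (fderiv ℝ (fderiv ℝ K) z)) z :=
    hamL.hasFDerivAt.comp z (hdf.differentiable (by simp) z).hasFDerivAt
  have hS : fderiv ℝ (srcMap K) z = ContinuousLinearMap.id ℝ Phase -
      (ContinuousLinearMap.inr ℝ Plane Plane ∘L ContinuousLinearMap.snd ℝ Plane Plane).comp
        (hamL.comp (fderiv ℝ (fderiv ℝ K) z)) :=
    HasFDerivAt.fderiv ((hasFDerivAt_id z).sub ((ContinuousLinearMap.inr ℝ Plane Plane ∘L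
      ContinuousLinearMap.snd ℝ Plane Plane).hasFDerivAt.comp z hd2))
  have hT : fderiv ℝ (tgtMap K) z = ContinuousLinearMap.id ℝ Phase +
      (ContinuousLinearMap.inl ℝ Plane Plane ∘L ContinuousLinearMap.fst ℝ Plane Plane).comp
        (hamL.comp (fderiv ℝ (fderiv ℝ K) z)) :=
    HasFDerivAt.fderiv ((hasFDerivAt_id z).add ((ContinuousLinearMap.inl ℝ Plane Plane ∘L
      ContinuousLinearMap.fst ℝ Plane Plane).hasFDerivAt.comp z hd2))
  have hsymm : fderiv ℝ (fderiv ℝ K) z u v = fderiv ℝ (fderiv ℝ K) z v u :=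
    ((hK.smooth.contDiffAt (x := z)).isSymmSndFDerivAt (by
      rw [minSmoothness_of_isRCLikeNormedField]
      exact WithTop.coe_le_coe.2 (le_top : (2 : ℕ∞) ≤ ⊤))).eq u v
  rw [hS, hT]
  rw [clm_phase_apply (fderiv ℝ (fderiv ℝ K) z u) v,
    clm_phase_apply (fderiv ℝ (fderiv ℝ K) z v) u] at hsymm
  simp only [omega_eq, hamL, add_apply, sub_apply, ContinuousLinearMap.comp_apply,
    ContinuousLinearMap.id_apply, ContinuousLinearMap.inl_apply, ContinuousLinearMap.inr_apply,
    ContinuousLinearMap.coe_fst', ContinuousLinearMap.coe_snd',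
    LinearMap.coe_toContinuousLinearMap', LinearMap.coe_mk, AddHom.coe_mk, Prod.fst_add,
    Prod.snd_add, Prod.fst_sub, Prod.snd_sub, Pi.add_apply, Pi.sub_apply, Pi.neg_apply,
    Pi.zero_apply, add_zero, sub_zero]
  linarith

end IsAdm

theorem hamVF_sub {K K' : Phase → ℝ} {z : Phase} (hK : DifferentiableAt ℝ K z)
    (hK' : DifferentiableAt ℝ K' z) :
    hamVF (fun z => K z - K' z) z = hamVF K z - hamVF K' z := by
  simp only [hamVF_eq]
  rw [fderiv_fun_sub hK hK', map_sub]

theorem PosHom.hamVF {k : ℕ} {K : Phase → ℝ} (hP : PosHom (k + 1) K) (hs : ContDiff ℝ ∞ K) :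
    PosHom k (hamVF K) :=
  (hP.fderiv (hs.differentiable (by simp))).linear_comp hamL

theorem HasStrictFDerivAt.sub_id_isLittleO {E : Type*} [NormedAddCommGroup E] [NormedSpace ℝ E]
    {f : E → E} (h : HasStrictFDerivAt f (ContinuousLinearMap.id ℝ E) 0) (h0 : f 0 = 0) :
    (fun z => f z - z) =o[𝓝 0] fun z => ‖z‖ := by
  have := hasFDerivAt_iff_isLittleO_nhds_zero.1 h.hasFDerivAt
  simpa [h0] using this.norm_right

/-- Changing the generating function by a homogeneous term of degree `k + 1` changes the germ by
the Hamiltonian vector field of this term, up to terms of order greater than `k`. -/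
theorem gen_sub_gen {K K' Δ : Phase → ℝ} (hK : IsAdm K) (hK' : IsAdm K') {k : ℕ}
    (hΔ : ContDiff ℝ ∞ Δ) (hom : PosHom (k + 1) Δ)
    (h : (fun z => K' z - K z - Δ z) =o[𝓝 0] fun z => ‖z‖ ^ (k + 1)) :
    (fun z => gen K' z - gen K z - hamVF Δ z) =o[𝓝 0] fun z => ‖z‖ ^ k := by
  have hd := hK.smooth.differentiable (by simp)
  have hd' := hK'.smooth.differentiable (by simp)
  have hdΔ := hΔ.differentiable (by simp)
  have h1 : (fun z => hamVF K' z - hamVF K z - hamVF Δ z) =o[𝓝 0] fun z => ‖z‖ ^ k := by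
    refine (hamVF_isLittleO ((hK'.smooth.sub hK.smooth).sub hΔ).contDiffAt h).congr_left
      fun z => ?_
    have := hamVF_sub ((hd' z).sub (hd z)) (hdΔ z)
    refine this.trans ?_
    congr 1
    exact hamVF_sub (hd' z) (hd z)
  have hΔO : hamVF Δ =O[𝓝 0] fun z => ‖z‖ ^ k :=
    (hom.hamVF hΔ).isBigO (contDiff_hamVF hΔ).continuous.continuousAt
  have h2 : (fun z => hamVF K' z - hamVF K z) =O[𝓝 0] fun z => ‖z‖ ^ k := by
    refine (h1.isBigO.add hΔO).congr_left fun z => by abel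
  have hsrc : ∀ z, srcMap K' z - srcMap K z = -(0, (hamVF K' z - hamVF K z).2) := fun z => by
    simp only [srcMap, Prod.snd_sub]
    ext <;> simp
  have htgt : ∀ z, tgtMap K' z - tgtMap K z = ((hamVF K' z - hamVF K z).1, 0) := fun z => by
    simp only [tgtMap, Prod.fst_sub]
    ext <;> simp
  have h3 : (fun z => srcMap K' z - srcMap K z) =O[𝓝 0] fun z => ‖z‖ ^ k := by
    refine IsBigO.trans (IsBigO.of_bound 1 (Eventually.of_forall fun z => ?_)) h2
    rw [hsrc, norm_neg, one_mul, Prod.norm_mk, norm_zero]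
    exact max_le (norm_nonneg _) (norm_snd_le _)
  have hts : Tendsto (srcMap K) (𝓝 0) (𝓝 0) := hK.map_srcMap.le
  have hts' : Tendsto (srcMap K') (𝓝 0) (𝓝 0) := hK'.map_srcMap.le
  have h4 : (fun z => gen K (srcMap K' z) - gen K (srcMap K z) - (srcMap K' z - srcMap K z))
      =o[𝓝 0] fun z => ‖z‖ ^ k := by
    have := hK.hasStrictFDerivAt_gen.isLittleO.comp_tendsto
      ((hts'.prodMk_nhds hts))
    refine (this.congr_left fun z => ?_).trans_isBigO h3
    simp
  have h5 : (fun z => gen K' (srcMap K' z) - gen K (srcMap K' z) - hamVF Δ z)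
      =o[𝓝 0] fun z => ‖z‖ ^ k := by
    refine (h1.sub h4).congr' ?_ EventuallyEq.rfl
    filter_upwards [(isGen_gen hK).eq, (isGen_gen hK').eq] with z hz hz'
    rw [hz, hz']
    have e1 : hamVF K' z - hamVF K z = (tgtMap K' z - tgtMap K z) -
        (srcMap K' z - srcMap K z) := by
      rw [hsrc, htgt]
      ext <;> simp
    rw [e1]
    abel
  have hsub : (fun z => srcMap K' z - z) =o[𝓝 0] fun z => ‖z‖ :=
    HasStrictFDerivAt.sub_id_isLittleO hK'.hasStrictFDerivAt_srcMap hK'.srcMap_zero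
  have h6 := (hom.hamVF hΔ).comp_sub_isLittleO (contDiff_hamVF hΔ).contDiffAt hsub
  have h7 : ((fun z => gen K' z - gen K z - hamVF Δ z) ∘ srcMap K')
      =o[𝓝 0] fun z => ‖z‖ ^ k := by
    refine (h5.sub h6).congr_left fun z => ?_
    simp only [Function.comp]
    abel
  have h8 : (fun z : Phase => ‖z‖ ^ k) =O[𝓝 0] ((fun z => ‖z‖ ^ k) ∘ srcMap K') := by
    refine IsBigO.pow ?_ k
    refine IsBigO.of_bound 2 ?_
    filter_upwards [hsub.def (c := 1 / 2) (by norm_num)] with z hz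
    rw [norm_norm] at hz
    simp only [norm_norm]
    have := norm_sub_norm_le z (srcMap K' z)
    rw [norm_sub_rev] at this
    linarith
  rw [← hK'.map_srcMap]
  exact isLittleO_map.2 (h7.trans_isBigO h8)

/-! ### Lagrangian equivalences -/

/-- Functions `v(q) · P + w(q)`. -/
def AffineInP (K : Phase → ℝ) : Prop :=
  ∀ q P : Plane, K (q, P) = K (q, 0) + ∑ i, P i * (K (q, Pi.single i 1) - K (q, 0))

theorem AffineInP.hamVF_fst {K : Phase → ℝ} (h : AffineInP K) (hK : Differentiable ℝ K)
    (q P : Plane) (i : Fin 2) : (hamVF K (q, P)).1 i = K (q, Pi.single i 1) - K (q, 0) := by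
  have h1 : HasDerivAt (fun t : ℝ => K (q, P + t • Pi.single i 1))
      (fderiv ℝ K (q, P) (0, Pi.single i 1)) 0 := by
    have hl : HasDerivAt (fun t : ℝ => ((q, P + t • Pi.single i 1) : Phase))
        ((0, Pi.single i 1) : Phase) 0 := by
      refine (hasDerivAt_const (0 : ℝ) q).prodMk ?_
      simpa using ((hasDerivAt_id (0 : ℝ)).smul_const (Pi.single i 1 : Plane)).const_add P
    have h2 : HasFDerivAt K (fderiv ℝ K (q, P)) (q, P + (0 : ℝ) • Pi.single i 1) := by
      simpa using (hK (q, P)).hasFDerivAt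
    exact h2.comp_hasDerivAt (0 : ℝ) hl
  have h3 : HasDerivAt (fun t : ℝ => K (q, P + t • Pi.single i 1))
      (K (q, Pi.single i 1) - K (q, 0)) 0 := by
    have h4 : (fun t : ℝ => K (q, P + t • Pi.single i 1)) =
        fun t => K (q, P) + t * (K (q, Pi.single i 1) - K (q, 0)) := by
      funext t
      rw [h q (P + t • Pi.single i 1), h q P]
      fin_cases i <;> simp [Fin.sum_univ_two] <;> ring
    rw [h4]
    simpa using ((hasDerivAt_id (0 : ℝ)).mul_const _).const_add (K (q, P))
  exact h1.unique h3

theorem IsAdm.isLagrangianEquivalence_gen {K : Phase → ℝ} (hK : IsAdm K) (h : AffineInP K) :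
    IsLagrangianEquivalence (gen K) := by
  have hd := hK.smooth.differentiable (by simp)
  refine ⟨hK.isSympGerm_gen, fun q => (tgtMap K (q, 0)).1, ⟨⟨?_, ?_⟩, ?_⟩, ?_⟩
  · change (tgtMap K 0).1 = 0
    rw [hK.tgtMap_zero]; rfl
  · exact Eventually.of_forall fun q => (((contDiff_tgtMap hK.smooth).comp
      (contDiff_id.prodMk contDiff_const)).fst).contDiffAt
  · have h1 : HasFDerivAt (tgtMap K) (ContinuousLinearMap.id ℝ Phase) ((0 : Plane), (0 : Plane)) :=
      hK.hasStrictFDerivAt_tgtMap.hasFDerivAt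
    have h2 : HasFDerivAt (fun q : Plane => (tgtMap K (q, 0)).1)
        ((ContinuousLinearMap.fst ℝ Plane Plane).comp ((ContinuousLinearMap.id ℝ Phase).comp
          (ContinuousLinearMap.inl ℝ Plane Plane))) 0 :=
      (ContinuousLinearMap.fst ℝ Plane Plane).hasFDerivAt.comp (0 : Plane)
        (h1.comp (0 : Plane) (f := fun q : Plane => (q, (0 : Plane)))
          (hasFDerivAt_prodMk_left (0 : Plane) (0 : Plane)))
    rw [h2.fderiv]
    have : ⇑((ContinuousLinearMap.fst ℝ Plane Plane).comp ((ContinuousLinearMap.id ℝ Phase).comp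
          (ContinuousLinearMap.inl ℝ Plane Plane))) = id := rfl
    rw [this]
    exact Function.bijective_id
  · rw [← hK.map_srcMap, eventually_map]
    filter_upwards [(isGen_gen hK).eq] with z hz
    rw [hz]
    obtain ⟨q, P⟩ := z
    simp only [tgtMap, srcMap, Prod.fst_add, Prod.fst_sub, sub_zero]
    congr 1
    ext i
    rw [h.hamVF_fst hd, h.hamVF_fst hd]

/-! ### Reticular diffeomorphisms -/

/-- The Lagrangian plane spanned by `L_σ⁰`. -/
def cornerPlane (σ : Set (Fin 2)) : Set Phase :=
  {z | (∀ i ∈ σ, z.1 i = 0) ∧ ∀ i ∉ σ, z.2 i = 0}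

theorem fderiv_eq_zero_of_line {K : Phase → ℝ} (hd : Differentiable ℝ K) {z v : Phase}
    (h : ∀ t : ℝ, K (z + t • v) = 0) : fderiv ℝ K z v = 0 := by
  have h1 : HasDerivAt (fun t : ℝ => K (z + t • v)) (fderiv ℝ K z v) 0 := by
    have hl : HasDerivAt (fun t : ℝ => z + t • v) v 0 := by
      simpa using ((hasDerivAt_id (0 : ℝ)).smul_const v).const_add z
    have h2 : HasFDerivAt K (fderiv ℝ K z) (z + (0 : ℝ) • v) := by
      simpa using (hd z).hasFDerivAt
    exact h2.comp_hasDerivAt (0 : ℝ) hl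
  simp only [h] at h1
  exact h1.unique (hasDerivAt_const _ _)

theorem hamVF_mem_cornerPlane {K : Phase → ℝ} (hd : Differentiable ℝ K) {σ : Set (Fin 2)}
    (h : ∀ z ∈ cornerPlane σ, K z = 0) {z : Phase} (hz : z ∈ cornerPlane σ) :
    hamVF K z ∈ cornerPlane σ := by
  refine ⟨fun i hi => fderiv_eq_zero_of_line hd fun t => h _ ⟨fun j hj => ?_, fun j hj => ?_⟩,
    fun i hi => neg_eq_zero.2 (fderiv_eq_zero_of_line hd fun t => h _
      ⟨fun j hj => ?_, fun j hj => ?_⟩)⟩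
  · simpa using hz.1 j hj
  · have : j ≠ i := fun e => hj (e ▸ hi)
    simpa [this] using hz.2 j hj
  · have : j ≠ i := fun e => hi (e ▸ hj)
    simpa [this] using hz.1 j hj
  · simpa using hz.2 j hj

theorem map_nhdsWithin_of_mem_iff {E : Type*} [TopologicalSpace E] [Zero E] {f : E → E} {A : Set E}
    (hf : map f (𝓝 0) = 𝓝 0) (h : ∀ᶠ z in 𝓝 0, f z ∈ A ↔ z ∈ A) :
    map f (𝓝[A] 0) = 𝓝[A] 0 := by
  have h1 : 𝓝[A] (0 : E) = 𝓝[f ⁻¹' A] 0 :=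
    nhdsWithin_eq_iff_eventuallyEq.2 (eventuallyEq_set.2 (h.mono fun z hz => hz.symm))
  conv_lhs => rw [h1, nhdsWithin, map_inf_principal_preimage, hf]
  rfl

theorem IsAdm.exists_half_lipschitz {K : Phase → ℝ} (hK : IsAdm K) : ∃ r > 0,
    ∀ z ∈ Metric.ball (0 : Phase) r, ∀ w ∈ Metric.ball (0 : Phase) r,
      ‖hamVF K z - hamVF K w‖ ≤ 1 / 2 * ‖z - w‖ := by
  have h := hK.hasStrictFDerivAt_hamVF.isLittleO.def (c := 1 / 2) (by norm_num)
  rw [nhds_prod_eq] at h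
  obtain ⟨t, ht, h⟩ := mem_prod_self_iff.1 h
  obtain ⟨r, hr, hrt⟩ := Metric.mem_nhds_iff.1 ht
  refine ⟨r, hr, fun z hz w hw => ?_⟩
  have := h (Set.mk_mem_prod (hrt hz) (hrt hw))
  simpa using this

theorem norm_le_of_components {z w : Phase} (h1 : ∀ i, ‖w.1 i‖ ≤ ‖z.1 i‖)
    (h2 : ∀ i, ‖w.2 i‖ ≤ ‖z.2 i‖) : ‖w‖ ≤ ‖z‖ := by
  rw [Prod.norm_def, Prod.norm_def]
  refine max_le_max ((pi_norm_le_iff_of_nonneg (norm_nonneg _)).2 fun i => ?_)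
    ((pi_norm_le_iff_of_nonneg (norm_nonneg _)).2 fun i => ?_)
  · exact (h1 i).trans (norm_le_pi_norm z.1 i)
  · exact (h2 i).trans (norm_le_pi_norm z.2 i)

theorem eq_of_norm_components_le {u : Phase}
    (h1 : ∀ i, ‖u.1 i‖ ≤ 1 / 2 * ‖u‖) (h2 : ∀ i, ‖u.2 i‖ ≤ 1 / 2 * ‖u‖) : u = 0 := by
  have h : ‖u‖ ≤ 1 / 2 * ‖u‖ := by
    conv_lhs => rw [Prod.norm_def]
    exact max_le ((pi_norm_le_iff_of_nonneg (by positivity)).2 h1)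
      ((pi_norm_le_iff_of_nonneg (by positivity)).2 h2)
  exact norm_le_zero_iff.1 (by linarith)

theorem norm_fst_apply_le (u : Phase) (i : Fin 2) : ‖u.1 i‖ ≤ ‖u‖ :=
  (norm_le_pi_norm u.1 i).trans (norm_fst_le u)

theorem norm_snd_apply_le (u : Phase) (i : Fin 2) : ‖u.2 i‖ ≤ ‖u‖ :=
  (norm_le_pi_norm u.2 i).trans (norm_snd_le u)

open Classical in
theorem IsAdm.srcMap_mem_cornerL {K : Phase → ℝ} (hK : IsAdm K) {σ : Set (Fin 2)}
    (h : ∀ z ∈ cornerPlane σ, K z = 0) : ∀ᶠ z in 𝓝 0, srcMap K z ∈ cornerL σ ↔ z ∈ cornerL σ := by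
  have hd := hK.smooth.differentiable (by simp)
  obtain ⟨r, hr, hlip⟩ := hK.exists_half_lipschitz
  filter_upwards [Metric.ball_mem_nhds 0 hr] with z hz
  refine ⟨fun hs => ?_, fun hs => ?_⟩
  · set w : Phase := (z.1, fun i => if i ∈ σ then z.2 i else 0) with hw
    have hz1 : ∀ i, (srcMap K z).1 i = z.1 i := fun i => by simp [srcMap]
    have hz2 : ∀ i, (srcMap K z).2 i = z.2 i - (hamVF K z).2 i := fun i => by simp [srcMap]
    have hwm : w ∈ cornerPlane σ :=
      ⟨fun i hi => (hz1 i).symm.trans (hs.1 i hi), fun i hi => if_neg hi⟩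
    have hwr : w ∈ Metric.ball (0 : Phase) r := by
      rw [mem_ball_zero_iff] at hz ⊢
      refine (norm_le_of_components (z := z) (w := w) (fun i => le_rfl) fun i => ?_).trans_lt hz
      by_cases hi : i ∈ σ <;> simp [hw, hi]
    have hl := hlip z hz w hwr
    have h0 : z - w = 0 := by
      refine eq_of_norm_components_le (fun i => ?_) fun i => ?_
      · simp [hw]
      · by_cases hi : i ∈ σ
        · simp [hw, hi]
        · refine le_trans (le_of_eq ?_) ((norm_snd_apply_le _ i).trans hl)
          have h2 := (hs.2 i hi).1
          rw [hz2] at h2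
          have h3 := (hamVF_mem_cornerPlane hd h hwm).2 i hi
          simp only [Prod.snd_sub, Pi.sub_apply, h3, sub_zero]
          simp only [hw, hi, if_false, sub_zero]
          rw [sub_eq_zero.1 h2]
    rw [sub_eq_zero.1 h0]
    refine ⟨hwm.1, fun i hi => ⟨hwm.2 i hi, ?_⟩⟩
    have := (hs.2 i hi).2
    rwa [hz1] at this
  · have hm := hamVF_mem_cornerPlane hd h (z := z) ⟨hs.1, fun i hi => (hs.2 i hi).1⟩
    refine ⟨fun i hi => by simpa [srcMap] using hs.1 i hi, fun i hi => ⟨?_, ?_⟩⟩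
    · simp [srcMap, (hs.2 i hi).1, hm.2 i hi]
    · simpa [srcMap] using (hs.2 i hi).2

open Classical in
theorem IsAdm.tgtMap_mem_cornerL {K : Phase → ℝ} (hK : IsAdm K)
    (h : ∀ σ, ∀ z ∈ cornerPlane σ, K z = 0) (σ : Set (Fin 2)) :
    ∀ᶠ z in 𝓝 0, tgtMap K z ∈ cornerL σ ↔ z ∈ cornerL σ := by
  have hd := hK.smooth.differentiable (by simp)
  obtain ⟨r, hr, hlip⟩ := hK.exists_half_lipschitz
  have key : ∀ z ∈ Metric.ball (0 : Phase) r, z ∈ cornerPlane σ → ∀ i ∉ σ,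
      |(hamVF K z).1 i| ≤ 1 / 2 * |z.1 i| := by
    intro z hz hzm i hi
    set w : Phase := (Function.update z.1 i 0, z.2) with hw
    have hwm : w ∈ cornerPlane (insert i σ) := by
      refine ⟨fun j hj => ?_, fun j hj => hzm.2 j fun h => hj (Set.mem_insert_of_mem i h)⟩
      rcases eq_or_ne j i with rfl | hji
      · simp [hw]
      · simpa [hw, hji] using hzm.1 j (hj.resolve_left hji)
    have hwr : w ∈ Metric.ball (0 : Phase) r := by
      rw [mem_ball_zero_iff] at hz ⊢
      refine (norm_le_of_components (z := z) (w := w) (fun j => ?_) fun j => le_rfl).trans_lt hz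
      rcases eq_or_ne j i with rfl | hji
      · simp [hw]
      · simp [hw, hji]
    have hl := hlip z hz w hwr
    have h3 := (hamVF_mem_cornerPlane hd (h _) hwm).1 i (Set.mem_insert i σ)
    have h4 : ‖z - w‖ ≤ |z.1 i| := by
      have h5 : z - w = (Pi.single i (z.1 i), 0) := by
        ext j
        · rcases eq_or_ne j i with rfl | hji
          · simp [hw]
          · simp [hw, hji]
        · simp [hw]
      rw [h5, Prod.norm_mk, norm_zero, Pi.norm_single]
      simp
    have h6 := (norm_fst_apply_le _ i).trans hl
    simp only [Prod.fst_sub, Pi.sub_apply, h3, sub_zero, Real.norm_eq_abs] at h6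
    linarith
  filter_upwards [Metric.ball_mem_nhds 0 hr] with z hz
  have hz1 : ∀ i, (tgtMap K z).1 i = z.1 i + (hamVF K z).1 i := fun i => by simp [tgtMap]
  have hz2 : ∀ i, (tgtMap K z).2 i = z.2 i := fun i => by simp [tgtMap]
  refine ⟨fun hs => ?_, fun hs => ?_⟩
  · set w : Phase := (fun i => if i ∈ σ then 0 else z.1 i, z.2) with hw
    have hwm : w ∈ cornerPlane σ :=
      ⟨fun i hi => if_pos hi, fun i hi => (hz2 i).symm.trans (hs.2 i hi).1⟩
    have hwr : w ∈ Metric.ball (0 : Phase) r := by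
      rw [mem_ball_zero_iff] at hz ⊢
      refine (norm_le_of_components (z := z) (w := w) (fun i => ?_) fun i => le_rfl).trans_lt hz
      by_cases hi : i ∈ σ <;> simp [hw, hi]
    have hl := hlip z hz w hwr
    have h0 : z - w = 0 := by
      refine eq_of_norm_components_le (fun i => ?_) fun i => ?_
      · by_cases hi : i ∈ σ
        · refine le_trans (le_of_eq ?_) ((norm_fst_apply_le _ i).trans hl)
          have h2 := hs.1 i hi
          rw [hz1] at h2
          have h3 := (hamVF_mem_cornerPlane hd (h _) hwm).1 i hi
          simp only [Prod.fst_sub, Pi.sub_apply, h3, sub_zero]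
          simp only [hw, hi, if_true, sub_zero]
          rw [eq_neg_of_add_eq_zero_left h2, norm_neg]
        · simp [hw, hi]
      · simp [hw]
    have hzm : z ∈ cornerPlane σ := by rw [sub_eq_zero.1 h0]; exact hwm
    refine ⟨hzm.1, fun i hi => ⟨hzm.2 i hi, ?_⟩⟩
    have h5 := (hs.2 i hi).2
    rw [hz1] at h5
    have h6 := key z hz hzm i hi
    by_contra! hneg
    rw [abs_of_neg hneg] at h6
    have := (le_abs_self _).trans h6
    linarith
  · have hzm : z ∈ cornerPlane σ := ⟨hs.1, fun i hi => (hs.2 i hi).1⟩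
    have hm := hamVF_mem_cornerPlane hd (h _) hzm
    refine ⟨fun i hi => by rw [hz1, hs.1 i hi, hm.1 i hi, add_zero], fun i hi => ⟨?_, ?_⟩⟩
    · rw [hz2]; exact (hs.2 i hi).1
    · rw [hz1]
      have h6 := key z hz hzm i hi
      rw [abs_of_nonneg (hs.2 i hi).2] at h6
      have := (neg_abs_le _).trans' (neg_le_neg h6)
      linarith [(hs.2 i hi).2]

theorem IsAdm.isReticular_gen {K : Phase → ℝ} (hK : IsAdm K)
    (h : ∀ σ, ∀ z ∈ cornerPlane σ, K z = 0) : IsReticular (gen K) := by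
  refine ⟨hK.isSympGerm_gen, fun σ => ?_⟩
  have h1 := map_nhdsWithin_of_mem_iff hK.map_srcMap (hK.srcMap_mem_cornerL (h σ))
  have h2 := map_nhdsWithin_of_mem_iff hK.map_tgtMap (hK.tgtMap_mem_cornerL h σ)
  conv_lhs => rw [← h1]
  rw [map_map]
  conv_rhs => rw [← h2]
  refine Filter.map_congr ?_
  exact (isGen_gen hK).eq.filter_mono nhdsWithin_le_nhds

theorem tendsto_omega {α : Type*} {l : Filter α} {a b : α → Phase} {u v : Phase}
    (ha : Tendsto a l (𝓝 u)) (hb : Tendsto b l (𝓝 v)) :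
    Tendsto (fun s => omega (a s) (b s)) l (𝓝 (omega u v)) := by
  have := (omegaL.isBoundedBilinearMap.continuous.tendsto (u, v)).comp (ha.prodMk_nhds hb)
  exact this

/-- The leading term of the difference of two symplectic germs tangent to the identity is
an infinitesimally symplectic vector field. -/
theorem IsSympGerm.leading_infinitesimal {f g : Phase → Phase} (hf : IsSympGerm f)
    (hg : IsSympGerm g) (hf' : fderiv ℝ f 0 = ContinuousLinearMap.id ℝ Phase)
    (hg' : fderiv ℝ g 0 = ContinuousLinearMap.id ℝ Phase) {k : ℕ} {d : Phase → Phase}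
    (hd : ContDiff ℝ ∞ d) (hom : PosHom (k + 1) d)
    (h : (fun z => f z - g z - d z) =o[𝓝 0] fun z => ‖z‖ ^ (k + 1)) (z u v : Phase) :
    omega (fderiv ℝ d z u) v + omega u (fderiv ℝ d z v) = 0 := by
  have hfs := hf.1.2
  have hgs := hg.1.2
  have hdd := hd.differentiable (by simp)
  have h1 := isLittleO_fderiv ((hfs.self_of_nhds.sub hgs.self_of_nhds).sub hd.contDiffAt) h
  have h2 : (fun z => (fderiv ℝ f z - fderiv ℝ g z) - fderiv ℝ d z) =o[𝓝 0] fun z => ‖z‖ ^ k := by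
    refine h1.congr' ?_ EventuallyEq.rfl
    filter_upwards [hfs, hgs] with z hz hz'
    have e1 := hz.differentiableAt (n := ∞) (by simp)
    have e2 := hz'.differentiableAt (n := ∞) (by simp)
    exact (((e1.hasFDerivAt.sub e2.hasFDerivAt).sub (hdd z).hasFDerivAt).fderiv)
  have hR := (hom.fderiv hdd).tendsto_ray h2 z
  have hray := tendsto_smul_pos z
  have hfc : Tendsto (fderiv ℝ f) (𝓝 0) (𝓝 (ContinuousLinearMap.id ℝ Phase)) := by
    rw [← hf']
    exact (hfs.self_of_nhds.fderiv_right (m := 0) (by simp)).continuousAt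
  have hgc : Tendsto (fderiv ℝ g) (𝓝 0) (𝓝 (ContinuousLinearMap.id ℝ Phase)) := by
    rw [← hg']
    exact (hgs.self_of_nhds.fderiv_right (m := 0) (by simp)).continuousAt
  have hap : ∀ {T : ℝ → Phase →L[ℝ] Phase} {T₀ : Phase →L[ℝ] Phase} (w : Phase),
      Tendsto T (𝓝[>] 0) (𝓝 T₀) → Tendsto (fun s => T s w) (𝓝[>] 0) (𝓝 (T₀ w)) :=
    fun w hT => ((ContinuousLinearMap.apply ℝ Phase w).continuous.tendsto _).comp hT
  have hlim := ((tendsto_omega (hap u hR) (hap v (hgc.comp hray))).add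
    (tendsto_omega (hap u (hgc.comp hray)) (hap v hR))).add
    (tendsto_omega (hap u hR) (hap v ((hfc.sub hgc).comp hray)))
  simp only [sub_self, zero_apply, ContinuousLinearMap.id_apply] at hlim
  have h0 : omega (fderiv ℝ d z u) 0 = 0 := by simp [omega_eq]
  rw [h0, add_zero] at hlim
  refine tendsto_nhds_unique hlim (tendsto_const_nhds.congr' ?_)
  have hev := hray.eventually (hf.2.and hg.2)
  filter_upwards [hev] with s hs
  have e1 := hs.1 u v
  have e2 := hs.2 u v
  simp only [Function.comp, ← omegaL_apply] at e1 e2 ⊢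
  simp only [smul_apply, sub_apply, map_smul, map_sub, smul_eq_mul]
  linear_combination (-(s ^ k)⁻¹) * (e1 - e2)

/-- The Hamiltonian function of a homogeneous infinitesimally symplectic vector field. -/
noncomputable def hamFun (k : ℕ) (d : Phase → Phase) (z : Phase) : ℝ :=
  ((k : ℝ) + 1)⁻¹ * omega (d z) z

theorem contDiff_hamFun {k : ℕ} {d : Phase → Phase} (hd : ContDiff ℝ ∞ d) :
    ContDiff ℝ ∞ (hamFun k d) := by
  have := omegaL.isBoundedBilinearMap.contDiff.comp (hd.prodMk contDiff_id)
  exact contDiff_const.mul this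

theorem PosHom.hamFun {k : ℕ} {d : Phase → Phase} (hom : PosHom k d) :
    PosHom (k + 1) (hamFun k d) := by
  intro s hs z
  simp only [RetLag.hamFun, hom s hs z, ← omegaL_apply, map_smul, smul_apply, smul_eq_mul]
  ring

theorem hamVF_hamFun {k : ℕ} {d : Phase → Phase} (hd : ContDiff ℝ ∞ d) (hom : PosHom k d)
    (h : ∀ z u v, omega (fderiv ℝ d z u) v + omega u (fderiv ℝ d z v) = 0) :
    hamVF (hamFun k d) = d := by
  funext z
  refine sub_eq_zero.1 (eq_zero_of_omega fun v => ?_)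
  have hdz := (hd.differentiable (by simp) z)
  have h1 : HasFDerivAt (fun z => omegaL (d z) z) _ z :=
    omegaL.hasFDerivAt_of_bilinear hdz.hasFDerivAt (hasFDerivAt_id z)
  have h2 := (h1.const_mul ((k : ℝ) + 1)⁻¹).fderiv
  have h3 : fderiv ℝ (hamFun k d) z v = ((k : ℝ) + 1)⁻¹ *
      (omega (d z) v + omega (fderiv ℝ d z v) z) := by
    have := DFunLike.congr_fun h2 v
    simp only [smul_apply, smul_eq_mul] at this
    refine this.trans ?_
    simp [omegaL_apply]
  have h4 := h z v z
  rw [hom.euler hdz, omega_antisymm v, ← omegaL_apply ((k : ℝ) • d z), map_smul, smul_apply,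
    smul_eq_mul, omegaL_apply] at h4
  rw [← omegaL_apply, map_sub, sub_apply, omegaL_apply, omegaL_apply, omega_hamVF, h3,
    eq_neg_of_add_eq_zero_left h4, neg_neg]
  field_simp
  ring

/-! ### Spaces of homogeneous Hamiltonians -/

/-- Homogeneous polynomials of degree `k`. -/
def homPoly (k : ℕ) : Submodule ℝ (Phase → ℝ) where
  carrier := {K | ContDiff ℝ ∞ K ∧ PosHom k K}
  add_mem' := fun h h' => ⟨h.1.add h'.1, fun s hs z => by
    simp only [Pi.add_apply, h.2 s hs, h'.2 s hs, smul_add]⟩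
  zero_mem' := ⟨contDiff_const, fun s hs z => by simp⟩
  smul_mem' := fun c K h => ⟨contDiff_const.smul h.1, fun s hs z => by
    simp only [Pi.smul_apply, h.2 s hs]; rw [smul_comm]⟩

/-- Homogeneous Hamiltonians of Lagrangian equivalences. -/
def lagPoly (k : ℕ) : Submodule ℝ (Phase → ℝ) where
  carrier := {K | K ∈ homPoly k ∧ AffineInP K}
  add_mem' := fun {K K'} h h' => ⟨add_mem h.1 h'.1, fun q P => by
    simp only [Pi.add_apply, Fin.sum_univ_two]
    rw [h.2 q P, h'.2 q P]
    simp only [Fin.sum_univ_two]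
    ring⟩
  zero_mem' := ⟨zero_mem _, fun q P => by simp⟩
  smul_mem' := fun c K h => ⟨Submodule.smul_mem _ c h.1, fun q P => by
    simp only [Pi.smul_apply, Fin.sum_univ_two, smul_eq_mul]
    rw [h.2 q P]
    simp only [Fin.sum_univ_two]
    ring⟩

/-- Homogeneous Hamiltonians of reticular diffeomorphisms. -/
def retPoly (k : ℕ) : Submodule ℝ (Phase → ℝ) where
  carrier := {K | K ∈ homPoly k ∧ ∀ σ, ∀ z ∈ cornerPlane σ, K z = 0}
  add_mem' := fun h h' => ⟨add_mem h.1 h'.1, fun σ z hz => by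
    simp [h.2 σ z hz, h'.2 σ z hz]⟩
  zero_mem' := ⟨zero_mem _, fun _ _ _ => rfl⟩
  smul_mem' := fun c K h => ⟨Submodule.smul_mem _ c h.1, fun σ z hz => by simp [h.2 σ z hz]⟩

theorem lagPoly_le (k : ℕ) : lagPoly k ≤ homPoly k := fun _ h => h.1

theorem retPoly_le (k : ℕ) : retPoly k ≤ homPoly k := fun _ h => h.1

instance finiteDimensional_homPoly (k : ℕ) : FiniteDimensional ℝ (homPoly k) := by
  let diag : MultilinearMap ℝ (fun _ : Fin k => Phase) ℝ →ₗ[ℝ] Phase → ℝ :=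
    { toFun := fun c z => c fun _ => z
      map_add' := fun _ _ => rfl
      map_smul' := fun _ _ => rfl }
  refine Submodule.finiteDimensional_of_le (S₂ := LinearMap.range diag) fun K hK => ?_
  refine ⟨(((k.factorial : ℝ)⁻¹ • iteratedFDeriv ℝ k K 0).toMultilinearMap), ?_⟩
  funext z
  exact (hK.2.eq_diag hK.1.contDiffAt z).symm

instance finiteDimensional_lagPoly (k : ℕ) : FiniteDimensional ℝ (lagPoly k) :=
  Submodule.finiteDimensional_of_le (lagPoly_le k)

instance finiteDimensional_retPoly (k : ℕ) : FiniteDimensional ℝ (retPoly k) :=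
  Submodule.finiteDimensional_of_le (retPoly_le k)

/-- The sum of homogeneous polynomials of degrees `3, …, n + 2`. -/
def polySum (V : ℕ → Submodule ℝ (Phase → ℝ)) (n : ℕ) :
    ((j : Fin n) → V (j + 3)) →ₗ[ℝ] Phase → ℝ :=
  ∑ j : Fin n, (V (j + 3)).subtype ∘ₗ LinearMap.proj (φ := fun j : Fin n => V (j + 3)) j

theorem polySum_apply {V : ℕ → Submodule ℝ (Phase → ℝ)} {n : ℕ} (c : (j : Fin n) → V (j + 3))
    (z : Phase) : polySum V n c z = ∑ j, (c j : Phase → ℝ) z := by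
  simp [polySum]

theorem isLittleO_of_mem_homPoly {K : Phase → ℝ} {j k : ℕ} (hK : K ∈ homPoly k) (hjk : j < k) :
    K =o[𝓝 0] fun z => ‖z‖ ^ j :=
  (hK.2.isBigO hK.1.continuous.continuousAt).trans_isLittleO
    ((isLittleO_pow_pow (𝕜 := ℝ) hjk).comp_tendsto (tendsto_norm_zero (E := Phase)))

theorem isAdm_polySum {V : ℕ → Submodule ℝ (Phase → ℝ)} (hV : ∀ k, V k ≤ homPoly k) {n : ℕ}
    (c : (j : Fin n) → V (j + 3)) : IsAdm (polySum V n c) := by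
  have he : polySum V n c = fun z => ∑ j, (c j : Phase → ℝ) z := funext (polySum_apply c)
  rw [he]
  exact ⟨ContDiff.sum fun j _ => (hV _ (c j).2).1,
    IsLittleO.fun_sum fun j _ => isLittleO_of_mem_homPoly (hV _ (c j).2) (by omega)⟩

theorem affineInP_polySum {n : ℕ} (c : (j : Fin n) → lagPoly (j + 3)) :
    AffineInP (polySum lagPoly n c) := by
  intro q P
  simp only [polySum_apply, Fin.sum_univ_two, ← Finset.sum_sub_distrib, Finset.mul_sum,
    ← Finset.sum_add_distrib]
  refine Finset.sum_congr rfl fun j _ => ?_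
  rw [(c j).2.2 q P, Fin.sum_univ_two]

theorem polySum_eq_zero_of_mem_cornerPlane {n : ℕ} (c : (j : Fin n) → retPoly (j + 3))
    (σ : Set (Fin 2)) (z : Phase) (hz : z ∈ cornerPlane σ) : polySum retPoly n c z = 0 := by
  rw [polySum_apply]
  exact Finset.sum_eq_zero fun j _ => (c j).2.2 σ z hz

/-- A class of symplectic germs tangent to the identity whose infinitesimal generators are given
by `V` is exhausted, up to jets, by the germs with generating functions in `V`. -/
theorem exists_gen_approx {V : ℕ → Submodule ℝ (Phase → ℝ)} (hV : ∀ k, V k ≤ homPoly k)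
    {p : (Phase → Phase) → Prop} (hgen : ∀ n (c : (j : Fin n) → V (j + 3)), p (gen (polySum V n c)))
    (hlead : ∀ f g k G, G ∈ homPoly (k + 1) → p f → p g →
      (fun z => f z - g z - hamVF G z) =o[𝓝 0] (fun z => ‖z‖ ^ k) → G ∈ V (k + 1))
    {f : Phase → Phase} (hf : IsSympGerm f) (hf' : fderiv ℝ f 0 = ContinuousLinearMap.id ℝ Phase)
    (hpf : p f) (n : ℕ) :
    ∃ c : (j : Fin n) → V (j + 3),
      (fun z => f z - gen (polySum V n c) z) =o[𝓝 0] fun z => ‖z‖ ^ (n + 1) := by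
  induction n with
  | zero =>
    refine ⟨fun j => j.elim0, ?_⟩
    have hA := isAdm_polySum hV (n := 0) (fun j => j.elim0)
    have h1 := hasFDerivAt_iff_isLittleO_nhds_zero.1 hA.hasStrictFDerivAt_gen.hasFDerivAt
    have h2 := hasFDerivAt_iff_isLittleO_nhds_zero.1
      (hf.1.2.self_of_nhds.differentiableAt (n := ∞) (by simp)).hasFDerivAt
    rw [hf'] at h2
    refine ((h2.sub h1).norm_right.congr_left fun z => ?_).congr_right fun z => (pow_one _).symm
    simp [hf.1.1, hA.gen_zero]
  | succ n ih =>
    obtain ⟨c, hc⟩ := ih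
    have hA := isAdm_polySum hV c
    set g := gen (polySum V n c) with hg
    have hgs := hA.isSympGerm_gen
    have hsm : ContDiffAt ℝ ∞ (fun z => f z - g z) 0 :=
      hf.1.2.self_of_nhds.sub hgs.1.2.self_of_nhds
    have hz := (isLittleO_iff_iteratedFDeriv hsm (n + 1)).1 hc
    have hlt := taylor_leading hsm (n + 2) fun j hj => hz j (by omega)
    set L := iteratedFDeriv ℝ (n + 2) (fun z => f z - g z) 0 with hL
    set d : Phase → Phase := fun z => (((n + 2).factorial : ℕ) : ℝ)⁻¹ • L fun _ => z with hd
    have hds : ContDiff ℝ ∞ d := by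
      have h1 : ContDiff ℝ ∞ fun z : Phase => fun _ : Fin (n + 2) => z :=
        contDiff_pi.2 fun _ => contDiff_id
      have h2 : ContDiff ℝ ∞ fun z : Phase => L fun _ => z := L.contDiff.comp h1
      exact h2.const_smul _
    have hdh : PosHom (n + 1 + 1) d := by
      intro s hs z
      have h1 : L (fun _ => s • z) = s ^ (n + 2) • L fun _ => z := by
        simpa using L.map_smul_univ (fun _ => s) (fun _ => z)
      simp only [hd, h1]
      rw [smul_comm]
    have hinf := hf.leading_infinitesimal hgs hf' hA.hasStrictFDerivAt_gen.hasFDerivAt.fderiv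
      hds hdh hlt
    have hGd := hamVF_hamFun hds hdh hinf
    set G := hamFun (n + 1 + 1) d with hG
    have hGm : G ∈ homPoly (n + 1 + 1 + 1) := ⟨contDiff_hamFun hds, hdh.hamFun⟩
    have hGV : G ∈ V (n + 1 + 1 + 1) :=
      hlead f g _ G hGm hpf (hgen n c) (by rw [hGd]; exact hlt)
    let c' : (j : Fin (n + 1)) → V (j + 3) := Fin.snoc (α := fun j : Fin (n + 1) => V (j + 3)) c ⟨G, hGV⟩
    refine ⟨c', ?_⟩
    have hsum : ∀ z, polySum V (n + 1) c' z = polySum V n c z + G z := by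
      intro z
      rw [polySum_apply, polySum_apply, Fin.sum_univ_castSucc]
      simp [c']
    have hdiff := gen_sub_gen hA (isAdm_polySum hV c') (k := n + 2) hGm.1 hGm.2
      ((isLittleO_zero _ _).congr_left fun z => by rw [hsum]; ring)
    rw [hGd] at hdiff
    refine (hlt.sub hdiff).congr_left fun z => ?_
    simp only [hd]
    abel

theorem omega_eq_zero_of_mem_cornerPlane {σ : Set (Fin 2)} {u v : Phase} (hu : u ∈ cornerPlane σ)
    (hv : v ∈ cornerPlane σ) : omega u v = 0 := by
  refine Finset.sum_eq_zero fun i _ => ?_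
  by_cases hi : i ∈ σ
  · simp [hu.1 i hi, hv.1 i hi]
  · simp [hu.2 i hi, hv.2 i hi]

theorem isClosed_cornerPlane (σ : Set (Fin 2)) : IsClosed (cornerPlane σ) := by
  have : cornerPlane σ = (⋂ i ∈ σ, {z : Phase | z.1 i = 0}) ∩ ⋂ i ∈ σᶜ, {z : Phase | z.2 i = 0} := by
    ext z; simp [cornerPlane]
  rw [this]
  refine IsClosed.inter (isClosed_biInter fun i _ => ?_) (isClosed_biInter fun i _ => ?_) <;>
  exact isClosed_eq (by fun_prop) continuous_const

theorem cornerL_subset_cornerPlane (σ : Set (Fin 2)) : cornerL σ ⊆ cornerPlane σ :=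
  fun _ hz => ⟨hz.1, fun i hi => (hz.2 i hi).1⟩

theorem smul_sub_mem_cornerPlane {σ : Set (Fin 2)} {u v : Phase} (hu : u ∈ cornerPlane σ)
    (hv : v ∈ cornerPlane σ) (c : ℝ) : c • (u - v) ∈ cornerPlane σ :=
  ⟨fun i hi => by simp [hu.1 i hi, hv.1 i hi], fun i hi => by simp [hu.2 i hi, hv.2 i hi]⟩

theorem smul_mem_cornerL {σ : Set (Fin 2)} {z : Phase} (hz : z ∈ cornerL σ) {s : ℝ} (hs : 0 ≤ s) :
    s • z ∈ cornerL σ :=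
  ⟨fun i hi => by simp [hz.1 i hi], fun i hi =>
    ⟨by simp [(hz.2 i hi).1], by simpa using mul_nonneg hs (hz.2 i hi).2⟩⟩

theorem tendsto_smul_cornerL {σ : Set (Fin 2)} {z : Phase} (hz : z ∈ cornerL σ) :
    Tendsto (fun s : ℝ => s • z) (𝓝[>] 0) (𝓝[cornerL σ] 0) := by
  refine tendsto_nhdsWithin_iff.2 ⟨tendsto_smul_pos z, ?_⟩
  filter_upwards [self_mem_nhdsWithin] with s hs using smul_mem_cornerL hz (Set.mem_Ioi.1 hs).le

open Classical in
/-- A homogeneous polynomial vanishing on `L_σ⁰` vanishes on its linear span. -/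
theorem eq_zero_on_cornerPlane {K : Phase → ℝ} {k : ℕ} (hK : K ∈ homPoly k) {σ : Set (Fin 2)}
    (h : ∀ z ∈ cornerL σ, K z = 0) {z : Phase} (hz : z ∈ cornerPlane σ) : K z = 0 := by
  set u : Phase := (fun i => if i ∈ σ then 0 else 1, 0) with hu
  have hKa : ContDiff ℝ ω K := by
    have he : K = fun z => (((k.factorial : ℕ) : ℝ)⁻¹ • iteratedFDeriv ℝ k K 0) fun _ => z :=
      funext fun z => hK.2.eq_diag hK.1.contDiffAt z
    rw [he]
    have h1 : ContDiff ℝ ω fun z : Phase => fun _ : Fin k => z := contDiff_pi.2 fun _ => contDiff_id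
    exact ContDiff.comp (ContinuousMultilinearMap.contDiff _) h1
  have hl : ContDiff ℝ ω fun s : ℝ => K (z + s • u) :=
    hKa.comp (contDiff_const.add (contDiff_id.smul contDiff_const))
  have hmem : ∀ s : ℝ, ‖z‖ ≤ s → z + s • u ∈ cornerL σ := by
    refine fun s hs => ⟨fun i hi => by simp [hu, hi, hz.1 i hi], fun i hi =>
      ⟨by simp [hu, hz.2 i hi], ?_⟩⟩
    have h1 := norm_fst_apply_le z i
    have h2 := neg_abs_le (z.1 i)
    rw [Real.norm_eq_abs] at h1
    simp only [hu, Prod.fst_add, Prod.smul_fst, Pi.add_apply, Pi.smul_apply, hi, if_false,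
      smul_eq_mul, mul_one]
    linarith
  have ha := (contDiff_omega_iff_analyticOnNhd.1 hl)
  have hev : (fun s : ℝ => K (z + s • u)) =ᶠ[𝓝 (‖z‖ + 1)] fun _ => 0 := by
    filter_upwards [lt_mem_nhds (lt_add_one ‖z‖)] with s hs using h _ (hmem s hs.le)
  have := congrFun (ha.eq_of_eventuallyEq analyticOnNhd_const hev) 0
  simpa using this

theorem mem_retPoly_of_leading {f g : Phase → Phase} {k : ℕ} {G : Phase → ℝ}
    (hG : G ∈ homPoly (k + 1))
    (hf : ∀ σ, ∀ᶠ z in 𝓝[cornerL σ] 0, f z ∈ cornerL σ)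
    (hg : ∀ σ, ∀ᶠ z in 𝓝[cornerL σ] 0, g z ∈ cornerL σ)
    (h : (fun z => f z - g z - hamVF G z) =o[𝓝 0] fun z => ‖z‖ ^ k) : G ∈ retPoly (k + 1) := by
  refine ⟨hG, fun σ z hz => eq_zero_on_cornerPlane hG (fun z hz => ?_) hz⟩
  have h1 := (hG.2.hamVF hG.1).tendsto_ray h z
  have h2 : hamVF G z ∈ cornerPlane σ := by
    refine (isClosed_cornerPlane σ).mem_of_tendsto h1 ?_
    filter_upwards [(tendsto_smul_cornerL hz).eventually ((hf σ).and (hg σ))] with s hs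
    exact smul_sub_mem_cornerPlane (cornerL_subset_cornerPlane σ hs.1)
      (cornerL_subset_cornerPlane σ hs.2) _
  have h3 := hG.2.euler (hG.1.differentiable (by simp) z)
  rw [← omega_hamVF, omega_eq_zero_of_mem_cornerPlane h2 (cornerL_subset_cornerPlane σ hz)] at h3
  have h4 : ((k + 1 : ℕ) : ℝ) ≠ 0 := by positivity
  exact (smul_eq_zero.1 h3.symm).resolve_left h4

theorem affineInP_of_hamVF {G : Phase → ℝ} (hG : Differentiable ℝ G)
    (h : ∀ q P, (hamVF G (q, P)).1 = (hamVF G (q, 0)).1) : AffineInP G := by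
  intro q
  set a := (hamVF G (q, 0)).1 with ha
  have hconst : ∀ P P' : Plane, G (q, P) - ∑ i, P i * a i = G (q, P') - ∑ i, P' i * a i := by
    have hder : ∀ P, HasFDerivAt (fun P : Plane => G (q, P) - ∑ i, P i * a i)
        (0 : Plane →L[ℝ] ℝ) P := by
      intro P
      have h1 : HasFDerivAt (fun P : Plane => G (q, P))
          ((fderiv ℝ G (q, P)).comp (ContinuousLinearMap.inr ℝ Plane Plane)) P :=
        (hG (q, P)).hasFDerivAt.comp P (f := fun P : Plane => (q, P))
          (hasFDerivAt_prodMk_right q P)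
      have h2 : HasFDerivAt (fun P : Plane => ∑ i, P i * a i)
          (∑ i, a i • (ContinuousLinearMap.proj i : Plane →L[ℝ] ℝ)) P := by
        refine HasFDerivAt.fun_sum fun i _ => ?_
        exact (hasFDerivAt_apply i P).mul_const (a i)
      refine (h1.sub h2).congr_fderiv ?_
      ext v
      have h3 : fderiv ℝ G (q, P) (0, v) = omega (hamVF G (q, P)) (0, v) := (omega_hamVF _ _ _).symm
      have h4 : (hamVF G (q, P)).1 = a := h q P
      simp only [sub_apply, ContinuousLinearMap.comp_apply, ContinuousLinearMap.inr_apply, h3,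
        Fin.sum_univ_two, zero_apply, omega_eq, h4]
      simp
    intro P P'
    exact is_const_of_fderiv_eq_zero (fun P => (hder P).differentiableAt)
      (fun P => (hder P).fderiv) P P'
  intro P
  have h0 := hconst P 0
  have hi : ∀ i, a i = G (q, Pi.single i 1) - G (q, 0) := by
    intro i
    have := hconst (Pi.single i 1) 0
    fin_cases i <;> simp [Fin.sum_univ_two] at this ⊢ <;> linarith
  simp only [← hi]
  simp at h0 ⊢
  linarith

theorem mem_lagPoly_of_leading {f g : Phase → Phase} {k : ℕ} {G : Phase → ℝ}
    (hG : G ∈ homPoly (k + 1))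
    (hf : ∃ b : Plane → Plane, ∀ᶠ z in 𝓝 0, (f z).1 = b z.1)
    (hg : ∃ b : Plane → Plane, ∀ᶠ z in 𝓝 0, (g z).1 = b z.1)
    (h : (fun z => f z - g z - hamVF G z) =o[𝓝 0] fun z => ‖z‖ ^ k) : G ∈ lagPoly (k + 1) := by
  obtain ⟨b, hb⟩ := hf
  obtain ⟨b', hb'⟩ := hg
  refine ⟨hG, affineInP_of_hamVF (hG.1.differentiable (by simp)) fun q P => ?_⟩
  have h1 := fun z => (continuous_fst.tendsto _).comp ((hG.2.hamVF hG.1).tendsto_ray h z)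
  refine tendsto_nhds_unique (h1 (q, P)) ((h1 (q, 0)).congr' ?_)
  filter_upwards [(tendsto_smul_pos (q, P)).eventually (hb.and hb'),
    (tendsto_smul_pos (q, (0 : Plane))).eventually (hb.and hb')] with s hs hs'
  simp only [Function.comp, Prod.smul_fst, Prod.fst_sub, hs.1, hs.2, hs'.1, hs'.2]

theorem IsReticular.eventually_mem {φ : Phase → Phase} (h : IsReticular φ) (σ : Set (Fin 2)) :
    ∀ᶠ z in 𝓝[cornerL σ] 0, φ z ∈ cornerL σ := by
  have h1 : Tendsto φ (𝓝[cornerL σ] 0) (𝓝[cornerL σ] 0) := (h.2 σ).le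
  exact h1.eventually self_mem_nhdsWithin

/-- Reticular diffeomorphism germs tangent to the identity have polynomial generating functions up
to jets. -/
theorem exists_gen_approx_of_reticular {φ : Phase → Phase} (hφ : IsSympGerm φ)
    (hφ' : fderiv ℝ φ 0 = ContinuousLinearMap.id ℝ Phase)
    (hmem : ∀ σ, ∀ᶠ z in 𝓝[cornerL σ] 0, φ z ∈ cornerL σ) (n : ℕ) :
    ∃ c : (j : Fin n) → retPoly (j + 3),
      (fun z => φ z - gen (polySum retPoly n c) z) =o[𝓝 0] fun z => ‖z‖ ^ (n + 1) :=
  exists_gen_approx retPoly_le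
    (p := fun f => ∀ σ, ∀ᶠ z in 𝓝[cornerL σ] 0, f z ∈ cornerL σ)
    (fun _ c => ((isAdm_polySum retPoly_le c).isReticular_gen
      (polySum_eq_zero_of_mem_cornerPlane c)).eventually_mem)
    (fun _ _ _ _ hG hf hg h => mem_retPoly_of_leading hG hf hg h) hφ hφ' hmem n

/-- Lagrangian equivalences tangent to the identity have polynomial generating functions up
to jets. -/
theorem exists_gen_approx_of_lagrangian {Θ : Phase → Phase} (hΘ : IsSympGerm Θ)
    (hΘ' : fderiv ℝ Θ 0 = ContinuousLinearMap.id ℝ Phase)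
    (hb : ∃ b : Plane → Plane, ∀ᶠ z in 𝓝 0, (Θ z).1 = b z.1) (n : ℕ) :
    ∃ c : (j : Fin n) → lagPoly (j + 3),
      (fun z => Θ z - gen (polySum lagPoly n c) z) =o[𝓝 0] fun z => ‖z‖ ^ (n + 1) :=
  exists_gen_approx lagPoly_le
    (p := fun f => ∃ b : Plane → Plane, ∀ᶠ z in 𝓝 0, (f z).1 = b z.1)
    (fun _ c => by
      obtain ⟨-, b, -, h⟩ := (isAdm_polySum lagPoly_le c).isLagrangianEquivalence_gen
        (affineInP_polySum c)
      exact ⟨b, h⟩)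
    (fun _ _ _ _ hG hf hg h => mem_lagPoly_of_leading hG hf hg h) hΘ hΘ' hb n

/-! ### Linear symplectic maps -/

/-- Linear maps preserving the symplectic form. -/
def IsSympLin (T : Phase →L[ℝ] Phase) : Prop := ∀ u v, omega (T u) (T v) = omega u v

theorem IsSympLin.injective {T : Phase →L[ℝ] Phase} (hT : IsSympLin T) : Function.Injective T := by
  refine (injective_iff_map_eq_zero T).2 fun u hu => eq_zero_of_omega fun v => ?_
  rw [← hT, hu]
  simp [omega_eq]

theorem IsSympLin.exists_equiv {T : Phase →L[ℝ] Phase} (hT : IsSympLin T) :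
    ∃ e : Phase ≃L[ℝ] Phase, (e : Phase →L[ℝ] Phase) = T :=
  ⟨(LinearEquiv.ofInjectiveEndo (T : Phase →ₗ[ℝ] Phase) hT.injective).toContinuousLinearEquiv,
    ContinuousLinearMap.ext fun _ => rfl⟩

theorem IsSympLin.isSympGerm {T : Phase →L[ℝ] Phase} (hT : IsSympLin T) : IsSympGerm T :=
  ⟨⟨map_zero T, Eventually.of_forall fun _ => T.contDiff.contDiffAt⟩,
    Eventually.of_forall fun z u v => by rw [T.fderiv]; exact hT u v⟩

theorem IsSympLin.comp {T T' : Phase →L[ℝ] Phase} (hT : IsSympLin T) (hT' : IsSympLin T') :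
    IsSympLin (T.comp T') := fun u v => (hT _ _).trans (hT' u v)

theorem IsSympGerm.isSympLin_fderiv {S : Phase → Phase} (hS : IsSympGerm S) :
    IsSympLin (fderiv ℝ S 0) := hS.2.self_of_nhds

theorem IsSympGerm.tendsto {S : Phase → Phase} (hS : IsSympGerm S) : Tendsto S (𝓝 0) (𝓝 0) := by
  have := hS.1.2.self_of_nhds.continuousAt.tendsto
  rwa [hS.1.1] at this

theorem IsSympGerm.hasFDerivAt {S : Phase → Phase} (hS : IsSympGerm S) :
    HasFDerivAt S (fderiv ℝ S 0) 0 :=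
  (hS.1.2.self_of_nhds.differentiableAt (by simp)).hasFDerivAt

theorem IsSympGerm.comp {S T : Phase → Phase} (hS : IsSympGerm S) (hT : IsSympGerm T) :
    IsSympGerm (S ∘ T) := by
  refine ⟨⟨by simp [hT.1.1, hS.1.1], ?_⟩, ?_⟩
  · filter_upwards [hT.1.2, hT.tendsto.eventually hS.1.2] with z h1 h2 using h2.comp z h1
  · filter_upwards [hT.1.2, hT.tendsto.eventually hS.1.2, hT.2, hT.tendsto.eventually hS.2]
      with z h1 h2 h3 h4 u v
    rw [fderiv_comp z (h2.differentiableAt (by simp)) (h1.differentiableAt (by simp))]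
    exact (h4 _ _).trans (h3 u v)

theorem IsSympGerm.exists_inverse {S : Phase → Phase} (hS : IsSympGerm S) :
    ∃ T, IsSympGerm T ∧ (∀ᶠ z in 𝓝 0, T (S z) = z) ∧ ∀ᶠ z in 𝓝 0, S (T z) = z := by
  obtain ⟨e, he⟩ := hS.isSympLin_fderiv.exists_equiv
  obtain ⟨T, h0, h1, h2, h3⟩ := exists_smooth_local_inverse hS.1.2 e (by
    rw [he]; exact hS.hasFDerivAt)
  rw [hS.1.1] at h0 h1 h3
  refine ⟨T, ⟨⟨h0, h1⟩, ?_⟩, h2, h3⟩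
  have hT : Tendsto T (𝓝 0) (𝓝 0) := by
    have := h1.self_of_nhds.continuousAt.tendsto
    rwa [h0] at this
  filter_upwards [h1, hT.eventually hS.1.2, hT.eventually hS.2, h3.eventually_nhds]
    with z hz hs hω hz' u v
  have hc : (fderiv ℝ S (T z)).comp (fderiv ℝ T z) = ContinuousLinearMap.id ℝ Phase := by
    rw [← fderiv_comp z (hs.differentiableAt (by simp)) (hz.differentiableAt (by simp)),
      ← fderiv_id (x := z)]
    exact EventuallyEq.fderiv_eq hz'
  have hc' : ∀ w, fderiv ℝ S (T z) (fderiv ℝ T z w) = w := fun w => DFunLike.congr_fun hc w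
  rw [← hω, hc', hc']

/-! ### Reticular diffeomorphisms and Lagrangian equivalences -/

theorem IsReticular.comp {φ ψ : Phase → Phase} (hφ : IsReticular φ) (hψ : IsReticular ψ) :
    IsReticular (φ ∘ ψ) :=
  ⟨hφ.1.comp hψ.1, fun σ => by rw [← map_map, hψ.2, hφ.2]⟩

theorem IsReticular.of_inverse {φ T : Phase → Phase} (hφ : IsReticular φ) (hT : IsSympGerm T)
    (h : ∀ᶠ z in 𝓝 0, T (φ z) = z) : IsReticular T := by
  refine ⟨hT, fun σ => ?_⟩
  conv_lhs => rw [← hφ.2 σ]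
  rw [map_map, Filter.map_congr (m₁ := T ∘ φ) (m₂ := id) (h.filter_mono nhdsWithin_le_nhds), map_id]

theorem IsReticular.exists_inverse {φ : Phase → Phase} (hφ : IsReticular φ) :
    ∃ T, IsReticular T ∧ (∀ᶠ z in 𝓝 0, T (φ z) = z) ∧ ∀ᶠ z in 𝓝 0, φ (T z) = z := by
  obtain ⟨T, h1, h2, h3⟩ := hφ.1.exists_inverse
  exact ⟨T, hφ.of_inverse h1 h2, h2, h3⟩

/-- Two extensions of the same reticular Lagrangian embedding differ by a reticular
diffeomorphism. -/
theorem exists_reticular_factor {S S' : Phase → Phase} (hS : IsSympGerm S) (hS' : IsSympGerm S')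
    (h : ∀ σ, map S (𝓝[cornerL σ] 0) = map S' (𝓝[cornerL σ] 0)) :
    ∃ φ, IsReticular φ ∧ S =ᶠ[𝓝 0] S' ∘ φ := by
  obtain ⟨T, h1, h2, h3⟩ := hS'.exists_inverse
  refine ⟨T ∘ S, ⟨h1.comp hS, fun σ => ?_⟩, ?_⟩
  · rw [← map_map, h, map_map, Filter.map_congr (m₁ := T ∘ S') (m₂ := id) (h2.filter_mono nhdsWithin_le_nhds), map_id]
  · filter_upwards [hS.tendsto.eventually h3] with z hz using hz.symm

theorem IsLagrangianEquivalence.comp {Θ Θ' : Phase → Phase} (h : IsLagrangianEquivalence Θ)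
    (h' : IsLagrangianEquivalence Θ') : IsLagrangianEquivalence (Θ ∘ Θ') := by
  obtain ⟨hs, g, hg, hb⟩ := h
  obtain ⟨hs', g', hg', hb'⟩ := h'
  have ht : Tendsto g' (𝓝 0) (𝓝 0) := by
    have := hg'.1.2.self_of_nhds.continuousAt.tendsto
    rwa [hg'.1.1] at this
  refine ⟨hs.comp hs', g ∘ g', ⟨⟨by simp [hg.1.1, hg'.1.1], ?_⟩, ?_⟩, ?_⟩
  · filter_upwards [hg'.1.2, ht.eventually hg.1.2] with z h1 h2 using h2.comp z h1
  · have h1 : DifferentiableAt ℝ g (g' 0) := by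
      rw [hg'.1.1]; exact hg.1.2.self_of_nhds.differentiableAt (by simp)
    rw [fderiv_comp 0 h1 (hg'.1.2.self_of_nhds.differentiableAt (by simp)), hg'.1.1]
    exact hg.2.comp hg'.2
  · filter_upwards [hb', hs'.tendsto.eventually hb] with z h1 h2
    simp only [Function.comp, h2, h1]

theorem IsSympLin.isLagrangianEquivalence {T : Phase →L[ℝ] Phase} (hT : IsSympLin T)
    (h : ∀ p, (T (0, p)).1 = 0) : IsLagrangianEquivalence T := by
  set g : Plane →L[ℝ] Plane := (ContinuousLinearMap.fst ℝ Plane Plane).comp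
    (T.comp (ContinuousLinearMap.inl ℝ Plane Plane)) with hg
  refine ⟨hT.isSympGerm, g, ⟨⟨map_zero g, Eventually.of_forall fun _ => g.contDiff.contDiffAt⟩, ?_⟩,
    Eventually.of_forall fun z => ?_⟩
  · rw [g.fderiv]
    have hi : Function.Injective (g : Plane →ₗ[ℝ] Plane) := by
      refine (injective_iff_map_eq_zero _).2 fun q hq => ?_
      have hq' : (T (q, 0)).1 = 0 := hq
      ext i
      have := hT (q, 0) (0, Pi.single i 1)
      rw [omega_eq, omega_eq, hq', h] at this
      fin_cases i <;> simpa using this.symm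
    exact ⟨hi, LinearMap.injective_iff_surjective.1 hi⟩
  · have : T z = T (z.1, 0) + T (0, z.2) := by rw [← map_add]; simp
    rw [this, Prod.fst_add, h, add_zero]; rfl

theorem IsLagrangianEquivalence.fderiv_fst {Θ : Phase → Phase} (h : IsLagrangianEquivalence Θ)
    (p : Plane) : (fderiv ℝ Θ 0 (0, p)).1 = 0 := by
  obtain ⟨hs, g, -, hb⟩ := h
  have h1 : HasDerivAt (fun s : ℝ => (Θ (s • ((0 : Plane), p))).1) (fderiv ℝ Θ 0 (0, p)).1 0 := by
    have hl : HasDerivAt (fun s : ℝ => s • ((0 : Plane), p)) ((0 : Plane), p) 0 := by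
      simpa using (hasDerivAt_id (0 : ℝ)).smul_const ((0 : Plane), p)
    have h2 : HasFDerivAt Θ (fderiv ℝ Θ 0) ((0 : ℝ) • ((0 : Plane), p)) := by
      simpa using hs.hasFDerivAt
    exact (ContinuousLinearMap.fst ℝ Plane Plane).hasFDerivAt.comp_hasDerivAt (0 : ℝ)
      (h2.comp_hasDerivAt (0 : ℝ) hl)
  have ht : Tendsto (fun s : ℝ => s • ((0 : Plane), p)) (𝓝 0) (𝓝 0) := by
    have : Continuous (fun s : ℝ => s • ((0 : Plane), p)) := by fun_prop
    simpa using this.tendsto 0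
  refine h1.unique ((hasDerivAt_const (0 : ℝ) (g 0)).congr_of_eventuallyEq ?_)
  filter_upwards [ht.eventually hb] with s hs
  rw [hs]; simp

theorem isClosed_cornerL (σ : Set (Fin 2)) : IsClosed (cornerL σ) := by
  have : cornerL σ = (⋂ i ∈ σ, {z : Phase | z.1 i = 0}) ∩
      ⋂ i ∈ σᶜ, {z : Phase | z.2 i = 0} ∩ {z : Phase | 0 ≤ z.1 i} := by
    ext z; simp [cornerL]
  rw [this]
  refine IsClosed.inter (isClosed_biInter fun i _ => ?_) (isClosed_biInter fun i _ =>
    IsClosed.inter ?_ (isClosed_le continuous_const (by fun_prop))) <;>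
  exact isClosed_eq (by fun_prop) continuous_const

theorem IsReticular.fderiv_mem_cornerL {φ : Phase → Phase} (h : IsReticular φ) {σ : Set (Fin 2)}
    {z : Phase} (hz : z ∈ cornerL σ) : fderiv ℝ φ 0 z ∈ cornerL σ := by
  have h1 : HasDerivAt (fun s : ℝ => φ (s • z)) (fderiv ℝ φ 0 z) 0 := by
    have hl : HasDerivAt (fun s : ℝ => s • z) z 0 := by
      simpa using (hasDerivAt_id (0 : ℝ)).smul_const z
    have h2 : HasFDerivAt φ (fderiv ℝ φ 0) ((0 : ℝ) • z) := by simpa using h.1.hasFDerivAt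
    exact h2.comp_hasDerivAt (0 : ℝ) hl
  have h2 := (hasDerivAt_iff_tendsto_slope.1 h1).mono_left
    (nhdsWithin_mono 0 fun s (hs : s ∈ Set.Ioi 0) => (ne_of_gt hs : s ≠ 0))
  refine (isClosed_cornerL σ).mem_of_tendsto h2 ?_
  filter_upwards [(tendsto_smul_cornerL hz).eventually (h.eventually_mem σ), self_mem_nhdsWithin]
    with s hs hs0
  simp only [slope, zero_smul, h.1.1.1, vsub_eq_sub, sub_zero]
  exact smul_mem_cornerL hs (inv_nonneg.2 (Set.mem_Ioi.1 hs0).le)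

/-! ### Explicit linear maps -/

/-- `(x, p) ↦ (D x, D⁻¹ p)` for a diagonal matrix `D`. -/
noncomputable def diagMap (D : Fin 2 → ℝ) : Phase →L[ℝ] Phase :=
  LinearMap.toContinuousLinearMap
    { toFun := fun z => (fun i => D i * z.1 i, fun i => (D i)⁻¹ * z.2 i)
      map_add' := fun u v => by ext i <;> simp [mul_add]
      map_smul' := fun c u => by ext i <;> simp <;> ring }

theorem diagMap_apply (D : Fin 2 → ℝ) (z : Phase) :
    diagMap D z = (fun i => D i * z.1 i, fun i => (D i)⁻¹ * z.2 i) := rfl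

/-- `(x, p) ↦ (-(p + M x), x)`, where `M` is the symmetric matrix with entries
`M 0`, `M 1`, `M 2`. -/
noncomputable def quadMap (M : Fin 3 → ℝ) : Phase →L[ℝ] Phase :=
  LinearMap.toContinuousLinearMap
    { toFun := fun z => (![-(z.2 0 + M 0 * z.1 0 + M 1 * z.1 1),
        -(z.2 1 + M 1 * z.1 0 + M 2 * z.1 1)], z.1)
      map_add' := fun u v => by
        ext i <;> fin_cases i <;> simp <;> ring
      map_smul' := fun c u => by
        ext i <;> fin_cases i <;> simp <;> ring }

theorem quadMap_apply (M : Fin 3 → ℝ) (z : Phase) :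
    quadMap M z = (![-(z.2 0 + M 0 * z.1 0 + M 1 * z.1 1),
        -(z.2 1 + M 1 * z.1 0 + M 2 * z.1 1)], z.1) := rfl

/-- The determinant of the matrix with rows `g 0, g 1` and `g 2, g 3`. -/
def detMap (g : Fin 4 → ℝ) : ℝ := g 0 * g 3 - g 1 * g 2

/-- `(q, p) ↦ (g q, g⁻ᵀ (p + w q))`, where `w` is the symmetric matrix with entries
`w 0`, `w 1`, `w 2`. -/
noncomputable def affMap (g : Fin 4 → ℝ) (w : Fin 3 → ℝ) : Phase →L[ℝ] Phase :=
  LinearMap.toContinuousLinearMap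
    { toFun := fun z => (![g 0 * z.1 0 + g 1 * z.1 1, g 2 * z.1 0 + g 3 * z.1 1],
        ![(g 3 * (z.2 0 + w 0 * z.1 0 + w 1 * z.1 1) -
            g 2 * (z.2 1 + w 1 * z.1 0 + w 2 * z.1 1)) / detMap g,
          (g 0 * (z.2 1 + w 1 * z.1 0 + w 2 * z.1 1) -
            g 1 * (z.2 0 + w 0 * z.1 0 + w 1 * z.1 1)) / detMap g])
      map_add' := fun u v => by
        ext i <;> fin_cases i <;> simp <;> ring
      map_smul' := fun c u => by
        ext i <;> fin_cases i <;> simp <;> ring }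

theorem affMap_apply (g : Fin 4 → ℝ) (w : Fin 3 → ℝ) (z : Phase) :
    affMap g w z = (![g 0 * z.1 0 + g 1 * z.1 1, g 2 * z.1 0 + g 3 * z.1 1],
        ![(g 3 * (z.2 0 + w 0 * z.1 0 + w 1 * z.1 1) -
            g 2 * (z.2 1 + w 1 * z.1 0 + w 2 * z.1 1)) / detMap g,
          (g 0 * (z.2 1 + w 1 * z.1 0 + w 2 * z.1 1) -
            g 1 * (z.2 0 + w 0 * z.1 0 + w 1 * z.1 1)) / detMap g]) := rfl

theorem isSympLin_diagMap {D : Fin 2 → ℝ} (hD : ∀ i, D i ≠ 0) : IsSympLin (diagMap D) := by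
  intro u v
  have h0 := hD 0
  have h1 := hD 1
  simp only [diagMap_apply, omega_eq]
  field_simp

theorem isSympLin_quadMap (M : Fin 3 → ℝ) : IsSympLin (quadMap M) := by
  intro u v
  simp [quadMap_apply, omega_eq]
  ring

theorem isSympLin_affMap {g : Fin 4 → ℝ} (hg : detMap g ≠ 0) (w : Fin 3 → ℝ) :
    IsSympLin (affMap g w) := by
  intro u v
  simp [affMap_apply, omega_eq]
  field_simp
  simp only [detMap]
  ring

theorem affMap_fst_zero (g : Fin 4 → ℝ) (w : Fin 3 → ℝ) (p : Plane) :
    (affMap g w (0, p)).1 = 0 := by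
  ext i; fin_cases i <;> simp [affMap_apply]

theorem isReticular_diagMap {D : Fin 2 → ℝ} (hD : ∀ i, 0 < D i) : IsReticular (diagMap D) := by
  have hs := isSympLin_diagMap fun i => (hD i).ne'
  refine ⟨hs.isSympGerm, fun σ => map_nhdsWithin_of_mem_iff ?_ (Eventually.of_forall fun z => ?_)⟩
  · obtain ⟨e, he⟩ := hs.exists_equiv
    have := e.toHomeomorph.map_nhds_eq 0
    rw [← he]
    simpa using this
  · simp [cornerL, diagMap_apply, (hD _).ne', mul_nonneg_iff_of_pos_left (hD _)]

theorem exists_eq_diagMap {T : Phase →L[ℝ] Phase} (hT : IsSympLin T)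
    (h : ∀ σ, ∀ z ∈ cornerL σ, T z ∈ cornerL σ) :
    ∃ D : Fin 2 → ℝ, (∀ i, 0 < D i) ∧ T = diagMap D := by
  have a1 : ∀ i, ∀ j, (T (Pi.single i 1, 0)).2 j = 0 := fun i j =>
    ((h ∅ (Pi.single i 1, 0) ⟨by simp, fun k _ => ⟨rfl, by
      by_cases hk : k = i <;> simp [hk]⟩⟩).2 j (by simp)).1
  have a2 : ∀ i, 0 ≤ (T (Pi.single i 1, 0)).1 i := fun i =>
    ((h ∅ (Pi.single i 1, 0) ⟨by simp, fun k _ => ⟨rfl, by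
      by_cases hk : k = i <;> simp [hk]⟩⟩).2 i (by simp)).2
  have a3 : ∀ i j, j ≠ i → (T (Pi.single i 1, 0)).1 j = 0 := fun i j hij =>
    (h {j} (Pi.single i 1, 0) ⟨by simp [hij], fun k _ => ⟨rfl, by
      by_cases hk : k = i <;> simp [hk]⟩⟩).1 j rfl
  have a4 : ∀ i j, (T (0, Pi.single i 1)).1 j = 0 := fun i j =>
    (h Set.univ (0, Pi.single i 1) ⟨by simp, by simp⟩).1 j trivial
  have a5 : ∀ i j, j ≠ i → (T (0, Pi.single i 1)).2 j = 0 := fun i j hij =>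
    ((h {i} (0, Pi.single i 1) ⟨by simp, fun k hk => by
      simp [show k ≠ i from hk]⟩).2 j hij).1
  have a6 : ∀ i, (T (Pi.single i 1, 0)).1 i * (T (0, Pi.single i 1)).2 i = 1 := by
    intro i
    have := hT (Pi.single i 1, 0) (0, Pi.single i 1)
    rw [omega_eq, omega_eq] at this
    fin_cases i <;> simpa [a1, a4, a3, a5] using this
  refine ⟨fun i => (T (Pi.single i 1, 0)).1 i, fun i => ?_, ?_⟩
  · refine lt_of_le_of_ne (a2 i) fun h0 => ?_
    have := a6 i
    rw [show (T (Pi.single i 1, 0)).1 i = 0 from h0.symm] at this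
    simp at this
  · have a7 : ∀ i, ((T (Pi.single i 1, 0)).1 i)⁻¹ = (T (0, Pi.single i 1)).2 i := fun i =>
      inv_eq_of_mul_eq_one_right (a6 i)
    refine ContinuousLinearMap.ext fun z => ?_
    conv_lhs => rw [phase_decomp z]
    simp only [map_add, map_smul, diagMap_apply, a7]
    ext i <;> fin_cases i <;> simp [a1, a3, a4, a5] <;> ring

theorem exists_eq_affMap {T : Phase →L[ℝ] Phase} (hT : IsSympLin T)
    (h : ∀ p, (T (0, p)).1 = 0) :
    ∃ g w, detMap g ≠ 0 ∧ T = affMap g w := by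
  have e1 := hT (Pi.single 0 1, 0) (0, Pi.single 0 1)
  have e2 := hT (Pi.single 0 1, 0) (0, Pi.single 1 1)
  have e3 := hT (Pi.single 1 1, 0) (0, Pi.single 0 1)
  have e4 := hT (Pi.single 1 1, 0) (0, Pi.single 1 1)
  have e5 := hT (Pi.single 0 1, 0) (Pi.single 1 1, 0)
  simp only [omega_eq, h] at e1 e2 e3 e4 e5
  simp at e1 e2 e3 e4 e5
  set a := T (Pi.single 0 1, 0) with ha
  set b := T (Pi.single 1 1, 0) with hb
  set c := T (0, Pi.single 0 1) with hc
  set d := T (0, Pi.single 1 1) with hd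
  have c0 : ∀ i, c.1 i = 0 := fun i => by rw [hc, h]; rfl
  have d0 : ∀ i, d.1 i = 0 := fun i => by rw [hd, h]; rfl
  have hdet : (a.1 0 * b.1 1 - b.1 0 * a.1 1) * (c.2 0 * d.2 1 - c.2 1 * d.2 0) = 1 := by
    linear_combination (b.1 0 * d.2 0 + b.1 1 * d.2 1) * e1 + e4 -
      (b.1 0 * c.2 0 + b.1 1 * c.2 1) * e2
  have hdet' : a.1 0 * b.1 1 - b.1 0 * a.1 1 ≠ 0 := left_ne_zero_of_mul_eq_one hdet
  refine ⟨![a.1 0, b.1 0, a.1 1, b.1 1], ![a.1 0 * a.2 0 + a.1 1 * a.2 1,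
    b.1 0 * a.2 0 + b.1 1 * a.2 1, b.1 0 * b.2 0 + b.1 1 * b.2 1], ?_, ?_⟩
  · simpa [detMap] using hdet'
  · refine ContinuousLinearMap.ext fun z => ?_
    conv_lhs => rw [phase_decomp z]
    have f1 : c.2 0 * (a.1 0 * b.1 1 - b.1 0 * a.1 1) = b.1 1 := by
      linear_combination b.1 1 * e1 - a.1 1 * e3
    have f2 : c.2 1 * (a.1 0 * b.1 1 - b.1 0 * a.1 1) = -b.1 0 := by
      linear_combination a.1 0 * e3 - b.1 0 * e1
    have f3 : d.2 0 * (a.1 0 * b.1 1 - b.1 0 * a.1 1) = -a.1 1 := by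
      linear_combination b.1 1 * e2 - a.1 1 * e4
    have f4 : d.2 1 * (a.1 0 * b.1 1 - b.1 0 * a.1 1) = a.1 0 := by
      linear_combination a.1 0 * e4 - b.1 0 * e2
    simp only [map_add, map_smul, affMap_apply, ← ha, ← hb, ← hc, ← hd, detMap]
    ext i <;> fin_cases i <;> simp [c0, d0]
    · ring
    · ring
    · rw [eq_div_iff hdet']
      linear_combination z.2 0 * f1 + z.2 1 * f3 + z.1 1 * b.1 1 * e5
    · rw [eq_div_iff hdet']
      linear_combination z.2 0 * f2 + z.2 1 * f4 - z.1 1 * b.1 0 * e5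

/-! ### The parametrization -/

theorem contDiff_quadMap : ContDiff ℝ ∞ fun p : (Fin 3 → ℝ) × Phase => quadMap p.1 p.2 := by
  simp only [quadMap_apply]
  refine ContDiff.prodMk (contDiff_pi.2 fun i => ?_) (by fun_prop)
  fin_cases i <;> simp <;> fun_prop

theorem contDiffAt_affMap {g : Fin 4 → ℝ} (hg : detMap g ≠ 0) (w : Fin 3 → ℝ) (z : Phase) :
    ContDiffAt ℝ ∞ (fun p : ((Fin 4 → ℝ) × (Fin 3 → ℝ)) × Phase => affMap p.1.1 p.1.2 p.2)
      ((g, w), z) := by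
  simp only [affMap_apply]
  have hd : ContDiffAt ℝ ∞ (fun p : ((Fin 4 → ℝ) × (Fin 3 → ℝ)) × Phase => detMap p.1.1)
      ((g, w), z) := by
    simp only [detMap]
    fun_prop
  refine ContDiffAt.prodMk (contDiffAt_pi.2 fun i => ?_) (contDiffAt_pi.2 fun i => ?_)
  · fin_cases i <;> simp <;> fun_prop
  · fin_cases i <;> simp <;> refine ContDiffAt.div ?_ hd hg <;> fun_prop

/-- The parameters of the orbit: a linear Lagrangian equivalence, a symmetric matrix, and
polynomial Hamiltonians of Lagrangian equivalences and of reticular diffeomorphisms. -/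
abbrev Params (n : ℕ) : Type :=
  (Fin 4 → ℝ) × (Fin 3 → ℝ) × (Fin 3 → ℝ) × ((j : Fin n) → lagPoly (j + 3)) ×
    ((j : Fin n) → retPoly (j + 3))

/-- The symplectic germ with given parameters. -/
noncomputable def germOf {n : ℕ} (t : Params n) : Phase → Phase :=
  affMap t.1 t.2.1 ∘ gen (polySum lagPoly n t.2.2.2.1) ∘ quadMap t.2.2.1 ∘
    gen (polySum retPoly n t.2.2.2.2)

/-- The parameters of jets of caustic-equivalent germs. -/
def paramSet (n : ℕ) : Set (Params n) :=
  {t | detMap t.1 ≠ 0 ∧ 0 < t.2.2.1 0 * t.2.2.1 1 ∧ 0 < t.2.2.1 0 * t.2.2.1 2 - t.2.2.1 1 ^ 2}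

theorem isSympGerm_germOf {n : ℕ} {t : Params n} (ht : detMap t.1 ≠ 0) : IsSympGerm (germOf t) :=
  (isSympLin_affMap ht _).isSympGerm.comp ((isAdm_polySum lagPoly_le _).isSympGerm_gen.comp
    ((isSympLin_quadMap _).isSympGerm.comp (isAdm_polySum retPoly_le _).isSympGerm_gen))

theorem jet_congr {l : ℕ} {S T : Phase → Phase} (h : S =ᶠ[𝓝 0] T) : jet l S = jet l T := by
  funext k
  exact (h.iteratedFDeriv ℝ k).self_of_nhds

theorem jet_eq_iff {l : ℕ} {S T : Phase → Phase} (hS : ContDiffAt ℝ ∞ S 0)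
    (hT : ContDiffAt ℝ ∞ T 0) :
    jet l S = jet l T ↔ (fun z => S z - T z) =o[𝓝 0] fun z => ‖z‖ ^ l := by
  rw [isLittleO_iff_iteratedFDeriv (hS.sub hT)]
  have h : ∀ j : ℕ, iteratedFDeriv ℝ j (fun z => S z - T z) 0 =
      iteratedFDeriv ℝ j S 0 - iteratedFDeriv ℝ j T 0 := fun j =>
    iteratedFDeriv_sub_apply (hS.of_le (by exact_mod_cast le_top)) (hT.of_le (by exact_mod_cast le_top))
  simp only [h, sub_eq_zero]
  exact ⟨fun h j hj => congrFun h ⟨j, by omega⟩, fun h => funext fun k => h k (by omega)⟩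

theorem contDiffAt_jet {V : Type*} [NormedAddCommGroup V] [NormedSpace ℝ V] {l : ℕ}
    {H : Phase × V → Phase} {s₀ : V} (hH : ContDiffAt ℝ ∞ H (0, s₀)) :
    ContDiffAt ℝ ∞ (fun s => jet l fun z => H (z, s)) s₀ := by
  refine contDiffAt_pi.2 fun k => ?_
  have hev : ∀ᶠ s in 𝓝 s₀, ContDiffAt ℝ ((k : ℕ) : WithTop ℕ∞) H (0, s) := by
    have h1 := (hH.of_le (m := ((k : ℕ) : WithTop ℕ∞)) (by exact_mod_cast le_top)).eventually
      (by simp)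
    have h2 : Tendsto (fun s : V => ((0 : Phase), s)) (𝓝 s₀) (𝓝 (0, s₀)) :=
      Continuous.tendsto (by fun_prop) _
    exact h2.eventually h1
  have heq : (fun s => iteratedFDeriv ℝ (k : ℕ) (fun z => H (z, s)) 0) =ᶠ[𝓝 s₀] fun s =>
      (iteratedFDeriv ℝ (k : ℕ) H (0, s)).compContinuousLinearMap
        fun _ => ContinuousLinearMap.inl ℝ Phase V := by
    filter_upwards [hev] with s hs
    obtain ⟨u, hu, hHu⟩ := hs.contDiffOn (m := ((k : ℕ) : WithTop ℕ∞)) le_rfl (by simp)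
    obtain ⟨v, hvu, hv, hmem⟩ := mem_nhds_iff.1 hu
    have h1 : (fun z => H (z, s)) =
        (fun p => H (p + (0, s))) ∘ ContinuousLinearMap.inl ℝ Phase V := by
      funext z; simp
    have hv' : IsOpen ((fun p : Phase × V => p + (0, s)) ⁻¹' v) :=
      hv.preimage (by fun_prop)
    have hmem' : (ContinuousLinearMap.inl ℝ Phase V) 0 ∈ (fun p : Phase × V => p + (0, s)) ⁻¹' v := by
      simpa using hmem
    have hv'' : IsOpen (ContinuousLinearMap.inl ℝ Phase V ⁻¹'
        ((fun p : Phase × V => p + (0, s)) ⁻¹' v)) :=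
      hv'.preimage (ContinuousLinearMap.inl ℝ Phase V).continuous
    have h3 : ContDiffOn ℝ ((k : ℕ) : WithTop ℕ∞) (fun p : Phase × V => H (p + (0, s)))
        ((fun p : Phase × V => p + (0, s)) ⁻¹' v) :=
      (hHu.mono hvu).comp (contDiff_id.add contDiff_const).contDiffOn fun p hp => hp
    have h4 := (ContinuousLinearMap.inl ℝ Phase V).iteratedFDerivWithin_comp_right h3
      hv'.uniqueDiffOn hv''.uniqueDiffOn hmem' (i := k) le_rfl
    rw [iteratedFDerivWithin_of_isOpen _ hv'' hmem',
      iteratedFDerivWithin_of_isOpen _ hv' hmem', iteratedFDeriv_comp_add_right] at h4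
    rw [h1, h4]
    simp
  refine ContDiffAt.congr_of_eventuallyEq ?_ heq
  have h5 : ContDiffAt ℝ ∞ (fun s => iteratedFDeriv ℝ (k : ℕ) H (0, s)) s₀ :=
    (hH.iteratedFDeriv_right (m := ∞) (i := k) (by exact_mod_cast le_top)).comp s₀
      (contDiffAt_const.prodMk contDiffAt_id)
  exact (ContinuousMultilinearMap.compContinuousLinearMapL
    (fun _ : Fin k => ContinuousLinearMap.inl ℝ Phase V)).contDiff.contDiffAt.comp s₀ h5

theorem contDiffAt_jet_germOf {V : Type*} [NormedAddCommGroup V] [NormedSpace ℝ V]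
    [FiniteDimensional ℝ V] {n l : ℕ} (g : V →ₗ[ℝ] Fin 4 → ℝ) (w M : V →ₗ[ℝ] Fin 3 → ℝ)
    (h : V →ₗ[ℝ] (j : Fin n) → lagPoly (j + 3)) (K : V →ₗ[ℝ] (j : Fin n) → retPoly (j + 3))
    {s₀ : V} (hs₀ : detMap (g s₀) ≠ 0) :
    ContDiffAt ℝ ∞ (fun s => jet l (germOf (n := n) (g s, w s, M s, h s, K s))) s₀ := by
  have hg : ContDiff ℝ ∞ g := (LinearMap.toContinuousLinearMap g).contDiff
  have hw : ContDiff ℝ ∞ w := (LinearMap.toContinuousLinearMap w).contDiff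
  have hM : ContDiff ℝ ∞ M := (LinearMap.toContinuousLinearMap M).contDiff
  obtain ⟨G₁, hG₁, hG₁'⟩ := exists_joint_gen (polySum lagPoly n ∘ₗ h)
    (fun s => isAdm_polySum lagPoly_le (h s)) s₀
  obtain ⟨G₂, hG₂, hG₂'⟩ := exists_joint_gen (polySum retPoly n ∘ₗ K)
    (fun s => isAdm_polySum retPoly_le (K s)) s₀
  have e₁ : ∀ᶠ s in 𝓝 s₀, (fun z => G₁ (z, s)) =ᶠ[𝓝 0] gen (polySum lagPoly n (h s)) :=
    hG₁'.mono fun s hs => hs.unique (isAdm_polySum lagPoly_le _) (isGen_gen (isAdm_polySum lagPoly_le _))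
  have e₂ : ∀ᶠ s in 𝓝 s₀, (fun z => G₂ (z, s)) =ᶠ[𝓝 0] gen (polySum retPoly n (K s)) :=
    hG₂'.mono fun s hs => hs.unique (isAdm_polySum retPoly_le _) (isGen_gen (isAdm_polySum retPoly_le _))
  have z₂ : G₂ (0, s₀) = 0 :=
    e₂.self_of_nhds.self_of_nhds.trans (isAdm_polySum retPoly_le _).gen_zero
  set H : Phase × V → Phase := fun p => affMap (g p.2) (w p.2)
    (G₁ (quadMap (M p.2) (G₂ p), p.2)) with hHdef
  have hH : ContDiffAt ℝ ∞ H (0, s₀) := by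
    have h1 : ContDiffAt ℝ ∞ (fun p : Phase × V => quadMap (M p.2) (G₂ p)) (0, s₀) :=
      contDiff_quadMap.contDiffAt.comp ((0 : Phase), s₀)
        ((hM.comp contDiff_snd).contDiffAt.prodMk hG₂.self_of_nhds)
    have h2 : ContDiffAt ℝ ∞ (fun p : Phase × V => G₁ (quadMap (M p.2) (G₂ p), p.2))
        (0, s₀) := by
      refine ContDiffAt.comp (g := G₁) ((0 : Phase), s₀) ?_ (h1.prodMk contDiffAt_snd)
      simp only [z₂, map_zero]
      exact hG₁.self_of_nhds
    exact ContDiffAt.comp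
      (g := fun p : ((Fin 4 → ℝ) × (Fin 3 → ℝ)) × Phase => affMap p.1.1 p.1.2 p.2)
      ((0 : Phase), s₀) (contDiffAt_affMap hs₀ _ _)
      (((hg.comp contDiff_snd).contDiffAt.prodMk (hw.comp contDiff_snd).contDiffAt).prodMk h2)
  refine (contDiffAt_jet (l := l) hH).congr_of_eventuallyEq ?_
  filter_upwards [e₁, e₂] with s h1 h2
  refine jet_congr ?_
  have ht : Tendsto (fun z => quadMap (M s) (gen (polySum retPoly n (K s)) z))
      (𝓝 0) (𝓝 0) :=
    ((isSympLin_quadMap (M s)).isSympGerm.comp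
      (isAdm_polySum retPoly_le (K s)).isSympGerm_gen).tendsto
  filter_upwards [ht.eventually h1, h2] with z hz hz'
  simp only [hHdef, germOf, Function.comp, hz', hz]

/-! ### Separation of parameters by jets -/

theorem lagPoly_retPoly_transverse {M : Fin 3 → ℝ} (h0 : M 0 ≠ 0) (h2 : M 2 ≠ 0) {k : ℕ}
    {H K : Phase → ℝ} (hH : H ∈ lagPoly (k + 1)) (hK : K ∈ retPoly (k + 1))
    (h : ∀ z, hamVF H (quadMap M z) + quadMap M (hamVF K z) = 0) : H = 0 ∧ K = 0 := by
  have hHd := hH.1.1.differentiable (by simp)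
  have hKd := hK.1.1.differentiable (by simp)
  have hF : ∀ z, H (quadMap M z) + K z = 0 := by
    have hder : ∀ z, HasFDerivAt (fun z => H (quadMap M z) + K z) (0 : Phase →L[ℝ] ℝ) z := by
      intro z
      refine (((hHd (quadMap M z)).hasFDerivAt.comp z (quadMap M).hasFDerivAt).add
        (hKd z).hasFDerivAt).congr_fderiv (ContinuousLinearMap.ext fun v => ?_)
      simp only [add_apply, ContinuousLinearMap.comp_apply,
        zero_apply]
      rw [← omega_hamVF, ← omega_hamVF, ← isSympLin_quadMap M (hamVF K z) v,
        ← omegaL_apply, ← omegaL_apply, ← add_apply, ← map_add, h z]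
      simp
    intro z
    rw [is_const_of_fderiv_eq_zero (fun z => (hder z).differentiableAt)
      (fun z => (hder z).fderiv) z 0, map_zero, hH.1.2.apply_zero, hK.1.2.apply_zero, add_zero]
  have hH0 : ∀ {σ : Set (Fin 2)} {z : Phase}, z ∈ cornerPlane σ → H (quadMap M z) = 0 :=
    fun {σ z} hz => by have := hF z; rwa [hK.2 σ z hz, add_zero] at this
  have c : ∀ q : Plane, H (q, 0) = 0 := by
    intro q
    have := hH0 (σ := Set.univ) (z := (0, -q)) ⟨by simp, by simp⟩
    convert this using 1
    congr 1
    ext i <;> fin_cases i <;> simp [quadMap_apply]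
  have haff : ∀ q P : Plane, H (q, P) = P 0 * H (q, Pi.single 0 1) + P 1 * H (q, Pi.single 1 1) :=
    fun q P => by rw [hH.2 q P, c]; simp [Fin.sum_univ_two]
  have dens : ∀ (i : Fin 2), (∀ q : Plane, q i ≠ 0 → H (q, Pi.single i 1) = 0) →
      ∀ q, H (q, Pi.single i 1) = 0 := by
    intro i hi q
    have hc : Continuous fun s : ℝ => H (Function.update q i s, Pi.single i 1) :=
      hH.1.1.continuous.comp (by fun_prop)
    have := Continuous.ext_on (dense_compl_singleton (0 : ℝ)) hc continuous_const
      (fun s hs => hi (Function.update q i s) (by simpa using hs))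
    simpa using congrFun this (q i)
  have c0 : ∀ q, H (q, Pi.single 0 1) = 0 := by
    refine dens 0 fun q hq => ?_
    have := hH0 (σ := {1}) (z := (![-q 0 / M 0, 0], ![0, -q 1 + M 1 * q 0 / M 0]))
      ⟨by simp, fun i hi => by fin_cases i <;> simp at hi ⊢⟩
    rw [show quadMap M (![-q 0 / M 0, 0], ![0, -q 1 + M 1 * q 0 / M 0]) = (q, ![-q 0 / M 0, 0]) by
      ext i <;> fin_cases i <;> simp [quadMap_apply] <;> field_simp; ring, haff] at this
    simpa [hq, h0] using this
  have c1 : ∀ q, H (q, Pi.single 1 1) = 0 := by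
    refine dens 1 fun q hq => ?_
    have := hH0 (σ := {0}) (z := (![0, -q 1 / M 2], ![-q 0 + M 1 * q 1 / M 2, 0]))
      ⟨by simp, fun i hi => by fin_cases i <;> simp at hi ⊢⟩
    rw [show quadMap M (![0, -q 1 / M 2], ![-q 0 + M 1 * q 1 / M 2, 0]) = (q, ![0, -q 1 / M 2]) by
      ext i <;> fin_cases i <;> simp [quadMap_apply] <;> field_simp; ring, haff] at this
    simpa [hq, h2] using this
  have hHz : H = 0 := by
    funext ⟨q, P⟩
    rw [haff, c0, c1]; simp
  refine ⟨hHz, funext fun z => ?_⟩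
  have := hF z
  rw [hHz] at this
  simpa using this

theorem iteratedFDeriv_diag_of_isLittleO {f g V : Phase → Phase} (hf : ContDiffAt ℝ ∞ f 0)
    (hg : ContDiffAt ℝ ∞ g 0) {k : ℕ} (hV : ContDiff ℝ ∞ V) (hom : PosHom k V)
    (h : (fun z => f z - g z - V z) =o[𝓝 0] fun z => ‖z‖ ^ k) (z : Phase) :
    iteratedFDeriv ℝ k f 0 (fun _ => z) =
      iteratedFDeriv ℝ k g 0 (fun _ => z) + (k.factorial : ℝ) • V z := by
  have le : ((k : ℕ) : WithTop ℕ∞) ≤ ∞ := by exact_mod_cast le_top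
  have h1 := (isLittleO_iff_iteratedFDeriv ((hf.sub hg).sub hV.contDiffAt) k).1 h k le_rfl
  rw [fun_iteratedFDeriv_sub_apply ((hf.sub hg).of_le le) (hV.contDiffAt.of_le le),
    fun_iteratedFDeriv_sub_apply (hf.of_le le) (hg.of_le le)] at h1
  rw [hom.eq_diag hV.contDiffAt z, sub_eq_zero.1 ((sub_sub _ _ _).symm.trans h1)]
  simp only [add_apply]
  rw [smul_smul, mul_inv_cancel₀ (by positivity), one_smul]

theorem IsAdm.gen_sub_id {K : Phase → ℝ} (hK : IsAdm K) :
    (fun z => gen K z - z) =o[𝓝 0] fun z => ‖z‖ :=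
  HasStrictFDerivAt.sub_id_isLittleO hK.hasStrictFDerivAt_gen hK.gen_zero

/-- First variation of `A ∘ gen h ∘ S ∘ gen K`. -/
theorem comp_gen_sub_comp_gen {h h' K K' : Phase → ℝ} (hh : IsAdm h) (hh' : IsAdm h')
    (hK : IsAdm K) (hK' : IsAdm K') {k : ℕ} {δh δK : Phase → ℝ} (dh : δh ∈ homPoly (k + 1))
    (dK : δK ∈ homPoly (k + 1))
    (eh : (fun z => h' z - h z - δh z) =o[𝓝 0] fun z => ‖z‖ ^ (k + 1))
    (eK : (fun z => K' z - K z - δK z) =o[𝓝 0] fun z => ‖z‖ ^ (k + 1))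
    (A S : Phase →L[ℝ] Phase) :
    (fun z => A (gen h' (S (gen K' z))) - A (gen h (S (gen K z))) -
      A (hamVF δh (S z) + S (hamVF δK z))) =o[𝓝 0] fun z => ‖z‖ ^ k := by
  have h1 := gen_sub_gen hh hh' dh.1 dh.2 eh
  have h2 := gen_sub_gen hK hK' dK.1 dK.2 eK
  have t1 : Tendsto (fun z => S (gen K z)) (𝓝 0) (𝓝 0) := by
    have := (S.continuous.tendsto 0).comp hK.isSympGerm_gen.tendsto
    rwa [map_zero] at this
  have t2 : Tendsto (fun z => S (gen K' z)) (𝓝 0) (𝓝 0) := by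
    have := (S.continuous.tendsto 0).comp hK'.isSympGerm_gen.tendsto
    rwa [map_zero] at this
  have O2 : (fun z => S (gen K' z)) =O[𝓝 0] fun z => ‖z‖ := by
    refine (S.isBigO_comp (gen K') _).trans ?_
    refine (hK'.gen_sub_id.isBigO.add (isBigO_refl (fun z : Phase => z) (𝓝 0)).norm_right).congr_left
      fun z => by simp
  have a1 : (fun z => gen h' (S (gen K' z)) - gen h (S (gen K' z)) - hamVF δh (S (gen K' z)))
      =o[𝓝 0] fun z => ‖z‖ ^ k := by
    refine (h1.comp_tendsto t2).trans_isBigO ?_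
    exact O2.norm_left.pow k
  have a2 : (fun z => hamVF δh (S (gen K' z)) - hamVF δh (S z)) =o[𝓝 0] fun z => ‖z‖ ^ k :=
    ((dh.2.hamVF dh.1).comp_linear S).comp_sub_isLittleO
      ((contDiff_hamVF dh.1).comp S.contDiff).contDiffAt hK'.gen_sub_id
  have a3 : (fun z => S (gen K' z) - S (gen K z) - S (hamVF δK z)) =o[𝓝 0] fun z => ‖z‖ ^ k := by
    refine ((S.isBigO_comp _ _).trans_isLittleO h2).congr_left fun z => by simp
  have a4 : (fun z => S (gen K' z) - S (gen K z)) =O[𝓝 0] fun z => ‖z‖ ^ k := by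
    have := (S.isBigO_comp (hamVF δK) (𝓝 0)).trans
      ((dK.2.hamVF dK.1).isBigO (contDiff_hamVF dK.1).continuous.continuousAt)
    exact (a3.isBigO.add this).congr_left fun z => by abel
  have a5 : (fun z => gen h (S (gen K' z)) - gen h (S (gen K z)) - (S (gen K' z) - S (gen K z)))
      =o[𝓝 0] fun z => ‖z‖ ^ k :=
    ((hh.hasStrictFDerivAt_gen.isLittleO.comp_tendsto (t2.prodMk_nhds t1)).congr_left
      fun z => by simp).trans_isBigO a4
  have := (A.isBigO_comp _ _).trans_isLittleO (((a1.add a2).add a3).add a5)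
  refine this.congr_left fun z => ?_
  simp only [map_add, map_sub]
  abel

/-- Every affine component of the jets of the curve `s ↦ t + s τ` is constant. -/
def JetStationary {n : ℕ} (t τ : Params n) : Prop :=
  ∀ (L : JetSpace (n + 1) →L[ℝ] Phase) (b : Phase),
    (∀ s : ℝ, L (jet (n + 1) (germOf (t + s • τ))) = L (jet (n + 1) (germOf t)) + s • b) → b = 0

theorem smooth_germOf {n : ℕ} (t : Params n) : ContDiffAt ℝ ∞ (germOf t) 0 :=
  (affMap t.1 t.2.1).contDiff.contDiffAt.comp (0 : Phase)
    ((isAdm_polySum lagPoly_le t.2.2.2.1).isSympGerm_gen.comp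
    ((isSympLin_quadMap _).isSympGerm.comp
      (isAdm_polySum retPoly_le t.2.2.2.2).isSympGerm_gen)).1.2.self_of_nhds

theorem hasFDerivAt_germOf {n : ℕ} (t : Params n) :
    HasFDerivAt (germOf t) ((affMap t.1 t.2.1).comp (quadMap t.2.2.1)) 0 := by
  have hh := isAdm_polySum lagPoly_le t.2.2.2.1
  have hK := isAdm_polySum retPoly_le t.2.2.2.2
  have h1 : HasFDerivAt (fun z => quadMap t.2.2.1 (gen (polySum retPoly n t.2.2.2.2) z))
      (quadMap t.2.2.1) 0 := by
    have := (quadMap t.2.2.1).hasFDerivAt.comp (0 : Phase) hK.hasStrictFDerivAt_gen.hasFDerivAt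
    rwa [ContinuousLinearMap.comp_id] at this
  have h2 : HasFDerivAt (gen (polySum lagPoly n t.2.2.2.1)) (ContinuousLinearMap.id ℝ Phase)
      (quadMap t.2.2.1 (gen (polySum retPoly n t.2.2.2.2) 0)) := by
    rw [hK.gen_zero, map_zero]
    exact hh.hasStrictFDerivAt_gen.hasFDerivAt
  have := (affMap t.1 t.2.1).hasFDerivAt.comp (0 : Phase) (h2.comp (0 : Phase) h1)
  rwa [ContinuousLinearMap.id_comp] at this

theorem JetStationary.linear {n : ℕ} {t τ : Params n} (H : JetStationary t τ)
    (B : Phase →L[ℝ] Phase) (v b : Phase)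
    (h : ∀ s : ℝ, B (affMap (t.1 + s • τ.1) (t.2.1 + s • τ.2.1)
      (quadMap (t.2.2.1 + s • τ.2.2.1) v)) = B (affMap t.1 t.2.1 (quadMap t.2.2.1 v)) + s • b) :
    b = 0 := by
  have hj : ∀ t : Params n, jet (n + 1) (germOf t) ⟨1, by omega⟩ (fun _ => v) =
      affMap t.1 t.2.1 (quadMap t.2.2.1 v) := by
    intro t
    change iteratedFDeriv ℝ 1 (germOf t) 0 (fun _ => v) = _
    rw [iteratedFDeriv_one_apply, (hasFDerivAt_germOf t).fderiv]; rfl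
  refine H (B.comp ((ContinuousMultilinearMap.apply ℝ (fun _ : Fin 1 => Phase) Phase
    (fun _ => v)).comp (ContinuousLinearMap.proj (R := ℝ)
      (φ := fun k : Fin (n + 1 + 1) => ContinuousMultilinearMap ℝ (fun _ : Fin (k : ℕ) => Phase) Phase)
      ⟨1, by omega⟩))) b fun s => ?_
  have e1 := hj (t + s • τ)
  have e2 := hj t
  simp only [ContinuousLinearMap.comp_apply, ContinuousLinearMap.proj_apply,
    ContinuousMultilinearMap.apply_apply]
  rw [e1, e2]
  exact h s

theorem JetStationary.fst_eq_zero {n : ℕ} {t τ : Params n} (H : JetStationary t τ) : τ.1 = 0 := by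
  have h1 := H.linear ((ContinuousLinearMap.inl ℝ Plane Plane).comp
    (ContinuousLinearMap.fst ℝ Plane Plane)) (0, Pi.single 0 1) (![-τ.1 0, -τ.1 2], 0) fun s => by
      ext i <;> fin_cases i <;> simp [affMap_apply, quadMap_apply] <;> ring
  have h2 := H.linear ((ContinuousLinearMap.inl ℝ Plane Plane).comp
    (ContinuousLinearMap.fst ℝ Plane Plane)) (0, Pi.single 1 1) (![-τ.1 1, -τ.1 3], 0) fun s => by
      ext i <;> fin_cases i <;> simp [affMap_apply, quadMap_apply] <;> ring
  simp [Prod.ext_iff] at h1 h2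
  ext i; fin_cases i <;> simp [h1, h2]

theorem affMap_injective {g : Fin 4 → ℝ} (hg : detMap g ≠ 0) {w : Fin 3 → ℝ} {z : Phase}
    (h : affMap g w z = 0) : z = 0 := (isSympLin_affMap hg w).injective (h.trans (map_zero _).symm)

theorem JetStationary.matrix_eq_zero {n : ℕ} {t τ : Params n} (ht : detMap t.1 ≠ 0)
    (H : JetStationary t τ) : τ.2.2.1 = 0 := by
  have hg := H.fst_eq_zero
  have key : ∀ v : Plane, (![τ.2.2.1 0 * v 0 + τ.2.2.1 1 * v 1,
      τ.2.2.1 1 * v 0 + τ.2.2.1 2 * v 1] : Plane) = 0 := by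
    intro v
    set y : Plane := ![τ.2.2.1 0 * v 0 + τ.2.2.1 1 * v 1,
      τ.2.2.1 1 * v 0 + τ.2.2.1 2 * v 1] with hy
    have h1 := H.linear ((ContinuousLinearMap.inl ℝ Plane Plane).comp
      (ContinuousLinearMap.fst ℝ Plane Plane)) (v, 0) ((affMap t.1 0 (-y, 0)).1, 0) fun s => by
        rw [hg]
        ext i <;> fin_cases i <;> simp [affMap_apply, quadMap_apply, hy] <;> ring
    have h2 : affMap t.1 0 (-y, 0) = 0 := by
      refine Prod.ext (Prod.mk.inj h1).1 ?_
      ext i; fin_cases i <;> simp [affMap_apply]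
    exact neg_eq_zero.1 (congrArg Prod.fst (affMap_injective ht h2))
  have k0 := key (Pi.single 0 1)
  have k1 := key (Pi.single 1 1)
  have e0 := congrFun k0 0
  have e1 := congrFun k1 0
  have e2 := congrFun k1 1
  simp at e0 e1 e2
  ext i; fin_cases i <;> simp [e0, e1, e2]

theorem JetStationary.snd_eq_zero {n : ℕ} {t τ : Params n} (ht : detMap t.1 ≠ 0)
    (H : JetStationary t τ) : τ.2.1 = 0 := by
  have hg := H.fst_eq_zero
  have hM := H.matrix_eq_zero ht
  have key : ∀ v : Plane, (![τ.2.1 0 * v 0 + τ.2.1 1 * v 1,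
      τ.2.1 1 * v 0 + τ.2.1 2 * v 1] : Plane) = 0 := by
    intro v
    set y : Plane := ![τ.2.1 0 * v 0 + τ.2.1 1 * v 1,
      τ.2.1 1 * v 0 + τ.2.1 2 * v 1] with hy
    have h1 := H.linear (ContinuousLinearMap.id ℝ Phase) (0, -v) (affMap t.1 0 (0, y)) fun s => by
        rw [hg, hM]
        ext i <;> fin_cases i <;> simp [affMap_apply, quadMap_apply, hy] <;> ring
    exact congrArg Prod.snd (affMap_injective ht h1)
  have k0 := key (Pi.single 0 1)
  have k1 := key (Pi.single 1 1)
  have e0 := congrFun k0 0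
  have e1 := congrFun k1 0
  have e2 := congrFun k1 1
  simp at e0 e1 e2
  ext i; fin_cases i <;> simp [e0, e1, e2]

theorem polySum_add_smul_sub {V : ℕ → Submodule ℝ (Phase → ℝ)} (hV : ∀ k, V k ≤ homPoly k) {n : ℕ}
    (c d : (j : Fin n) → V (j + 3)) (j : Fin n) (hd : ∀ i < j, d i = 0) (s : ℝ) :
    (fun z => polySum V n (c + s • d) z - polySum V n c z - (s • (d j : Phase → ℝ)) z)
      =o[𝓝 0] fun z => ‖z‖ ^ ((j : ℕ) + 3) := by
  have he : ∀ z, polySum V n (c + s • d) z - polySum V n c z - (s • (d j : Phase → ℝ)) z =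
      ∑ i ∈ Finset.univ.erase j, s • (d i : Phase → ℝ) z := by
    intro z
    rw [map_add, map_smul, Pi.add_apply, add_sub_cancel_left, Pi.smul_apply, Pi.smul_apply,
      polySum_apply, ← Finset.smul_sum, ← smul_sub, ← Finset.add_sum_erase _ _ (Finset.mem_univ j),
      add_sub_cancel_left]
  simp only [he]
  refine IsLittleO.fun_sum fun i hi => ?_
  rcases lt_or_gt_of_ne (Finset.ne_of_mem_erase hi) with h | h
  · rw [hd i h]
    simp only [ZeroMemClass.coe_zero, Pi.zero_apply, smul_zero]
    exact isLittleO_zero _ _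
  · exact (isLittleO_of_mem_homPoly (hV _ (d i).2) (by simpa using h)).const_smul_left s

theorem hamVF_smul {K : Phase → ℝ} (hK : Differentiable ℝ K) (s : ℝ) (z : Phase) :
    hamVF (s • K) z = s • hamVF K z := by
  rw [hamVF_eq, hamVF_eq, ← map_smul]
  congr 1
  exact fderiv_const_smul (hK z) s

theorem JetStationary.hamiltonians_eq_zero {n : ℕ} {t τ : Params n} (ht : t ∈ paramSet n)
    (H : JetStationary t τ) (j : Fin n) : τ.2.2.2.1 j = 0 ∧ τ.2.2.2.2 j = 0 := by
  induction j using WellFoundedLT.induction with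
  | _ j ih =>
  have hg := H.fst_eq_zero
  have hw := H.snd_eq_zero ht.1
  have hM := H.matrix_eq_zero ht.1
  obtain ⟨hdet, h01, hpos⟩ := ht
  have hM0 : t.2.2.1 0 ≠ 0 := fun h => by simp [h] at h01
  have hM2 : t.2.2.1 2 ≠ 0 := fun h => by
    rw [h, mul_zero, zero_sub] at hpos
    exact absurd hpos (not_lt.2 (neg_nonpos.2 (sq_nonneg _)))
  set A := affMap t.1 t.2.1 with hA
  set S := quadMap t.2.2.1 with hS
  set δh := τ.2.2.2.1 j with hδh
  set δK := τ.2.2.2.2 j with hδK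
  have dh := lagPoly_le _ δh.2
  have dK := retPoly_le _ δK.2
  set V : Phase → Phase := fun z => A (hamVF δh (S z) + S (hamVF δK z)) with hV
  have hVs : ContDiff ℝ ∞ V := A.contDiff.comp
    (((contDiff_hamVF dh.1).comp S.contDiff).add (S.contDiff.comp (contDiff_hamVF dK.1)))
  have hVh : PosHom ((j : ℕ) + 2) V := by
    intro s hs z
    have e1 := (dh.2.hamVF dh.1).comp_linear S s hs z
    have e2 := (dK.2.hamVF dK.1).linear_comp S s hs z
    simp only [hV] at e1 e2 ⊢
    rw [e1, e2, ← smul_add, map_smul]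
  have hmain : ∀ s : ℝ, (fun z => germOf (t + s • τ) z - germOf t z - (s • V) z)
      =o[𝓝 0] fun z => ‖z‖ ^ ((j : ℕ) + 2) := by
    intro s
    have := comp_gen_sub_comp_gen (isAdm_polySum lagPoly_le t.2.2.2.1)
      (isAdm_polySum lagPoly_le (t.2.2.2.1 + s • τ.2.2.2.1))
      (isAdm_polySum retPoly_le t.2.2.2.2) (isAdm_polySum retPoly_le (t.2.2.2.2 + s • τ.2.2.2.2))
      (Submodule.smul_mem _ s dh) (Submodule.smul_mem _ s dK)
      (polySum_add_smul_sub lagPoly_le _ _ j (fun i hi => (ih i hi).1) s)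
      (polySum_add_smul_sub retPoly_le _ _ j (fun i hi => (ih i hi).2) s) A S
    refine this.congr_left fun z => ?_
    rw [hamVF_smul (dh.1.differentiable (by simp)), hamVF_smul (dK.1.differentiable (by simp))]
    simp only [germOf, Function.comp, Prod.fst_add, Prod.snd_add, Prod.smul_fst, Prod.smul_snd,
      hg, hw, hM, smul_zero, add_zero, Pi.smul_apply, hV, map_add, map_smul, smul_add, hA, hS]
  have hV0 : ∀ z, V z = 0 := by
    intro z
    have hk : (j : ℕ) + 2 < n + 1 + 1 := by omega
    have h1 := H ((ContinuousMultilinearMap.apply ℝ (fun _ : Fin ((j : ℕ) + 2) => Phase) Phase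
      (fun _ => z)).comp (ContinuousLinearMap.proj (R := ℝ)
      (φ := fun k : Fin (n + 1 + 1) => ContinuousMultilinearMap ℝ (fun _ : Fin (k : ℕ) => Phase) Phase)
      ⟨(j : ℕ) + 2, hk⟩)) ((((j : ℕ) + 2).factorial : ℝ) • V z) fun s => by
        have := iteratedFDeriv_diag_of_isLittleO (smooth_germOf (t + s • τ)) (smooth_germOf t)
          (V := s • V) (contDiff_const.smul hVs) (fun r hr z => by
            simp only [Pi.smul_apply, hVh r hr z]; rw [smul_comm]) (hmain s) z
        rw [Pi.smul_apply, smul_comm] at this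
        exact this
    exact (smul_eq_zero.1 h1).resolve_left (by positivity)
  have := lagPoly_retPoly_transverse hM0 hM2 δh.2 δK.2 fun z => affMap_injective hdet (hV0 z)
  exact ⟨Subtype.ext this.1, Subtype.ext this.2⟩

theorem JetStationary.eq_zero {n : ℕ} {t τ : Params n} (ht : t ∈ paramSet n)
    (H : JetStationary t τ) : τ = 0 :=
  Prod.ext H.fst_eq_zero (Prod.ext (H.snd_eq_zero ht.1) (Prod.ext (H.matrix_eq_zero ht.1)
    (Prod.ext (funext fun j => (H.hamiltonians_eq_zero ht j).1)
      (funext fun j => (H.hamiltonians_eq_zero ht j).2))))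

/-! ### Normal form of caustic-equivalent germs -/

/-- `D M D` for a diagonal matrix `D` and a symmetric matrix `M`. -/
def conjDiag (D : Fin 2 → ℝ) (M : Fin 3 → ℝ) : Fin 3 → ℝ :=
  ![D 0 ^ 2 * M 0, D 0 * D 1 * M 1, D 1 ^ 2 * M 2]

theorem diagMap_inv_apply {D : Fin 2 → ℝ} (hD : ∀ i, D i ≠ 0) (z : Phase) :
    diagMap D⁻¹ (diagMap D z) = z := by
  ext i <;> simp [diagMap_apply, hD]

theorem diagMap_apply_inv {D : Fin 2 → ℝ} (hD : ∀ i, D i ≠ 0) (z : Phase) :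
    diagMap D (diagMap D⁻¹ z) = z := by
  ext i <;> simp [diagMap_apply, hD]

theorem diagMap_quadMap_diagMap {D : Fin 2 → ℝ} (hD : ∀ i, D i ≠ 0) (M : Fin 3 → ℝ) (z : Phase) :
    diagMap D (quadMap M (diagMap D z)) = quadMap (conjDiag D M) z := by
  have h0 := hD 0
  have h1 := hD 1
  ext i <;> fin_cases i <;> simp [diagMap_apply, quadMap_apply, conjDiag, h0, h1] <;>
    field_simp

/-- The symplectic germs of the form `Θ ∘ S_M ∘ φ` have the jets of the parametrized ones. -/
theorem exists_params_of_comp {Θ φ S' : Phase → Phase} {M : Fin 3 → ℝ}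
    (hΘ : IsLagrangianEquivalence Θ) (hφ : IsReticular φ) (hM : 0 < M 0 * M 1)
    (hM' : 0 < M 0 * M 2 - M 1 ^ 2) (h : S' =ᶠ[𝓝 0] Θ ∘ quadMap M ∘ φ) (n : ℕ) :
    ∃ t ∈ paramSet n, jet (n + 1) S' = jet (n + 1) (germOf t) := by
  obtain ⟨D, hD, hφD⟩ := exists_eq_diagMap hφ.1.isSympLin_fderiv fun _ _ => hφ.fderiv_mem_cornerL
  have hD' : ∀ i, D i ≠ 0 := fun i => (hD i).ne'
  have hDi : ∀ i, 0 < D⁻¹ i := fun i => inv_pos.2 (hD i)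
  have hret : IsReticular (diagMap D⁻¹ ∘ φ) := (isReticular_diagMap hDi).comp hφ
  have hret' : fderiv ℝ (diagMap D⁻¹ ∘ φ) 0 = ContinuousLinearMap.id ℝ Phase := by
    rw [((diagMap D⁻¹).hasFDerivAt.comp (0 : Phase) hφ.1.hasFDerivAt).fderiv, hφD]
    exact ContinuousLinearMap.ext fun z => diagMap_inv_apply hD' z
  obtain ⟨K, hK⟩ := exists_gen_approx_of_reticular hret.1 hret' (fun σ => hret.eventually_mem σ) n
  have hlag : IsLagrangianEquivalence (Θ ∘ diagMap D⁻¹) :=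
    hΘ.comp ((isSympLin_diagMap fun i => (hDi i).ne').isLagrangianEquivalence fun p => by
      ext i; simp [diagMap_apply])
  obtain ⟨g, w, hg, hgw⟩ := exists_eq_affMap hlag.1.isSympLin_fderiv hlag.fderiv_fst
  obtain ⟨e, he⟩ := (isSympLin_affMap hg w).exists_equiv
  have he' : ∀ z, affMap g w (e.symm z) = z := fun z => by
    rw [← he]; exact e.apply_symm_apply z
  have hes : IsSympLin (e.symm : Phase →L[ℝ] Phase) := fun u v => by
    rw [← isSympLin_affMap hg w]
    exact congrArg₂ omega (he' u) (he' v)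
  have hefst : ∀ p, (e.symm (0, p)).1 = 0 := by
    intro p
    have h1 : affMap g w (e.symm (0, p)) = (0, p) := he' _
    have h2 := congrArg Prod.fst h1
    have h3 : affMap g 0 ((e.symm (0, p)).1, 0) = 0 := by
      refine Prod.ext h2 ?_
      ext i; fin_cases i <;> simp [affMap_apply]
    exact congrArg Prod.fst (affMap_injective hg h3)
  have hlag2 : IsLagrangianEquivalence ((e.symm : Phase →L[ℝ] Phase) ∘ (Θ ∘ diagMap D⁻¹)) :=
    (hes.isLagrangianEquivalence hefst).comp hlag
  have hlag2' : fderiv ℝ ((e.symm : Phase →L[ℝ] Phase) ∘ (Θ ∘ diagMap D⁻¹)) 0 =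
      ContinuousLinearMap.id ℝ Phase := by
    rw [((e.symm : Phase →L[ℝ] Phase).hasFDerivAt.comp (0 : Phase) hlag.1.hasFDerivAt).fderiv,
      hgw, ← he]
    exact ContinuousLinearMap.ext fun z => e.symm_apply_apply z
  obtain ⟨b, -, hb⟩ := hlag2.2
  obtain ⟨H, hH⟩ := exists_gen_approx_of_lagrangian hlag2.1 hlag2' ⟨b, hb⟩ n
  set Θ' := (e.symm : Phase →L[ℝ] Phase) ∘ (Θ ∘ diagMap D⁻¹) with hΘ'
  set φ' := diagMap D⁻¹ ∘ φ with hφ'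
  set N := conjDiag D M with hN
  refine ⟨(g, w, N, H, K), ⟨hg, ?_, ?_⟩, ?_⟩
  · have : N 0 * N 1 = D 0 ^ 3 * D 1 * (M 0 * M 1) := by simp [hN, conjDiag]; ring
    change 0 < N 0 * N 1
    rw [this]
    have h0 := hD 0
    have h1 := hD 1
    positivity
  · have : N 0 * N 2 - N 1 ^ 2 = (D 0 * D 1) ^ 2 * (M 0 * M 2 - M 1 ^ 2) := by
      simp [hN, conjDiag]; ring
    change 0 < N 0 * N 2 - N 1 ^ 2
    rw [this]
    have h0 := hD 0
    have h1 := hD 1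
    positivity
  · have hA := isAdm_polySum lagPoly_le H
    have hB := isAdm_polySum retPoly_le K
    have hfac : S' =ᶠ[𝓝 0] fun z => affMap g w (Θ' (quadMap N (φ' z))) := by
      filter_upwards [h] with z hz
      rw [hz]
      simp only [hΘ', hφ', Function.comp, hN]
      rw [← diagMap_quadMap_diagMap hD', diagMap_inv_apply hD', diagMap_apply_inv hD']
      exact (he' _).symm
    rw [jet_congr hfac]
    have hcomp : IsSympGerm (affMap g w ∘ Θ' ∘ quadMap N ∘ φ') :=
      (isSympLin_affMap hg w).isSympGerm.comp (hlag2.1.comp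
        ((isSympLin_quadMap N).isSympGerm.comp hret.1))
    refine (jet_eq_iff hcomp.1.2.self_of_nhds (smooth_germOf _)).2 ?_
    have t1 : Tendsto (fun z => quadMap N (φ' z)) (𝓝 0) (𝓝 0) :=
      ((isSympLin_quadMap N).isSympGerm.comp hret.1).tendsto
    have t2 : Tendsto (fun z => quadMap N (gen (polySum retPoly n K) z)) (𝓝 0) (𝓝 0) :=
      ((isSympLin_quadMap N).isSympGerm.comp hB.isSympGerm_gen).tendsto
    have O1 : (fun z => quadMap N (φ' z)) =O[𝓝 0] fun z => ‖z‖ := by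
      have := ((isSympLin_quadMap N).isSympGerm.comp hret.1).hasFDerivAt.isBigO_sub
      simp only [Function.comp, hret.1.1.1, map_zero, sub_zero] at this
      exact this.norm_right
    have a1 : (fun z => Θ' (quadMap N (φ' z)) - gen (polySum lagPoly n H) (quadMap N (φ' z)))
        =o[𝓝 0] fun z => ‖z‖ ^ (n + 1) :=
      (hH.comp_tendsto t1).trans_isBigO (O1.norm_left.pow (n + 1))
    have a2 : (fun z => quadMap N (φ' z) - quadMap N (gen (polySum retPoly n K) z))
        =o[𝓝 0] fun z => ‖z‖ ^ (n + 1) :=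
      (((quadMap N).isBigO_comp _ _).trans_isLittleO hK).congr_left fun z => by simp
    have a3 : (fun z => gen (polySum lagPoly n H) (quadMap N (φ' z)) -
        gen (polySum lagPoly n H) (quadMap N (gen (polySum retPoly n K) z)))
        =o[𝓝 0] fun z => ‖z‖ ^ (n + 1) :=
      (hA.hasStrictFDerivAt_gen.isBigO_sub.comp_tendsto (t1.prodMk_nhds t2)).trans_isLittleO a2
    refine (((affMap g w).isBigO_comp _ _).trans_isLittleO (a1.add a3)).congr_left fun z => ?_
    simp only [germOf, Function.comp, map_add, map_sub]
    abel

theorem isSympLin_smul_id {ε : ℝ} (hε : ε * ε = 1) :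
    IsSympLin (ε • ContinuousLinearMap.id ℝ Phase) := by
  intro u v
  simp [omega_eq]
  linear_combination (u.1 0 * v.2 0 - u.2 0 * v.1 0 + (u.1 1 * v.2 1 - u.2 1 * v.1 1)) * hε

theorem isLagrangianEquivalence_smul_id {ε : ℝ} (hε : ε * ε = 1) :
    IsLagrangianEquivalence (ε • ContinuousLinearMap.id ℝ Phase) :=
  (isSympLin_smul_id hε).isLagrangianEquivalence fun p => by simp

/-- `ε S_{ε M}` for a sign `ε`. -/
noncomputable def signedQuad (ε : ℝ) (M : Fin 3 → ℝ) : Phase →L[ℝ] Phase :=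
  (ε • ContinuousLinearMap.id ℝ Phase).comp (quadMap (ε • M))

theorem isSympLin_signedQuad {ε : ℝ} (hε : ε * ε = 1) (M : Fin 3 → ℝ) :
    IsSympLin (signedQuad ε M) := (isSympLin_smul_id hε).comp (isSympLin_quadMap _)

theorem exists_params_of_mem_lagrangianClass {X S' : Phase → Phase} {ε : ℝ} (hε : ε * ε = 1)
    {M : Fin 3 → ℝ} (hM : 0 < M 0 * M 1) (hM' : 0 < M 0 * M 2 - M 1 ^ 2) (hX : IsSympGerm X)
    (h : ∀ σ, map X (𝓝[cornerL σ] 0) = map (signedQuad ε M) (𝓝[cornerL σ] 0))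
    (hS' : S' ∈ lagrangianClass X) (n : ℕ) :
    ∃ t ∈ paramSet n, jet (n + 1) S' = jet (n + 1) (germOf t) := by
  obtain ⟨hs, Θ, φ, hΘ, hφ, he⟩ := hS'
  obtain ⟨φ₁, hφ₁, hX₁⟩ := exists_reticular_factor hX (isSympLin_signedQuad hε M).isSympGerm h
  obtain ⟨ψ, hψ, h1, h2⟩ := hφ.exists_inverse
  have e1 : (ε • M) 0 * (ε • M) 1 = M 0 * M 1 := by
    simp only [Pi.smul_apply, smul_eq_mul]
    linear_combination M 0 * M 1 * hε
  have e2 : (ε • M) 0 * (ε • M) 2 - (ε • M) 1 ^ 2 = M 0 * M 2 - M 1 ^ 2 := by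
    simp only [Pi.smul_apply, smul_eq_mul]
    linear_combination (M 0 * M 2 - M 1 ^ 2) * hε
  refine exists_params_of_comp (hΘ.comp (isLagrangianEquivalence_smul_id hε)) (hφ₁.comp hψ)
    (M := ε • M) (by rwa [e1]) (by rwa [e2]) ?_ n
  filter_upwards [h2, hψ.1.tendsto.eventually he, hψ.1.tendsto.eventually hX₁] with z h2 h3 h4
  simp only [Function.comp, h2, h4, signedQuad, ContinuousLinearMap.comp_apply] at h3 ⊢
  exact h3.symm

theorem germOf_mem_lagrangianClass {X : Phase → Phase} {ε : ℝ} (hε : ε * ε = 1)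
    {M : Fin 3 → ℝ} {D : Fin 2 → ℝ} (hD : ∀ i, 0 < D i) (hX : IsSympGerm X)
    (h : ∀ σ, map X (𝓝[cornerL σ] 0) = map (signedQuad ε M) (𝓝[cornerL σ] 0))
    {n : ℕ} {t : Params n} (ht : detMap t.1 ≠ 0) (htM : t.2.2.1 = conjDiag D (ε • M)) :
    germOf t ∈ lagrangianClass X := by
  obtain ⟨φ₁, hφ₁, hX₁⟩ := exists_reticular_factor hX (isSympLin_signedQuad hε M).isSympGerm h
  have hD' : ∀ i, D i ≠ 0 := fun i => (hD i).ne'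
  have hA := isAdm_polySum lagPoly_le t.2.2.2.1
  have hret := (isReticular_diagMap hD).comp ((isAdm_polySum retPoly_le t.2.2.2.2).isReticular_gen
    (polySum_eq_zero_of_mem_cornerPlane _))
  obtain ⟨ψ, hψ, h1, h2⟩ := hret.exists_inverse
  refine ⟨isSympGerm_germOf ht, affMap t.1 t.2.1 ∘ gen (polySum lagPoly n t.2.2.2.1) ∘
    diagMap D ∘ (ε • ContinuousLinearMap.id ℝ Phase), ψ ∘ φ₁, ?_, hψ.comp hφ₁, ?_⟩
  · exact ((isSympLin_affMap ht _).isLagrangianEquivalence (affMap_fst_zero _ _)).comp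
      ((hA.isLagrangianEquivalence_gen (affineInP_polySum _)).comp
        (((isSympLin_diagMap hD').isLagrangianEquivalence fun p => by
          ext i; simp [diagMap_apply]).comp (isLagrangianEquivalence_smul_id hε)))
  · filter_upwards [hX₁, hφ₁.1.tendsto.eventually h2] with z h3 h4
    simp only [germOf, Function.comp] at h3 h4 ⊢
    rw [h3, htM, ← diagMap_quadMap_diagMap hD', h4]
    simp only [signedQuad, ContinuousLinearMap.comp_apply, smul_apply,
      Pi.smul_apply, ContinuousLinearMap.id_apply, smul_smul, hε, one_smul]

/-- Positive definite matrices with positive off-diagonal entry. -/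
theorem exists_eq_conjDiag {N : Fin 3 → ℝ} (h0 : 0 < N 0) (h1 : 0 < N 1)
    (h2 : 0 < N 0 * N 2 - N 1 ^ 2) :
    ∃ a : ℝ, 1 / 4 < a ∧ ∃ D : Fin 2 → ℝ, (∀ i, 0 < D i) ∧ N = conjDiag D ![2, 1, 2 * a] := by
  set d := Real.sqrt (N 0 / 2) with hd
  have hd0 : 0 < d := Real.sqrt_pos.2 (by positivity)
  have hdd : d ^ 2 = N 0 / 2 := Real.sq_sqrt (by positivity)
  refine ⟨N 0 * N 2 / (4 * N 1 ^ 2), ?_, ![d, N 1 / d], fun i => ?_, ?_⟩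
  · rw [div_lt_div_iff₀ (by norm_num) (by positivity)]
    linarith
  · fin_cases i
    · exact hd0
    · exact div_pos h1 hd0
  · ext i
    fin_cases i
    · simp [conjDiag, hdd]
    · simp [conjDiag]; field_simp
    · simp [conjDiag]
      rw [div_pow, hdd]
      field_simp
      norm_num

/-! ### Generating families -/

theorem hasFDerivAt_fst_apply (i : Fin 2) (z : Plane × Plane) :
    HasFDerivAt (fun z : Plane × Plane => z.1 i)
      ((ContinuousLinearMap.proj i : Plane →L[ℝ] ℝ).comp
        (ContinuousLinearMap.fst ℝ Plane Plane)) z :=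
  ((ContinuousLinearMap.proj i : Plane →L[ℝ] ℝ).comp
    (ContinuousLinearMap.fst ℝ Plane Plane)).hasFDerivAt

theorem hasFDerivAt_snd_apply (i : Fin 2) (z : Plane × Plane) :
    HasFDerivAt (fun z : Plane × Plane => z.2 i)
      ((ContinuousLinearMap.proj i : Plane →L[ℝ] ℝ).comp
        (ContinuousLinearMap.snd ℝ Plane Plane)) z :=
  ((ContinuousLinearMap.proj i : Plane →L[ℝ] ℝ).comp
    (ContinuousLinearMap.snd ℝ Plane Plane)).hasFDerivAt

theorem fderiv_familyB_apply (a : ℝ) (z v : Plane × Plane) : fderiv ℝ (familyB a) z v =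
    (2 * z.1 0 + z.1 1 + z.2 0) * v.1 0 + (z.1 0 + 2 * a * z.1 1 + z.2 1) * v.1 1 +
      z.1 0 * v.2 0 + z.1 1 * v.2 1 := by
  have x := fun i => hasFDerivAt_fst_apply i z
  have q := fun i => hasFDerivAt_snd_apply i z
  have h : HasFDerivAt (familyB a) _ z :=
    (((((x 0).pow 2).add ((x 0).mul (x 1))).add (((x 1).pow 2).const_mul a)).add
      ((q 0).mul (x 0))).add ((q 1).mul (x 1))
  rw [h.fderiv]
  simp
  ring

theorem dX_familyB_zero (a : ℝ) (z : Plane × Plane) :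
    dX (familyB a) 0 z = 2 * z.1 0 + z.1 1 + z.2 0 := by
  simp [dX, fderiv_familyB_apply]

theorem dX_familyB_one (a : ℝ) (z : Plane × Plane) :
    dX (familyB a) 1 z = z.1 0 + 2 * a * z.1 1 + z.2 1 := by
  simp [dX, fderiv_familyB_apply]

theorem conormal_familyB (a : ℝ) (z : Plane × Plane) : conormal (familyB a) z = (z.2, z.1) := by
  refine Prod.ext rfl ?_
  ext i
  fin_cases i <;> simp [conormal, dQ, fderiv_familyB_apply]

/-- The family `F_a` generates `S_M(𝕃)`, where `M` is the Hessian of `x ↦ F_a(x, 0)`. -/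
theorem map_quadMap_cornerL (a : ℝ) (σ : Set (Fin 2)) :
    map (quadMap ![2, 1, 2 * a]) (𝓝[cornerL σ] 0) =
      map (conormal (familyB a)) (𝓝[critSet (familyB a) σ] 0) := by
  set M : Fin 3 → ℝ := ![2, 1, 2 * a] with hM
  set κ : Phase → Plane × Plane := fun z => (quadMap M z).swap with hκ
  have hκn : map κ (𝓝 0) = 𝓝 0 := by
    obtain ⟨e, he⟩ := (isSympLin_quadMap M).exists_equiv
    have h1 := (e.toHomeomorph.trans (Homeomorph.prodComm Plane Plane)).map_nhds_eq 0
    have h2 : κ = e.toHomeomorph.trans (Homeomorph.prodComm Plane Plane) := by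
      funext z
      simp only [hκ, ← he]
      rfl
    have h3 : κ 0 = 0 := by simp [hκ]
    rwa [← h2, h3] at h1
  have hκm : ∀ z, κ z ∈ critSet (familyB a) σ ↔ z ∈ cornerL σ := by
    intro z
    have h0 : dX (familyB a) 0 (κ z) = -z.2 0 := by
      rw [dX_familyB_zero]; simp [hκ, quadMap_apply, hM]
    have h1 : dX (familyB a) 1 (κ z) = -z.2 1 := by
      rw [dX_familyB_one]; simp [hκ, quadMap_apply, hM]
    have h : ∀ i, dX (familyB a) i (κ z) = -z.2 i := fun i => by
      fin_cases i
      · exact h0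
      · exact h1
    have hf : (κ z).1 = z.1 := rfl
    simp only [critSet, cornerL, Set.mem_ofPred_eq, h, hf, neg_eq_zero, and_comm]
  have hpre : cornerL σ = κ ⁻¹' critSet (familyB a) σ := Set.ext fun z => (hκm z).symm
  have hcomp : ⇑(quadMap M) = conormal (familyB a) ∘ κ := by
    funext z
    simp only [Function.comp, conormal_familyB, hκ, Prod.fst_swap, Prod.snd_swap, Prod.mk.eta]
  rw [hcomp, ← map_map, hpre, nhdsWithin, map_inf_principal_preimage, hκn]
  rfl

/-- `(q, p) ↦ (q, -p)`. -/
def reflect (z : Phase) : Phase := (z.1, -z.2)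

theorem dX_neg (F : Plane × Plane → ℝ) (i : Fin 2) (z : Plane × Plane) :
    dX (-F) i z = -dX F i z := by
  simp [dX, fderiv_neg]

theorem conormal_neg (F : Plane × Plane → ℝ) : conormal (-F) = reflect ∘ conormal F := by
  funext z
  refine Prod.ext rfl ?_
  ext i
  simp [conormal, reflect, dQ, fderiv_neg]

theorem critSet_neg (F : Plane × Plane → ℝ) (σ : Set (Fin 2)) : critSet (-F) σ = critSet F σ := by
  simp only [critSet, dX_neg, neg_eq_zero]

theorem map_reflect_cornerL (σ : Set (Fin 2)) : map reflect (𝓝[cornerL σ] 0) = 𝓝[cornerL σ] 0 := by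
  refine map_nhdsWithin_of_mem_iff ?_ (Eventually.of_forall fun z => ?_)
  · have := ((Homeomorph.refl Plane).prodCongr (Homeomorph.neg Plane)).map_nhds_eq 0
    have h2 : reflect = (Homeomorph.refl Plane).prodCongr (Homeomorph.neg Plane) := rfl
    have h3 : reflect 0 = 0 := by simp [reflect]
    rwa [← h2, h3] at this
  · simp [reflect, cornerL]

theorem reflect_quadMap_reflect (M : Fin 3 → ℝ) :
    reflect ∘ quadMap M ∘ reflect = signedQuad (-1) M := by
  funext z
  ext i <;> fin_cases i <;> simp [reflect, quadMap_apply, signedQuad] <;> ring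

theorem map_reflect_quadMap (M : Fin 3 → ℝ) (σ : Set (Fin 2)) :
    map (reflect ∘ quadMap M) (𝓝[cornerL σ] 0) = map (signedQuad (-1) M) (𝓝[cornerL σ] 0) := by
  rw [← reflect_quadMap_reflect]
  conv_lhs => rw [← map_reflect_cornerL σ]
  rw [map_map]
  rfl

theorem map_of_isGeneratingFamily_neg {F : Plane × Plane → ℝ} {S T : Phase → Phase}
    (h : IsGeneratingFamily F S) (h' : IsGeneratingFamily (-F) T) (σ : Set (Fin 2)) :
    map T (𝓝[cornerL σ] 0) = map reflect (map S (𝓝[cornerL σ] 0)) := by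
  rw [h'.generates, h.generates, conormal_neg, critSet_neg, map_map]

theorem IsGeneratingFamily.neg {F : Plane × Plane → ℝ} {S T : Phase → Phase}
    (h : IsGeneratingFamily F S)
    (hT : ∀ σ, map T (𝓝[cornerL σ] 0) = map reflect (map S (𝓝[cornerL σ] 0))) :
    IsGeneratingFamily (-F) T where
  smooth := ⟨by simp [h.smooth.1], h.smooth.2.mono fun z hz => hz.neg⟩
  critical := by rw [fderiv_neg, h.critical, neg_zero]
  nondegenerate := by
    have h1 := h.nondegenerate.units_smul (Sum.elim (fun _ => 1) fun _ => -1)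
    convert h1 using 1
    funext i
    rcases i with i | i
    · simp
    · have : dX (-F) i = -dX F i := funext (dX_neg F i)
      simp [this, fderiv_neg, Units.smul_def]
  generates := fun σ => by rw [hT, h.generates, conormal_neg, critSet_neg, map_map]

/-! ### Immersed manifolds from parametrizations -/

open Classical in
theorem mfderiv_subtypeVal_injective {d : ℕ}
    (U : TopologicalSpace.Opens (EuclideanSpace ℝ (Fin d))) (x : U) :
    Function.Injective (mfderiv (𝓡 d) (𝓡 d) (Subtype.val : U → EuclideanSpace ℝ (Fin d)) x) := by
  set r : EuclideanSpace ℝ (Fin d) → U := fun y => if h : y ∈ U then ⟨y, h⟩ else x with hr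
  have hrx : ∀ y : U, r y = y := fun y => by simp [hr]
  have hU : ∀ᶠ y in 𝓝 (x : EuclideanSpace ℝ (Fin d)), y ∈ U := U.isOpen.mem_nhds x.2
  have h1 : ContMDiffAt (𝓡 d) (𝓡 d) ∞ r (x : EuclideanSpace ℝ (Fin d)) := by
    rw [← ContMDiffAt.subtypeVal_comp_iff]
    refine (contMDiffAt_id (I := 𝓡 d)).congr_of_eventuallyEq ?_
    filter_upwards [hU] with y hy
    simp [hr, hy]
  have h2 : ContMDiffAt (𝓡 d) (𝓡 d) ∞ (Subtype.val : U → EuclideanSpace ℝ (Fin d)) x :=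
    contMDiff_subtype_val.contMDiffAt
  have h3 := mfderiv_comp x (h1.mdifferentiableAt (by simp)) (h2.mdifferentiableAt (by simp))
  rw [show r ∘ (Subtype.val : U → EuclideanSpace ℝ (Fin d)) = id from funext hrx, mfderiv_id] at h3
  intro v w hvw
  have h4 : ∀ v, v = mfderiv (𝓡 d) (𝓡 d) r x (mfderiv (𝓡 d) (𝓡 d) Subtype.val x v) :=
    fun v => DFunLike.congr_fun h3 v
  rw [h4 v, hvw, ← h4 w]

theorem isImmersedManifoldIn_of_parametrization {V : Type*} [NormedAddCommGroup V]
    [NormedSpace ℝ V] {N W : Set V} {d : ℕ} {U : Set (EuclideanSpace ℝ (Fin d))} (hU : IsOpen U)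
    {Φ : EuclideanSpace ℝ (Fin d) → V} (hs : ∀ x ∈ U, ContDiffAt ℝ ∞ Φ x) (hinj : Set.InjOn Φ U)
    (himm : ∀ x ∈ U, ∀ v, fderiv ℝ Φ x v = 0 → v = 0) (hNW : W ⊆ N) (hW : Φ '' U = W) :
    IsImmersedManifoldIn N W := by
  let M : TopologicalSpace.Opens (EuclideanSpace ℝ (Fin d)) := ⟨U, hU⟩
  refine ⟨hNW, d, M, inferInstance, inferInstance, inferInstance, inferInstance, inferInstance,
    fun x => Φ x, fun x => ?_, fun x y hxy => ?_, fun x => ?_, ?_⟩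
  · exact (hs x x.2).contMDiffAt.comp x contMDiff_subtype_val.contMDiffAt
  · exact Subtype.ext (hinj x.2 y.2 hxy)
  · have h1 : MDifferentiableAt (𝓡 d) 𝓘(ℝ, V) Φ x :=
      (hs x x.2).contMDiffAt.mdifferentiableAt (by simp)
    have h2 : MDifferentiableAt (𝓡 d) (𝓡 d) (Subtype.val : M → EuclideanSpace ℝ (Fin d)) x :=
      (contMDiff_subtype_val (n := ∞)).contMDiffAt.mdifferentiableAt (by simp)
    have h3 := mfderiv_comp x h1 h2
    rw [mfderiv_eq_fderiv] at h3
    change Function.Injective (mfderiv (𝓡 d) 𝓘(ℝ, V) (Φ ∘ Subtype.val) x)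
    rw [h3]
    have h4 : Function.Injective (fderiv ℝ Φ x) :=
      (injective_iff_map_eq_zero _).2 fun v hv => himm x x.2 v hv
    exact h4.comp (mfderiv_subtypeVal_injective M x)
  · rw [← hW, Set.image_eq_range]
    rfl

/-! ### The weak caustic-equivalence class -/

theorem IsGeneratingFamily.map_eq_signedQuad_one {a : ℝ} {S : Phase → Phase}
    (h : IsGeneratingFamily (familyB a) S) (σ : Set (Fin 2)) :
    map S (𝓝[cornerL σ] 0) = map (signedQuad 1 ![2, 1, 2 * a]) (𝓝[cornerL σ] 0) := by
  have : signedQuad 1 ![2, 1, 2 * a] = quadMap ![2, 1, 2 * a] := by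
    refine ContinuousLinearMap.ext fun z => ?_
    simp [signedQuad]
  rw [h.generates, ← map_quadMap_cornerL, this]

theorem map_reflect_eq_signedQuad_neg_one {a : ℝ} {S : Phase → Phase}
    (h : IsGeneratingFamily (familyB a) S) (σ : Set (Fin 2)) :
    map reflect (map S (𝓝[cornerL σ] 0)) =
      map (signedQuad (-1) ![2, 1, 2 * a]) (𝓝[cornerL σ] 0) := by
  rw [h.generates, ← map_quadMap_cornerL, map_map, map_reflect_quadMap]

theorem mem_sympJets_of_mem_causticClass {l : ℕ} {S S' : Phase → Phase}
    (h : S' ∈ causticClass S) : jet l S' ∈ sympJets l := by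
  rcases h with h | ⟨_, _, _, _, _, h⟩ <;> exact ⟨S', h.1, rfl⟩

theorem weakCausticJets_eq (n : ℕ) {S : ℝ → Phase → Phase}
    (hS : ∀ a : ℝ, 1 / 4 < a → IsSympGerm (S a))
    (hF : ∀ a : ℝ, 1 / 4 < a → IsGeneratingFamily (familyB a) (S a)) :
    weakCausticJets (n + 1) S = (fun t => jet (n + 1) (germOf t)) '' paramSet n := by
  ext y
  simp only [weakCausticJets, Set.mem_iUnion, causticJets, Set.mem_image]
  constructor
  · rintro ⟨a, ha, S', hS', rfl⟩
    have ha' : (1 : ℝ) / 4 < a := ha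
    have hM : (0 : ℝ) < (![2, 1, 2 * a] : Fin 3 → ℝ) 0 * (![2, 1, 2 * a] : Fin 3 → ℝ) 1 := by simp
    have hM' : (0 : ℝ) < (![2, 1, 2 * a] : Fin 3 → ℝ) 0 * (![2, 1, 2 * a] : Fin 3 → ℝ) 2 -
        (![2, 1, 2 * a] : Fin 3 → ℝ) 1 ^ 2 := by
      simp; linarith
    rcases hS' with h | ⟨F, T, hFS, hT, hFT, h⟩
    · obtain ⟨t, ht, e⟩ := exists_params_of_mem_lagrangianClass (one_mul 1) hM hM' (hS a ha')
        (hF a ha').map_eq_signedQuad_one h n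
      exact ⟨t, ht, e.symm⟩
    · obtain ⟨t, ht, e⟩ := exists_params_of_mem_lagrangianClass (ε := -1) (by norm_num) hM hM' hT
        (fun σ => by rw [map_of_isGeneratingFamily_neg hFS hFT,
          map_reflect_eq_signedQuad_neg_one (hF a ha')]) h n
      exact ⟨t, ht, e.symm⟩
  · rintro ⟨t, ⟨hdet, h01, hpos⟩, rfl⟩
    rcases lt_or_gt_of_ne (show t.2.2.1 0 ≠ 0 from fun h => by simp [h] at h01) with h0 | h0
    · have h1 : t.2.2.1 1 < 0 := neg_of_mul_pos_right h01 h0.le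
      obtain ⟨a, ha, D, hD, he⟩ := exists_eq_conjDiag (N := -t.2.2.1) (by simpa using h0)
        (by simpa using h1) (by simpa using hpos)
      refine ⟨a, ha, germOf t, Or.inr ⟨familyB a, signedQuad (-1) ![2, 1, 2 * a], hF a ha,
        (isSympLin_signedQuad (by norm_num) _).isSympGerm, (hF a ha).neg fun σ =>
          (map_reflect_eq_signedQuad_neg_one (hF a ha) σ).symm, ?_⟩, rfl⟩
      refine germOf_mem_lagrangianClass (by norm_num) hD
        (isSympLin_signedQuad (by norm_num) _).isSympGerm (fun σ => rfl) hdet ?_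
      rw [neg_eq_iff_eq_neg.1 he]
      ext i; fin_cases i <;> simp [conjDiag]
    · have h1 : 0 < t.2.2.1 1 := pos_of_mul_pos_right h01 h0.le
      obtain ⟨a, ha, D, hD, he⟩ := exists_eq_conjDiag h0 h1 hpos
      exact ⟨a, ha, germOf t, Or.inl (germOf_mem_lagrangianClass (one_mul 1) hD (hS a ha)
        (hF a ha).map_eq_signedQuad_one hdet (by rw [he, one_smul])), rfl⟩

theorem injOn_jet_germOf (n : ℕ) :
    Set.InjOn (fun t : Params n => jet (n + 1) (germOf t)) (paramSet n) := by
  intro t ht t' _ h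
  have h' : jet (n + 1) (germOf t) = jet (n + 1) (germOf t') := h
  have : JetStationary t (t' - t) := by
    intro L b hb
    have := hb 1
    rw [one_smul, one_smul, add_sub_cancel, h'] at this
    exact left_eq_add.1 this
  exact (sub_eq_zero.1 (this.eq_zero ht)).symm

theorem isImmersedManifoldIn_weakCausticJets (n : ℕ) {S : ℝ → Phase → Phase}
    (hS : ∀ a : ℝ, 1 / 4 < a → IsSympGerm (S a))
    (hF : ∀ a : ℝ, 1 / 4 < a → IsGeneratingFamily (familyB a) (S a)) :
    IsImmersedManifoldIn (sympJets (n + 1)) (weakCausticJets (n + 1) S) := by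
  let e : EuclideanSpace ℝ (Fin (Module.finrank ℝ (Params n))) ≃ₗ[ℝ] Params n :=
    LinearEquiv.ofFinrankEq _ _ finrank_euclideanSpace_fin
  let g : EuclideanSpace ℝ (Fin (Module.finrank ℝ (Params n))) →ₗ[ℝ] Fin 4 → ℝ :=
    { toFun := fun s => (e s).1, map_add' := fun s s' => by simp, map_smul' := fun c s => by simp }
  let w : EuclideanSpace ℝ (Fin (Module.finrank ℝ (Params n))) →ₗ[ℝ] Fin 3 → ℝ :=
    { toFun := fun s => (e s).2.1, map_add' := fun s s' => by simp,
      map_smul' := fun c s => by simp }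
  let M : EuclideanSpace ℝ (Fin (Module.finrank ℝ (Params n))) →ₗ[ℝ] Fin 3 → ℝ :=
    { toFun := fun s => (e s).2.2.1, map_add' := fun s s' => by simp,
      map_smul' := fun c s => by simp }
  let h : EuclideanSpace ℝ (Fin (Module.finrank ℝ (Params n))) →ₗ[ℝ]
      (j : Fin n) → lagPoly (j + 3) :=
    { toFun := fun s => (e s).2.2.2.1, map_add' := fun s s' => by simp,
      map_smul' := fun c s => by simp }
  let K : EuclideanSpace ℝ (Fin (Module.finrank ℝ (Params n))) →ₗ[ℝ]
      (j : Fin n) → retPoly (j + 3) :=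
    { toFun := fun s => (e s).2.2.2.2, map_add' := fun s s' => by simp,
      map_smul' := fun c s => by simp }
  have hg : Continuous g := LinearMap.continuous_of_finiteDimensional g
  have hMc : Continuous M := LinearMap.continuous_of_finiteDimensional M
  have hopen : IsOpen (e ⁻¹' paramSet n) := by
    have h1 : IsOpen {s | detMap (g s) ≠ 0} :=
      isOpen_ne_fun (by simp only [detMap]; fun_prop) continuous_const
    have h2 : IsOpen {s | 0 < M s 0 * M s 1} := isOpen_lt continuous_const (by fun_prop)
    have h3 : IsOpen {s | 0 < M s 0 * M s 2 - M s 1 ^ 2} :=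
      isOpen_lt continuous_const (by fun_prop)
    exact h1.inter (h2.inter h3)
  have hsm : ∀ s ∈ e ⁻¹' paramSet n,
      ContDiffAt ℝ ∞ (fun s => jet (n + 1) (germOf (e s))) s := fun s hs =>
    contDiffAt_jet_germOf g w M h K hs.1
  refine isImmersedManifoldIn_of_parametrization hopen hsm ?_ ?_ ?_ ?_
  · exact (injOn_jet_germOf n).comp e.injective.injOn fun s hs => hs
  · intro s hs v hv
    have : JetStationary (e s) (e v) := by
      intro L b hb
      have hd := ((hsm s hs).differentiableAt (by simp)).hasFDerivAt
      have hl : HasDerivAt (fun r : ℝ => s + r • v) v 0 := by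
        simpa using ((hasDerivAt_id (0 : ℝ)).smul_const v).const_add s
      have hd0 : HasFDerivAt (fun s => jet (n + 1) (germOf (e s)))
          (fderiv ℝ (fun s => jet (n + 1) (germOf (e s))) s) (s + (0 : ℝ) • v) := by
        simpa using hd
      have h1 := L.hasFDerivAt.comp_hasDerivAt (0 : ℝ) (hd0.comp_hasDerivAt (0 : ℝ) hl)
      have h2 : HasDerivAt (fun r : ℝ => L (jet (n + 1) (germOf (e s))) + r • b) b 0 := by
        simpa using ((hasDerivAt_id (0 : ℝ)).smul_const b).const_add
          (L (jet (n + 1) (germOf (e s))))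
      have h3 := (h1.congr_of_eventuallyEq (Eventually.of_forall fun r => ?_)).unique h2
      · rw [hv, map_zero] at h3
        exact h3.symm
      · simp only [Function.comp, map_add, map_smul]
        exact (hb r).symm
    exact e.map_eq_zero_iff.1 (this.eq_zero hs)
  · intro y hy
    simp only [weakCausticJets, Set.mem_iUnion] at hy
    obtain ⟨a, -, S', hS', rfl⟩ := hy
    exact mem_sympJets_of_mem_causticClass hS'
  · rw [weakCausticJets_eq n hS hF]
    ext y
    constructor
    · rintro ⟨s, hs, rfl⟩
      exact ⟨e s, hs, rfl⟩
    · rintro ⟨t, ht, rfl⟩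
      exact ⟨e.symm t, by simpa using ht, by simp⟩

end RetLag

theorem proposition4p1 (l : ℕ) (hl : 1 ≤ l) (S : ℝ → RetLag.Phase → RetLag.Phase)
    (hS : ∀ a : ℝ, 1 / 4 < a → RetLag.IsSympGerm (S a))
    (hF : ∀ a : ℝ, 1 / 4 < a → RetLag.IsGeneratingFamily (RetLag.familyB a) (S a)) :
    RetLag.IsImmersedManifoldIn (RetLag.sympJets l) (RetLag.weakCausticJets l S) := by
  obtain ⟨n, rfl⟩ := Nat.exists_eq_add_of_le' hl
  exact RetLag.isImmersedManifoldIn_weakCausticJets n hS hF
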